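/- **Theorem (Boundary Carleman estimate).** Let $m,n\ge 1$. On $\mathbb R^{m+n}$, with coordinates $(t,x)\in\mathbb R^m\times\mathbb R^n$, consider the flat metric $g=-dt_1^2-\dots-dt_m^2+dx_1^2+\dots+dx_n^2$ and the ultrahyperbolic operator $\square=-\sum_{i=1}^m\partial_{t_i}^2+\sum_{k=1}^n\partial_{x_k}^2$. Put $$r=|x|,\quad \tau=|t|,\quad u=\tfrac12(\tau-r),\quad v=\tfrac12(\tau+r),\quad f=-uv=\tfrac14(|x|^2-|t|^2),\quad \mathfrak D=\{f>0\},$$ and let $\partial_u=\partial_\tau-\partial_r$, $\partial_v=\partial_\tau+\partial_r$ be the null coordinate vector fields. Let $g^{ab}\nabla\!\!\!\!/_a z\,\nabla\!\!\!\!/_b z=|\nabla_x z|^2-(\partial_r z)^2$ and $g^{CD}\tilde\nabla_C z\,\tilde\nabla_D z=-\left(|\nabla_t z|^2-(\partial_\tau z)^2\right)$ denote the parts of $g(\nabla z,\nabla z)$ that come from the spatial and the temporal angular derivatives. For $a,b,\varepsilon>0$ let $$\zeta_{a,b;\varepsilon}=\left\{\frac{f}{(1+\varepsilon u)(1-\varepsilon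 v)}\exp\left[\frac{2bf^{1/2}}{(1+\varepsilon u)^{1/2}(1-\varepsilon v)^{1/2}}\right]\right\}^{2a}.$$ There is an absolute constant $\kappa>0$ and, for all $m,n\ge1$, there are constants $c,C,C'>0$ depending only on $m,n$ such that the following holds. Let $\mathfrak U\subset\mathbb R^{m+n}$ be an open set with $\mathfrak U\cap\mathfrak D\subseteq\{r<R\}$ for some $R>0$, whose boundary $\partial\mathfrak U$ is smooth (with $\mathfrak U$ locally on one side of it) and timelike (its $g$-normal is spacelike at every point), and let $\mathcal N$ be the outer-pointing unit normal of $\mathfrak U$ with respect to $g$. Let $\varepsilon,a,b>0$ satisfy $$a\ge(m+n)^2,\qquad \varepsilon\le c\,b,\qquad b\le\kappa R^{-1}.$$ Then for every real-valued $z\in C^2(\mathfrak U)\cap C^1(\overline{\mathfrak U})$ with $z|_{\partial\mathfrak U\cap\mathfrak D}=0$, $$C\varepsilon\int_{\mathfrak U\cap\mathfrak D}\zeta_{a,b;\varepsilon}\,r^{-1}\left(|u\partial_uz|^2+|v\partial_vz|^2+f g^{ab}\nabla\!\!\!\!/_a z\,\nabla\!\!\!\!/_b z-f g^{CD}\tilde\nabla_Cz\,\tilde\nabla_Dz\right)+Cba^2\int_{\mathfrak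 U\cap\mathfrak D}\zeta_{a,b;\varepsilon}\,f^{-1/2}z^2$$ $$\le\frac1a\int_{\mathfrak U\cap\mathfrak D}\zeta_{a,b;\varepsilon}\,f\,|\square z|^2+C'\int_{\partial\mathfrak U\cap\mathfrak D}\zeta_{a,b;\varepsilon}\left[(1-\varepsilon r)\,\mathcal Nf+\varepsilon f\,\mathcal Nr\right]|\mathcal Nz|^2 .$$ The integrals are taken with respect to the volume forms induced by $g$. The two integrals on the left and the boundary integral converge absolutely; the integral of $\zeta_{a,b;\varepsilon}f|\square z|^2$ may be $+\infty$, in which case the inequality is trivial. -/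

import Mathlib

open MeasureTheory Set Filter Topology
open scoped ContDiff

namespace Ultrahyperbolic

/-- `ℝ^{m+n}` with coordinates `(t, x) = (t₁, …, t_m, x₁, …, x_n)`: the index `Sum.inl i` is the
time coordinate `t_i` and `Sum.inr k` is the space coordinate `x_k`. -/
abbrev Spacetime (m n : ℕ) : Type := EuclideanSpace ℝ (Fin m ⊕ Fin n)

variable {m n : ℕ}

/-- The time part `t ∈ ℝ^m` of a point. -/
noncomputable def timePart (p : Spacetime m n) : EuclideanSpace ℝ (Fin m) :=
  WithLp.toLp 2 fun i => p (Sum.inl i)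

/-- The space part `x ∈ ℝ^n` of a point. -/
noncomputable def spacePart (p : Spacetime m n) : EuclideanSpace ℝ (Fin n) :=
  WithLp.toLp 2 fun k => p (Sum.inr k)

/-- The flat metric `g = -dt₁² - ⋯ - dt_m² + dx₁² + ⋯ + dx_n²`. -/
noncomputable def metric (X Y : Spacetime m n) : ℝ :=
  -(∑ i : Fin m, X (Sum.inl i) * Y (Sum.inl i)) + ∑ k : Fin n, X (Sum.inr k) * Y (Sum.inr k)

/-- `r = |x|`. -/
noncomputable def rad (p : Spacetime m n) : ℝ := ‖spacePart p‖

/-- `τ = |t|`. -/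
noncomputable def tau (p : Spacetime m n) : ℝ := ‖timePart p‖

/-- The null coordinate `u = (τ - r) / 2`. -/
noncomputable def nullU (p : Spacetime m n) : ℝ := (tau p - rad p) / 2

/-- The null coordinate `v = (τ + r) / 2`. -/
noncomputable def nullV (p : Spacetime m n) : ℝ := (tau p + rad p) / 2

/-- `f = -u v`. -/
noncomputable def fFun (p : Spacetime m n) : ℝ := -(nullU p * nullV p)

theorem fFun_eq (p : Spacetime m n) :
    fFun p = (‖spacePart p‖ ^ 2 - ‖timePart p‖ ^ 2) / 4 := by
  simp only [fFun, nullU, nullV, rad, tau]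
  ring

/-- The region `𝔇 = {f > 0}`, the exterior `{|x| > |t|}` of the null cone. -/
def coneExterior (m n : ℕ) : Set (Spacetime m n) := {p | 0 < fFun p}

/-- The Cartesian partial derivative `∂_α z`. -/
noncomputable def partialDeriv (α : Fin m ⊕ Fin n) (z : Spacetime m n → ℝ) (p : Spacetime m n) :
    ℝ :=
  fderiv ℝ z p (EuclideanSpace.single α 1)

/-- The ultrahyperbolic operator
`□ z = g^{αβ} ∇_α ∇_β z = -∑ ∂²z/∂t_i² + ∑ ∂²z/∂x_k²`. -/
noncomputable def box (z : Spacetime m n → ℝ) (p : Spacetime m n) : ℝ :=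
  -(∑ i : Fin m, partialDeriv (Sum.inl i) (partialDeriv (Sum.inl i) z) p)
    + ∑ k : Fin n, partialDeriv (Sum.inr k) (partialDeriv (Sum.inr k) z) p

/-- The coordinate vector field `∂_τ = (t/|t|, 0)` (used where `τ ≠ 0`). -/
noncomputable def dTau (p : Spacetime m n) : Spacetime m n :=
  WithLp.toLp 2 (Sum.elim (fun i => p (Sum.inl i) / tau p) (fun _ => 0))

/-- The coordinate vector field `∂_r = (0, x/|x|)` (used where `r ≠ 0`). -/
noncomputable def dRad (p : Spacetime m n) : Spacetime m n :=
  WithLp.toLp 2 (Sum.elim (fun _ => 0) (fun k => p (Sum.inr k) / rad p))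

/-- The null coordinate vector field `∂_u = ∂_τ - ∂_r` (since `τ = u + v`, `r = v - u`). -/
noncomputable def dU (p : Spacetime m n) : Spacetime m n := dTau p - dRad p

/-- The null coordinate vector field `∂_v = ∂_τ + ∂_r`. -/
noncomputable def dV (p : Spacetime m n) : Spacetime m n := dTau p + dRad p

/-- The spatial gradient `∇_x z ∈ ℝ^n`. -/
noncomputable def gradSpace (z : Spacetime m n → ℝ) (p : Spacetime m n) :
    EuclideanSpace ℝ (Fin n) :=
  WithLp.toLp 2 fun k => partialDeriv (Sum.inr k) z p

/-- The temporal gradient `∇_t z ∈ ℝ^m`. -/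
noncomputable def gradTime (z : Spacetime m n → ℝ) (p : Spacetime m n) :
    EuclideanSpace ℝ (Fin m) :=
  WithLp.toLp 2 fun i => partialDeriv (Sum.inl i) z p

/-- The spatial angular quantity `g^{ab} ∇̸_a z ∇̸_b z`. The metric induced by `g` on the sphere
`{|x| = r}` is the Euclidean one, so this is the squared length of the component of `∇_x z` that is
tangent to that sphere. -/
noncomputable def spaceAngular (z : Spacetime m n → ℝ) (p : Spacetime m n) : ℝ :=
  ‖gradSpace z p - (fderiv ℝ z p (dRad p)) • ((rad p)⁻¹ • spacePart p)‖ ^ 2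

/-- The temporal angular quantity `g^{CD} ∇̃_C z ∇̃_D z`. The metric induced by `g` on the sphere
`{|t| = τ}` is minus the Euclidean one, so this is minus the squared length of the component of
`∇_t z` that is tangent to that sphere. -/
noncomputable def timeAngular (z : Spacetime m n → ℝ) (p : Spacetime m n) : ℝ :=
  -‖gradTime z p - (fderiv ℝ z p (dTau p)) • ((tau p)⁻¹ • timePart p)‖ ^ 2

/-- The Carleman weight
`ζ = { f / ((1 + εu)(1 - εv)) · exp[2 b f^{1/2} / ((1 + εu)^{1/2} (1 - εv)^{1/2})] }^{2a}`. -/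
noncomputable def carlemanWeight (a b ε : ℝ) (p : Spacetime m n) : ℝ :=
  (fFun p / ((1 + ε * nullU p) * (1 - ε * nullV p)) *
    Real.exp (2 * b * Real.sqrt (fFun p) /
      (Real.sqrt (1 + ε * nullU p) * Real.sqrt (1 - ε * nullV p)))) ^ (2 * a)

/-- `φ` is a smooth defining function of `U` near the boundary point `p`: near `p`, `U` is
`{φ < 0}`, and `φ` vanishes at `p` with nonzero differential. The tangent space of `∂U` at `p` is
then the kernel of the differential of `φ` at `p`. -/
structure IsDefiningFunction (U : Set (Spacetime m n)) (p : Spacetime m n)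
    (φ : Spacetime m n → ℝ) : Prop where
  smooth : ContDiff ℝ ∞ φ
  eq_zero : φ p = 0
  locally_eq : ∀ᶠ q in 𝓝 p, (q ∈ U ↔ φ q < 0)
  fderiv_ne_zero : fderiv ℝ φ p ≠ 0

/-- `∂U` is a smooth hypersurface with `U` locally on one side of it. -/
def HasSmoothBoundary (U : Set (Spacetime m n)) : Prop :=
  ∀ p ∈ frontier U, ∃ φ, IsDefiningFunction U p φ

/-- `X` is `g`-normal to the boundary of `U` at `p`. -/
def IsNormalAt (U : Set (Spacetime m n)) (p X : Spacetime m n) : Prop :=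
  ∀ φ, IsDefiningFunction U p φ → ∀ Y, fderiv ℝ φ p Y = 0 → metric X Y = 0

/-- `∂U` is timelike: its nonzero `g`-normal vectors are spacelike. -/
def HasTimelikeBoundary (U : Set (Spacetime m n)) : Prop :=
  ∀ p ∈ frontier U, ∀ X, X ≠ 0 → IsNormalAt U p X → 0 < metric X X

/-- `N` is the outer-pointing unit normal, with respect to `g`, of `U` at the boundary point `p`
of a smooth timelike boundary. -/
structure IsOuterUnitNormal (U : Set (Spacetime m n)) (p N : Spacetime m n) : Prop where
  normal : IsNormalAt U p N
  unit : metric N N = 1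
  outward : ∀ φ, IsDefiningFunction U p φ → 0 < fderiv ℝ φ p N

/-- The surface measure on `∂U` given by the volume form that `g` induces on `∂U`, where `𝒩`
is the `g`-unit normal field. The induced volume form is the contraction of the volume form
`dt dx` of `g` with `𝒩`; with respect to Euclidean surface measure its density is the Euclidean
length of the component of `𝒩` along the Euclidean unit normal `ν`. If `J` flips the sign of the
time components, then `ν = ± J𝒩 / ‖𝒩‖`, so the density is `|g(𝒩, 𝒩)| / ‖𝒩‖ = 1 / ‖𝒩‖`. -/
noncomputable def inducedSurfaceMeasure (𝒩 : Spacetime m n → Spacetime m n) :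
    Measure (Spacetime m n) :=
  (Measure.euclideanHausdorffMeasure (m + n - 1)).withDensity fun p => ENNReal.ofReal ‖𝒩 p‖⁻¹

/-- The first-order integrand
`ζ r⁻¹ (|u ∂_u z|² + |v ∂_v z|² + f g^{ab} ∇̸_a z ∇̸_b z - f g^{CD} ∇̃_C z ∇̃_D z)`. -/
noncomputable def firstOrderDensity (a b ε : ℝ) (z : Spacetime m n → ℝ) (p : Spacetime m n) : ℝ :=
  carlemanWeight a b ε p * (rad p)⁻¹ *
    (|nullU p * fderiv ℝ z p (dU p)| ^ 2 + |nullV p * fderiv ℝ z p (dV p)| ^ 2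
      + fFun p * spaceAngular z p - fFun p * timeAngular z p)

/-- The zeroth-order integrand `ζ f^{-1/2} z²`. -/
noncomputable def zeroOrderDensity (a b ε : ℝ) (z : Spacetime m n → ℝ) (p : Spacetime m n) : ℝ :=
  carlemanWeight a b ε p * (Real.sqrt (fFun p))⁻¹ * z p ^ 2

/-- The source integrand `ζ f |□z|²`. -/
noncomputable def boxDensity (a b ε : ℝ) (z : Spacetime m n → ℝ) (p : Spacetime m n) : ℝ :=
  carlemanWeight a b ε p * fFun p * |box z p| ^ 2

/-- The boundary integrand `ζ [(1 - ε r) 𝒩f + ε f 𝒩r] |𝒩z|²`. The derivative of `z` at a boundary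
point is the one from within the closure of `U`. -/
noncomputable def boundaryDensity (a b ε : ℝ) (U : Set (Spacetime m n))
    (𝒩 : Spacetime m n → Spacetime m n) (z : Spacetime m n → ℝ) (p : Spacetime m n) : ℝ :=
  carlemanWeight a b ε p *
    ((1 - ε * rad p) * fderiv ℝ fFun p (𝒩 p) + ε * fFun p * fderiv ℝ rad p (𝒩 p)) *
    |fderivWithin ℝ z (closure U) p (𝒩 p)| ^ 2

end Ultrahyperbolic

/-!
The estimate comes from integrating the divergence of a weighted current over `U ∩ {f > 0}`.

*The current.* Let `E` be the square root of the weight. Its gradient is `Γ E S`, where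
`S = (1 - ε r) ∇f + ε f ∇r` and `Γ > 0` (`hasFDerivAt_weightRoot`), so `ψ = E z` satisfies
`□ψ + 𝒜ψ = E □z + 2Γ (Sψ + wψ)` for suitable functions `w` and `𝒜` (`box_conj`). Using
`Sψ + wψ` as a multiplier gives a current `P`, quadratic in `(ψ, ∇ψ)`, whose divergence
(`divergence_weightedCurrent`) consists of `E □z (Sψ + wψ)`, the square `2Γ (Sψ + wψ)²`, a
zeroth-order term with coefficient of size `a² b f^{-1/2}`, and quadratic terms in `∇ψ` with
coefficient `ε f / r`. The source term is absorbed by half of the square. The quadratic form in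
`∇ψ` is indefinite, but it controls the full null and angular gradient once a small multiple of
`(Sψ)²` is added, because the form degenerates only in the direction that `S` differentiates. This is an
inequality between real numbers, `current_lower_bound`, and it yields the pointwise estimate
`densities_le_divergence`.

*Boundary terms.* On `∂U` the function `z` vanishes, so `∇z` is a multiple of the normal and the
flux of `P` is half the boundary density (`metric_currentField`). On the null cone `f = 0` the weight
vanishes to order at least four, so `P = O(f²)` (`IsAdmissible.bdd_current`), and multiplying `P` by
a cutoff in `f` produces no boundary term in the limit (`integral_divergence_currentField`). The
divergence of `P` is bounded by a constant plus the source density (`IsAdmissible.abs_divergence_le`),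
hence integrable whenever the source term of the estimate is finite.

*The divergence theorem.* The boundary of `U` carries a Hausdorff measure, and `P` is only continuous
up to `∂U` with integrable divergence. In a chart where a transverse direction `e` crosses `∂U` once,
the derivative along `e` is integrated on lines (`IsGraphChart.integral_fderiv`). The projection
formula `∫_B ⟪ν, e⟫ dℋ = vol (proj B)` for pieces `B` of the boundary turns the endpoint values into a
surface integral; it follows from comparing small pieces with their tangent planes, since such a
comparison is almost isometric (`exists_almost_tangent_comparison`,
`IsTransversePiece.measure_perpProj_image`). Translating the field slightly into `U` reduces the
divergence, of which only the sum is integrable, to its individual terms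
(`IsDivChart.integral_div`), and a partition of unity globalizes the result
(`integral_divergence`).
-/

section

open scoped ENNReal NNReal RealInnerProductSpace Gradient

section

open Module

/-! ### Projections along a direction and Hausdorff measure -/

section ProjectionFormula

set_option linter.unusedSectionVars false

variable {E : Type*} [NormedAddCommGroup E] [InnerProductSpace ℝ E] [FiniteDimensional ℝ E]
  [MeasurableSpace E] [BorelSpace E]

/-- The projection `x ↦ x - ⟪e, x⟫ e`, which is the orthogonal projection onto the hyperplane
`e^⊥` when `e` is a unit vector. -/
noncomputable def perpProj (e : E) : E →L[ℝ] E :=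
  ContinuousLinearMap.id ℝ E - (innerSL ℝ e).smulRight e

theorem perpProj_apply (e x : E) : perpProj e x = x - ⟪e, x⟫ • e := by
  simp [perpProj]

theorem inner_perpProj {e : E} (he : ‖e‖ = 1) (x : E) : ⟪e, perpProj e x⟫ = 0 := by
  simp [perpProj_apply, inner_sub_right, inner_smul_right, he]

theorem norm_sq_perpProj {e : E} (he : ‖e‖ = 1) (x : E) :
    ‖perpProj e x‖ ^ 2 = ‖x‖ ^ 2 - ⟪e, x⟫ ^ 2 := by
  rw [perpProj_apply, norm_sub_sq_real, inner_smul_right, norm_smul, he, real_inner_comm,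
    Real.norm_eq_abs, mul_one, sq_abs]
  ring

/-- The projection along `e` maps the hyperplane `n^⊥` to `e^⊥` with area factor `|⟪n, e⟫|`. The Gram
determinant reduces, by the matrix determinant lemma, to `1 - |proj e|²` with `proj` onto `n^⊥`. -/
theorem normDet_perpProj_subtype {e n : E} (he : ‖e‖ = 1) (hn : ‖n‖ = 1) :
    ((perpProj e : E →ₗ[ℝ] E) ∘ₗ ((ℝ ∙ n)ᗮ).subtype).normDet = |⟪n, e⟫| := by
  have hsq : ((perpProj e : E →ₗ[ℝ] E) ∘ₗ ((ℝ ∙ n)ᗮ).subtype).normDet ^ 2 = ⟪n, e⟫ ^ 2 := by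
    have h1 := LinearMap.normDet_sq_eq_det_gram
      ((perpProj e : E →ₗ[ℝ] E) ∘ₗ ((ℝ ∙ n)ᗮ).subtype) (stdOrthonormalBasis ℝ ((ℝ ∙ n)ᗮ))
    set b := stdOrthonormalBasis ℝ ((ℝ ∙ n)ᗮ)
    simp only [RCLike.ofReal_real_eq_id, id] at h1
    rw [h1]
    have h2 : (Matrix.gram ℝ fun x => ((perpProj e : E →ₗ[ℝ] E) ∘ₗ ((ℝ ∙ n)ᗮ).subtype) (b x)) =
        1 + Matrix.replicateCol Unit (fun i => -⟪e, (b i : E)⟫) *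
          Matrix.replicateRow Unit (fun i => ⟪e, (b i : E)⟫) := by
      ext i j
      have hb : ⟪(b i : E), (b j : E)⟫ = if i = j then 1 else 0 := by
        have := orthonormal_iff_ite.1 b.orthonormal i j
        simpa using this
      simp [Matrix.gram, perpProj_apply, inner_sub_left, inner_sub_right, inner_smul_left,
        inner_smul_right, he, hb, Matrix.mul_apply, Matrix.one_apply, real_inner_comm]
      ring
    rw [h2, Matrix.det_one_add_replicateCol_mul_replicateRow]
    have h3 : ∑ i, ⟪e, (b i : E)⟫ ^ 2 = 1 - ⟪n, e⟫ ^ 2 := by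
      have h7 : (((ℝ ∙ n)ᗮ.orthogonalProjectionOnto e : (ℝ ∙ n)ᗮ) : E) = perpProj n e := by
        rw [Submodule.coe_orthogonalProjectionOnto_apply, perpProj_apply,
          Submodule.starProjection_orthogonal_val, Submodule.starProjection_unit_singleton ℝ hn]
      have h4 := b.sum_sq_norm_inner_right ((ℝ ∙ n)ᗮ.orthogonalProjectionOnto e)
      have h5 : ∀ i, ‖⟪b i, (ℝ ∙ n)ᗮ.orthogonalProjectionOnto e⟫‖ ^ 2 = ⟪e, (b i : E)⟫ ^ 2 := by
        intro i
        have hb : ⟪(b i : E), n⟫ = 0 :=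
          Submodule.mem_orthogonal_singleton_iff_inner_left.1 (b i).2
        rw [Submodule.coe_inner, h7, perpProj_apply, inner_sub_right, inner_smul_right, hb,
          Real.norm_eq_abs, sq_abs, real_inner_comm]
        ring
      simp only [h5] at h4
      rw [h4, Submodule.norm_coe _ |>.symm, h7, norm_sq_perpProj hn e, he]
      ring
    simp only [dotProduct]
    have : ∑ i, ⟪e, (b i : E)⟫ * -⟪e, (b i : E)⟫ = - ∑ i, ⟪e, (b i : E)⟫ ^ 2 := by
      rw [← Finset.sum_neg_distrib]
      exact Finset.sum_congr rfl fun i _ => by ring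
    rw [this, h3]; ring
  rw [← abs_of_nonneg (LinearMap.normDet_nonneg _)]
  exact sq_eq_sq_iff_abs_eq_abs _ _ |>.1 hsq

theorem finrank_orthogonal_span_unit {n : E} (hn : ‖n‖ = 1) :
    finrank ℝ ((ℝ ∙ n)ᗮ) = finrank ℝ E - 1 := by
  have h := (ℝ ∙ n).finrank_add_finrank_orthogonal
  rw [finrank_span_singleton (by rintro rfl; simp at hn)] at h
  omega

/-- Comparison of Hausdorff measures of two images of the same set under maps of which one
varies at most `s` times as fast as the other. -/
theorem euclideanHausdorffMeasure_image_le_of_dist_le {X Y Z : Type*} [MetricSpace X]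
    [MeasurableSpace X] [BorelSpace X] [MetricSpace Y] [MeasurableSpace Y] [BorelSpace Y]
    (k : ℕ) (s : ℝ≥0) (f : Z → X) (g : Z → Y) (B : Set Z)
    (h : ∀ x ∈ B, ∀ y ∈ B, dist (f x) (f y) ≤ s * dist (g x) (g y)) :
    μHE[k] (f '' B) ≤ (s : ℝ≥0∞) ^ k * μHE[k] (g '' B) := by
  rcases B.eq_empty_or_nonempty with rfl | ⟨z0, hz0⟩
  · simp
  have : Nonempty Z := ⟨z0⟩
  set q : Y → X := f ∘ Function.invFunOn g B
  have hq : ∀ z ∈ B, q (g z) = f z := by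
    intro z hz
    have hm : Function.invFunOn g B (g z) ∈ B := Function.invFunOn_mem ⟨z, hz, rfl⟩
    have he : g (Function.invFunOn g B (g z)) = g z := Function.invFunOn_eq ⟨z, hz, rfl⟩
    have := h _ hm _ hz
    rw [he, dist_self, mul_zero] at this
    exact dist_le_zero.1 this
  have hL : LipschitzOnWith s q (g '' B) := by
    refine LipschitzOnWith.of_dist_le_mul ?_
    rintro _ ⟨x, hx, rfl⟩ _ ⟨y, hy, rfl⟩
    rw [hq x hx, hq y hy]
    exact h x hx y hy
  have him : f '' B = q '' (g '' B) := by
    rw [image_image]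
    exact image_congr fun z hz => (hq z hz).symm
  rw [him]
  simp_rw [Measure.euclideanHausdorffMeasure_def, Measure.smul_apply]
  have := hL.hausdorffMeasure_image_le (d := k) (by positivity)
  rw [ENNReal.smul_def, ENNReal.smul_def, smul_eq_mul, smul_eq_mul, mul_left_comm]
  gcongr
  simpa using this

theorem euclideanHausdorffMeasure_perpProj_image {e n : E} (he : ‖e‖ = 1) (hn : ‖n‖ = 1)
    (B : Set E) (hB : ∀ x ∈ B, ⟪n, x⟫ = 0) :
    μHE[finrank ℝ E - 1] (perpProj e '' B) =
      ENNReal.ofReal |⟪n, e⟫| * μHE[finrank ℝ E - 1] B := by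
  have h1 : B = Subtype.val '' {x : (ℝ ∙ n)ᗮ | (x : E) ∈ B} := by
    ext x
    constructor
    · intro hx
      exact ⟨⟨x, Submodule.mem_orthogonal_singleton_iff_inner_right.2 (hB x hx)⟩, hx, rfl⟩
    · rintro ⟨y, hy, rfl⟩; exact hy
  have h2 := LinearMap.euclideanHausdorffMeasure_image
    ((perpProj e : E →ₗ[ℝ] E) ∘ₗ ((ℝ ∙ n)ᗮ).subtype) {x : (ℝ ∙ n)ᗮ | (x : E) ∈ B}
  rw [finrank_orthogonal_span_unit hn, normDet_perpProj_subtype he hn] at h2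
  have h3 : (((perpProj e : E →ₗ[ℝ] E) ∘ₗ ((ℝ ∙ n)ᗮ).subtype) '' {x : (ℝ ∙ n)ᗮ | (x : E) ∈ B})
      = perpProj e '' B := by
    conv_rhs => rw [h1]
    rw [image_image]; rfl
  rw [h3] at h2
  rw [h2]
  congr 1
  conv_rhs => rw [h1]
  exact (isometry_subtype_coe.euclideanHausdorffMeasure_image _).symm

/-- A set that is almost tangent to `n^⊥` is projected to `e^⊥` with area factor almost
`⟪n, e⟫`. -/
theorem exists_almost_tangent_comparison {e n : E} (he : ‖e‖ = 1) (hn : ‖n‖ = 1)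
    (hc : 0 < ⟪n, e⟫) {t : ℝ≥0} (ht : 1 < t) :
    ∃ δ : ℝ, 0 < δ ∧ ∀ B : Set E, (∀ x ∈ B, ∀ y ∈ B, |⟪n, x - y⟫| ≤ δ * ‖x - y‖) →
      μHE[finrank ℝ E - 1] (perpProj e '' B) ≤
          t * (ENNReal.ofReal ⟪n, e⟫ * μHE[finrank ℝ E - 1] B) ∧
        ENNReal.ofReal ⟪n, e⟫ * μHE[finrank ℝ E - 1] B ≤
          t * μHE[finrank ℝ E - 1] (perpProj e '' B) := by
  set k := finrank ℝ E - 1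
  set c := ⟪n, e⟫ with hcdef
  -- `s` is the admissible distortion of each of the two projections that are composed
  obtain ⟨s, hs1, hst⟩ : ∃ s : ℝ≥0, 1 < s ∧ s ^ (2 * k) ≤ t := by
    have hcont : Tendsto (fun s : ℝ≥0 => s ^ (2 * k)) (𝓝[>] 1) (𝓝 1) := by
      have : Continuous fun s : ℝ≥0 => s ^ (2 * k) := by fun_prop
      have h := this.tendsto 1
      simp only [one_pow] at h
      exact h.mono_left nhdsWithin_le_nhds
    have h := (hcont.eventually (gt_mem_nhds ht)).and self_mem_nhdsWithin
    obtain ⟨s, h1, h2⟩ := h.exists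
    exact ⟨s, h2, h1.le⟩
  have hs0 : (1 : ℝ) < s := by exact_mod_cast hs1
  have hsk : s ^ k ≤ t := le_trans (pow_le_pow_right₀ hs1.le (by omega)) hst
  have hsk' : (s : ℝ≥0∞) ^ k ≤ t := by exact_mod_cast hsk
  have hst' : (s : ℝ≥0∞) ^ k * (s : ℝ≥0∞) ^ k ≤ t := by
    rw [← pow_add, ← two_mul]; exact_mod_cast hst
  -- `δ` small enough for all the distortions to be at most `s`
  obtain ⟨δ, hδ, hδ1, hδ2, hδ3⟩ : ∃ δ : ℝ, 0 < δ ∧ 1 ≤ (s : ℝ) ^ 2 * (1 - δ ^ 2) ∧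
      1 + δ * (s / c) ≤ s ∧ 1 ≤ s * (1 - δ * (s / c)) := by
    have h1 : Tendsto (fun δ : ℝ => (s : ℝ) ^ 2 * (1 - δ ^ 2)) (𝓝[>] 0) (𝓝 ((s : ℝ) ^ 2 * (1 - 0 ^ 2))) :=
      (Continuous.tendsto (by fun_prop) 0).mono_left nhdsWithin_le_nhds
    have h2 : Tendsto (fun δ : ℝ => 1 + δ * (s / c)) (𝓝[>] 0) (𝓝 (1 + 0 * (s / c))) :=
      (Continuous.tendsto (by fun_prop) 0).mono_left nhdsWithin_le_nhds
    have h3 : Tendsto (fun δ : ℝ => s * (1 - δ * (s / c))) (𝓝[>] 0) (𝓝 (s * (1 - 0 * (s / c)))) :=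
      (Continuous.tendsto (by fun_prop) 0).mono_left nhdsWithin_le_nhds
    have e1 := h1.eventually (lt_mem_nhds (show (1 : ℝ) < (s : ℝ) ^ 2 * (1 - 0 ^ 2) by nlinarith))
    have e2 := h2.eventually (gt_mem_nhds (show (1 : ℝ) + 0 * (s / c) < s by simpa using hs0))
    have e3 := h3.eventually (lt_mem_nhds (show (1 : ℝ) < s * (1 - 0 * (s / c)) by simpa using hs0))
    obtain ⟨δ, ⟨⟨h1, h2⟩, h3⟩, h4⟩ := (((e1.and e2).and e3).and self_mem_nhdsWithin).exists
    exact ⟨δ, h4, h1.le, h2.le, h3.le⟩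
  refine ⟨δ, hδ, fun B hB => ?_⟩
  have hs00 : (0 : ℝ) < s := by linarith
  -- projection to the tangent plane
  have hP : ∀ w : E, |⟪n, w⟫| ≤ δ * ‖w‖ → ‖w‖ ≤ s * ‖perpProj n w‖ := by
    intro w hw
    have h1 := norm_sq_perpProj hn w
    have h2 : ⟪n, w⟫ ^ 2 ≤ δ ^ 2 * ‖w‖ ^ 2 := by
      rw [← sq_abs, ← mul_pow]; gcongr
    have h3 : ‖w‖ ^ 2 ≤ (s * ‖perpProj n w‖) ^ 2 := by
      rw [mul_pow, h1]
      have h4 : ‖w‖ ^ 2 * 1 ≤ ‖w‖ ^ 2 * ((s : ℝ) ^ 2 * (1 - δ ^ 2)) := by gcongr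
      have h5 : (s : ℝ) ^ 2 * ⟪n, w⟫ ^ 2 ≤ (s : ℝ) ^ 2 * (δ ^ 2 * ‖w‖ ^ 2) := by gcongr
      linarith
    exact le_of_sq_le_sq h3 (by positivity)
  have hP1 : ∀ w : E, ‖perpProj n w‖ ≤ ‖w‖ := by
    intro w
    have h1 := norm_sq_perpProj hn w
    exact le_of_sq_le_sq (by nlinarith [sq_nonneg ⟪n, w⟫]) (norm_nonneg _)
  -- projecting along `e` shrinks vectors of the tangent plane at most by the factor `c`
  have hQ : ∀ w : E, ⟪n, w⟫ = 0 → c * ‖w‖ ≤ ‖perpProj e w‖ := by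
    intro w hw
    have h1 := norm_sq_perpProj he w
    have h2 : ⟪e, w⟫ = ⟪e - c • n, w⟫ := by
      rw [inner_sub_left, inner_smul_left, hw]; simp
    have h3 : ‖e - c • n‖ ^ 2 = 1 - c ^ 2 := by
      rw [norm_sub_sq_real, inner_smul_right, norm_smul, he, hn, real_inner_comm, ← hcdef,
        Real.norm_eq_abs, mul_one, sq_abs]
      ring
    have h4 : ⟪e, w⟫ ^ 2 ≤ (1 - c ^ 2) * ‖w‖ ^ 2 := by
      rw [h2, ← h3, ← mul_pow, ← sq_abs]
      have := abs_real_inner_le_norm (e - c • n) w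
      gcongr
    refine le_of_sq_le_sq ?_ (norm_nonneg _)
    rw [mul_pow]; nlinarith
  have hE1 : ‖perpProj e n‖ ≤ 1 := by
    refine le_of_sq_le_sq ?_ (by norm_num)
    rw [norm_sq_perpProj he, hn]; nlinarith [sq_nonneg ⟪e, n⟫]
  have hdiff : ∀ w : E, ‖perpProj e w - perpProj e (perpProj n w)‖ ≤ |⟪n, w⟫| := by
    intro w
    rw [← map_sub, show w - perpProj n w = ⟪n, w⟫ • n by rw [perpProj_apply]; abel, map_smul,
      norm_smul, Real.norm_eq_abs]
    exact mul_le_of_le_one_right (abs_nonneg _) hE1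
  have hdiff2 : ∀ w : E, |⟪n, w⟫| ≤ δ * ‖w‖ →
      ‖perpProj e w - perpProj e (perpProj n w)‖ ≤
        δ * (s / c) * ‖perpProj e (perpProj n w)‖ := by
    intro w hw
    have h1 := hQ (perpProj n w) (inner_perpProj hn w)
    have h2 := hP w hw
    calc _ ≤ |⟪n, w⟫| := hdiff w
      _ ≤ δ * ‖w‖ := hw
      _ ≤ δ * (s * ‖perpProj n w‖) := by gcongr
      _ ≤ δ * (s * (‖perpProj e (perpProj n w)‖ / c)) := by
          gcongr
          rw [le_div_iff₀ hc]; linarith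
      _ = _ := by ring
  have hI1 : ∀ w : E, |⟪n, w⟫| ≤ δ * ‖w‖ →
      ‖perpProj e w‖ ≤ s * ‖perpProj e (perpProj n w)‖ := by
    intro w hw
    have h1 := hdiff2 w hw
    have h2 := norm_sub_norm_le (perpProj e w) (perpProj e (perpProj n w))
    nlinarith [norm_nonneg (perpProj e (perpProj n w))]
  have hI2 : ∀ w : E, |⟪n, w⟫| ≤ δ * ‖w‖ →
      ‖perpProj e (perpProj n w)‖ ≤ s * ‖perpProj e w‖ := by
    intro w hw
    have h1 := hdiff2 w hw
    have h2 := norm_sub_norm_le (perpProj e (perpProj n w)) (perpProj e w)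
    rw [norm_sub_rev] at h2
    nlinarith [norm_nonneg (perpProj e (perpProj n w))]
  have m1 : μHE[k] (perpProj e '' B) ≤
      (s : ℝ≥0∞) ^ k * μHE[k] ((fun x => perpProj e (perpProj n x)) '' B) := by
    refine euclideanHausdorffMeasure_image_le_of_dist_le k s _ _ B fun x hx y hy => ?_
    simpa only [dist_eq_norm, ← map_sub] using hI1 (x - y) (hB x hx y hy)
  have m2 : μHE[k] ((fun x => perpProj e (perpProj n x)) '' B) ≤
      (s : ℝ≥0∞) ^ k * μHE[k] (perpProj e '' B) := by
    refine euclideanHausdorffMeasure_image_le_of_dist_le k s _ _ B fun x hx y hy => ?_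
    simpa only [dist_eq_norm, ← map_sub] using hI2 (x - y) (hB x hx y hy)
  have m3 : μHE[k] (perpProj n '' B) ≤ μHE[k] B := by
    have := euclideanHausdorffMeasure_image_le_of_dist_le k 1 (perpProj n) id B
      fun x hx y hy => by simpa only [dist_eq_norm, ← map_sub, NNReal.coe_one, one_mul, id]
                            using hP1 (x - y)
    simpa using this
  have m4 : μHE[k] B ≤ (s : ℝ≥0∞) ^ k * μHE[k] (perpProj n '' B) := by
    have := euclideanHausdorffMeasure_image_le_of_dist_le k s id (perpProj n) B
      fun x hx y hy => by simpa only [dist_eq_norm, ← map_sub, id]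
                            using hP (x - y) (hB x hx y hy)
    simpa using this
  have m5 : μHE[k] ((fun x => perpProj e (perpProj n x)) '' B) =
      ENNReal.ofReal c * μHE[k] (perpProj n '' B) := by
    have := euclideanHausdorffMeasure_perpProj_image he hn (perpProj n '' B)
      (by rintro _ ⟨x, _, rfl⟩; exact inner_perpProj hn x)
    rw [image_image, abs_of_pos hc] at this
    exact this
  rw [m5] at m1 m2
  constructor
  · calc _ ≤ _ := m1
      _ ≤ t * (ENNReal.ofReal c * μHE[k] B) := by gcongr
  · calc ENNReal.ofReal c * μHE[k] B
        ≤ ENNReal.ofReal c * ((s : ℝ≥0∞) ^ k * μHE[k] (perpProj n '' B)) := by gcongr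
      _ = (s : ℝ≥0∞) ^ k * (ENNReal.ofReal c * μHE[k] (perpProj n '' B)) := by ring
      _ ≤ (s : ℝ≥0∞) ^ k * ((s : ℝ≥0∞) ^ k * μHE[k] (perpProj e '' B)) := by gcongr
      _ ≤ t * μHE[k] (perpProj e '' B) := by rw [← mul_assoc]; gcongr

end ProjectionFormula

/-! ### The projection formula on transverse hypersurfaces -/

section AreaFormula

set_option linter.unusedSectionVars false

variable {E : Type*} [NormedAddCommGroup E] [InnerProductSpace ℝ E] [FiniteDimensional ℝ E]
  [MeasurableSpace E] [BorelSpace E]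

/-- A hypersurface `S` with unit normal `ν`, encoded by the fact that near each of its points the
chords of `S` are almost orthogonal to `ν`, and on which the projection along `e` is injective
and transverse. -/
structure IsTransversePiece (S : Set E) (ν : E → E) (e : E) : Prop where
  meas : MeasurableSet S
  cont : ContinuousOn ν S
  norm_normal : ∀ x ∈ S, ‖ν x‖ = 1
  transverse : ∀ x ∈ S, 0 < ⟪ν x, e⟫
  tangent : ∀ q ∈ S, ∀ δ > 0, ∃ O ∈ 𝓝 q, ∀ x ∈ S ∩ O, ∀ y ∈ S ∩ O,
    |⟪ν q, x - y⟫| ≤ δ * ‖x - y‖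
  inj : InjOn (perpProj e) S

/-- Near each point the projection along `e` distorts the area element `⟪ν, e⟫ dA` by a factor as close
to one as desired, since the piece is there almost a piece of the tangent plane and `⟪ν, e⟫` is almost
constant. -/
theorem IsTransversePiece.exists_local_comparison {S : Set E} {ν : E → E} {e : E} (he : ‖e‖ = 1)
    (hS : IsTransversePiece S ν e) {t : ℝ≥0} (ht : 1 < t) {q : E} (hq : q ∈ S) :
    ∃ O : Set E, IsOpen O ∧ q ∈ O ∧ ∀ B ⊆ S ∩ O, MeasurableSet B →
      μHE[finrank ℝ E - 1] (perpProj e '' B) ≤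
        (t : ℝ≥0∞) ^ 2 * ∫⁻ x in B, ENNReal.ofReal ⟪ν x, e⟫ ∂μHE[finrank ℝ E - 1] ∧
      ∫⁻ x in B, ENNReal.ofReal ⟪ν x, e⟫ ∂μHE[finrank ℝ E - 1] ≤
        (t : ℝ≥0∞) ^ 2 * μHE[finrank ℝ E - 1] (perpProj e '' B) := by
  set c := ⟪ν q, e⟫ with hc
  have hcpos : 0 < c := hS.transverse q hq
  have ht' : (1 : ℝ) < t := by exact_mod_cast ht
  obtain ⟨δ, hδ, hcomp⟩ := exists_almost_tangent_comparison he (hS.norm_normal q hq) hcpos ht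
  obtain ⟨O₁, hO₁, htan⟩ := hS.tangent q hq δ hδ
  have hcont : ContinuousWithinAt (fun x => ⟪ν x, e⟫) S q :=
    (hS.cont q hq).inner continuousWithinAt_const
  have h1 : ∀ᶠ x in 𝓝[S] q, ⟪ν x, e⟫ < t * c :=
    hcont.eventually (gt_mem_nhds (show ⟪ν q, e⟫ < t * c by nlinarith))
  have h2 : ∀ᶠ x in 𝓝[S] q, c / t < ⟪ν x, e⟫ := by
    refine hcont.eventually (lt_mem_nhds (show c / t < ⟪ν q, e⟫ from ?_))
    rw [div_lt_iff₀ (by linarith)]; nlinarith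
  obtain ⟨O₂, hO₂, hO₂'⟩ := mem_nhdsWithin_iff_exists_mem_nhds_inter.1 (h1.and h2)
  obtain ⟨O, hOsub, hOo, hqO⟩ := mem_nhds_iff.1 (inter_mem hO₁ hO₂)
  refine ⟨O, hOo, hqO, fun B hB hBm => ?_⟩
  have hB1 : ∀ x ∈ B, x ∈ S ∩ O₁ := fun x hx => ⟨(hB hx).1, (hOsub (hB hx).2).1⟩
  have hB2 : ∀ x ∈ B, ⟪ν x, e⟫ < t * c ∧ c / t < ⟪ν x, e⟫ :=
    fun x hx => hO₂' ⟨(hOsub (hB hx).2).2, (hB hx).1⟩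
  obtain ⟨hl, hr⟩ := hcomp B fun x hx y hy => htan x (hB1 x hx) y (hB1 y hy)
  have i1 : ENNReal.ofReal c * μHE[finrank ℝ E - 1] B ≤
      t * ∫⁻ x in B, ENNReal.ofReal ⟪ν x, e⟫ ∂μHE[finrank ℝ E - 1] := by
    rw [← lintegral_const_mul' _ _ ENNReal.coe_ne_top, ← setLIntegral_const]
    refine setLIntegral_mono' hBm fun x hx => ?_
    rw [← ENNReal.ofReal_coe_nnreal, ← ENNReal.ofReal_mul t.coe_nonneg]
    refine ENNReal.ofReal_le_ofReal ?_
    have := (hB2 x hx).2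
    rw [div_lt_iff₀ (by linarith)] at this
    linarith
  have i2 : ∫⁻ x in B, ENNReal.ofReal ⟪ν x, e⟫ ∂μHE[finrank ℝ E - 1] ≤
      t * (ENNReal.ofReal c * μHE[finrank ℝ E - 1] B) := by
    rw [← mul_assoc, ← setLIntegral_const]
    refine setLIntegral_mono' hBm fun x hx => ?_
    rw [← ENNReal.ofReal_coe_nnreal, ← ENNReal.ofReal_mul t.coe_nonneg]
    exact ENNReal.ofReal_le_ofReal (hB2 x hx).1.le
  constructor
  · calc _ ≤ _ := hl
      _ ≤ t * (t * ∫⁻ x in B, ENNReal.ofReal ⟪ν x, e⟫ ∂μHE[finrank ℝ E - 1]) := by gcongr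
      _ = _ := by ring
  · calc _ ≤ _ := i2
      _ ≤ t * (t * μHE[finrank ℝ E - 1] (perpProj e '' B)) := by gcongr
      _ = _ := by ring

/-- The projection of a hypersurface piece along `e` has area element `⟪ν, e⟫ dA`. -/
theorem IsTransversePiece.measure_perpProj_image {S : Set E} {ν : E → E} {e : E} (he : ‖e‖ = 1)
    (hS : IsTransversePiece S ν e) {B : Set E} (hBS : B ⊆ S) (hB : MeasurableSet B) :
    μHE[finrank ℝ E - 1] (perpProj e '' B) =
      ∫⁻ x in B, ENNReal.ofReal ⟪ν x, e⟫ ∂μHE[finrank ℝ E - 1] := by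
  have key : ∀ t : ℝ≥0, 1 < t →
      μHE[finrank ℝ E - 1] (perpProj e '' B) ≤
        (t : ℝ≥0∞) ^ 2 * ∫⁻ x in B, ENNReal.ofReal ⟪ν x, e⟫ ∂μHE[finrank ℝ E - 1] ∧
      ∫⁻ x in B, ENNReal.ofReal ⟪ν x, e⟫ ∂μHE[finrank ℝ E - 1] ≤
        (t : ℝ≥0∞) ^ 2 * μHE[finrank ℝ E - 1] (perpProj e '' B) := by
    intro t ht
    rcases B.eq_empty_or_nonempty with rfl | ⟨x₀, hx₀⟩
    · simp
    choose! O hOo hqO hO using fun q (hq : q ∈ S) => hS.exists_local_comparison he ht hq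
    obtain ⟨T, hTS, hTc, hTcov⟩ := TopologicalSpace.countable_cover_nhdsWithin (s := S) (f := O)
      fun q hq => mem_nhdsWithin_of_mem_nhds ((hOo q hq).mem_nhds (hqO q hq))
    have hTne : T.Nonempty := by
      obtain ⟨q, hq, -⟩ := mem_iUnion₂.1 (hTcov (hBS hx₀))
      exact ⟨q, hq⟩
    obtain ⟨q, hq⟩ := hTc.exists_eq_range hTne
    have hqS : ∀ i, q i ∈ S := fun i => hTS (hq ▸ mem_range_self i)
    set A : ℕ → Set E := fun i => B ∩ disjointed (fun j => O (q j)) i with hA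
    have hAm : ∀ i, MeasurableSet (A i) := fun i =>
      hB.inter (MeasurableSet.disjointed (fun j => (hOo _ (hqS j)).measurableSet) i)
    have hAd : Pairwise (Function.onFun Disjoint A) := fun i j hij =>
      ((disjoint_disjointed (fun j => O (q j)) hij).mono inter_subset_right inter_subset_right)
    have hAU : B = ⋃ i, A i := by
      rw [hA, ← inter_iUnion, iUnion_disjointed, eq_comm, inter_eq_left]
      refine fun x hx => ?_
      obtain ⟨p, hp, hxp⟩ := mem_iUnion₂.1 (hTcov (hBS hx))
      rw [hq] at hp
      obtain ⟨i, rfl⟩ := hp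
      exact mem_iUnion.2 ⟨i, hxp⟩
    have hAS : ∀ i, A i ⊆ S ∩ O (q i) := fun i x hx =>
      ⟨hBS hx.1, disjointed_subset _ i hx.2⟩
    have hcont := (perpProj e).continuous
    have s1 : μHE[finrank ℝ E - 1] (perpProj e '' B) =
        ∑' i, μHE[finrank ℝ E - 1] (perpProj e '' A i) := by
      rw [hAU, image_iUnion, measure_iUnion]
      · intro i j hij
        refine disjoint_left.2 ?_
        rintro _ ⟨x, hx, rfl⟩ ⟨y, hy, hxy⟩
        rw [hS.inj (hAS j hy).1 (hAS i hx).1 hxy] at hy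
        exact disjoint_left.1 (hAd hij) hx hy
      · exact fun i => (hAm i).image_of_continuousOn_injOn hcont.continuousOn
          (hS.inj.mono fun x hx => (hAS i hx).1)
    have s2 : ∫⁻ x in B, ENNReal.ofReal ⟪ν x, e⟫ ∂μHE[finrank ℝ E - 1] =
        ∑' i, ∫⁻ x in A i, ENNReal.ofReal ⟪ν x, e⟫ ∂μHE[finrank ℝ E - 1] := by
      conv_lhs => rw [hAU]
      exact lintegral_iUnion hAm hAd _
    rw [s1, s2, ← ENNReal.tsum_mul_left, ← ENNReal.tsum_mul_left]
    exact ⟨ENNReal.tsum_le_tsum fun i => (hO _ (hqS i) _ (hAS i) (hAm i)).1,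
      ENNReal.tsum_le_tsum fun i => (hO _ (hqS i) _ (hAS i) (hAm i)).2⟩
  have lim : ∀ a b : ℝ≥0∞, (∀ t : ℝ≥0, 1 < t → a ≤ (t : ℝ≥0∞) ^ 2 * b) → a ≤ b := by
    intro a b h
    have hlim : Tendsto (fun t : ℝ≥0 => (t : ℝ≥0∞) ^ 2 * b) (𝓝[>] 1) (𝓝 (1 * b)) := by
      refine ENNReal.Tendsto.mul_const ?_ (Or.inl one_ne_zero)
      have : Continuous fun t : ℝ≥0 => ((t ^ 2 : ℝ≥0) : ℝ≥0∞) :=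
        ENNReal.continuous_coe.comp (continuous_pow 2)
      have h := (this.tendsto 1).mono_left (nhdsWithin_le_nhds (s := Ioi 1))
      simpa using h
    rw [one_mul] at hlim
    exact ge_of_tendsto hlim (eventually_mem_nhdsWithin.mono h)
  exact le_antisymm (lim _ _ fun t ht => (key t ht).1) (lim _ _ fun t ht => (key t ht).2)

end AreaFormula

/-! ### Graph charts and integration along lines -/

section DirectionalDivergence

set_option linter.unusedSectionVars false

variable {E : Type*} [NormedAddCommGroup E] [InnerProductSpace ℝ E] [FiniteDimensional ℝ E]
  [MeasurableSpace E] [BorelSpace E]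

/-- The Euclidean unit normal `∇φ / |∇φ|` of the level sets of `φ`. -/
noncomputable def unitGrad (φ : E → ℝ) (x : E) : E := ‖∇ φ x‖⁻¹ • ∇ φ x

theorem inner_grad (φ : E → ℝ) (x v : E) : ⟪∇ φ x, v⟫ = fderiv ℝ φ x v := by
  rw [gradient, InnerProductSpace.toDual_symm_apply]

theorem inner_unitGrad (φ : E → ℝ) (x v : E) :
    ⟪unitGrad φ x, v⟫ = ‖∇ φ x‖⁻¹ * fderiv ℝ φ x v := by
  rw [unitGrad, inner_smul_left, inner_grad]; simp

theorem continuous_grad {φ : E → ℝ} (hφ : ContDiff ℝ 1 φ) : Continuous (∇ φ) :=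
  (InnerProductSpace.toDual ℝ E).symm.continuous.comp (hφ.continuous_fderiv (by norm_num))

/-- `W` is a convex open set on which the open set `U` is `{φ < 0}` and `φ` increases in the
direction `e`. -/
structure IsGraphChart (U W : Set E) (φ : E → ℝ) (e : E) : Prop where
  isOpen : IsOpen W
  convex : Convex ℝ W
  smooth : ContDiff ℝ 1 φ
  increasing : ∀ x ∈ W, 0 < fderiv ℝ φ x e
  mem_iff : ∀ x ∈ W, (x ∈ U ↔ φ x < 0)

/-- The part of the hypersurface `{φ = 0}` that lies in `W`. -/
def chartSurface (W : Set E) (φ : E → ℝ) : Set E := {x ∈ W | φ x = 0}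

variable {U W : Set E} {φ : E → ℝ} {e : E}

theorem IsGraphChart.grad_ne_zero (h : IsGraphChart U W φ e) {x : E} (hx : x ∈ W) :
    ∇ φ x ≠ 0 := by
  intro h0
  have := h.increasing x hx
  rw [← inner_grad, h0, inner_zero_left] at this
  exact lt_irrefl _ this

/-- A defining function is strictly increasing on the lines in the direction `e`, so that each of them
meets the hypersurface at most once. -/
theorem IsGraphChart.lt_of_lt (h : IsGraphChart U W φ e) {y : E} {s₁ s₂ : ℝ} (hs : s₁ < s₂)
    (h₁ : y + s₁ • e ∈ W) (h₂ : y + s₂ • e ∈ W) : φ (y + s₁ • e) < φ (y + s₂ • e) := by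
  have hline : ∀ s ∈ Icc s₁ s₂, y + s • e ∈ W := by
    intro s hs'
    have hmem : (AffineMap.lineMap (y + s₁ • e) (y + s₂ • e) : ℝ → E) ((s - s₁) / (s₂ - s₁)) ∈ W :=
      h.convex.lineMap_mem h₁ h₂ ⟨div_nonneg (by linarith [hs'.1]) (by linarith),
        (div_le_one (by linarith)).2 (by linarith [hs'.2])⟩
    have hne : s₂ - s₁ ≠ 0 := by linarith
    have : (AffineMap.lineMap (y + s₁ • e) (y + s₂ • e) : ℝ → E) ((s - s₁) / (s₂ - s₁)) =
        y + s • e := by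
      rw [AffineMap.lineMap_apply]
      simp only [vsub_eq_sub, vadd_eq_add, add_sub_add_left_eq_sub, ← sub_smul, smul_smul]
      rw [div_mul_cancel₀ _ hne, add_comm, add_assoc, ← add_smul]
      congr 2; ring
    rwa [this] at hmem
  have hderiv : ∀ s : ℝ, HasDerivAt (fun s : ℝ => φ (y + s • e)) (fderiv ℝ φ (y + s • e) e) s := by
    intro s
    have h1 : HasDerivAt (fun s : ℝ => y + s • e) e s := by
      simpa using ((hasDerivAt_id s).smul_const e).const_add y
    exact ((h.smooth.differentiable (by norm_num)) _).hasFDerivAt.comp_hasDerivAt s h1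
  obtain ⟨s, hs', hs''⟩ := exists_hasDerivAt_eq_slope (fun s : ℝ => φ (y + s • e))
    (fun s => fderiv ℝ φ (y + s • e) e) hs
    (fun s _ => (hderiv s).continuousAt.continuousWithinAt) (fun s _ => hderiv s)
  have hpos := h.increasing _ (hline s ⟨hs'.1.le, hs'.2.le⟩)
  rw [hs'', lt_div_iff₀ (by linarith)] at hpos
  linarith

theorem IsGraphChart.isTransversePiece (h : IsGraphChart U W φ e) :
    IsTransversePiece (chartSurface W φ) (unitGrad φ) e where
  meas := by
    have : chartSurface W φ = W ∩ φ ⁻¹' {0} := rfl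
    rw [this]
    exact h.isOpen.measurableSet.inter (isClosed_singleton.preimage h.smooth.continuous).measurableSet
  cont := by
    have h1 := continuous_grad h.smooth
    exact (h1.norm.continuousOn.inv₀ fun x hx =>
      norm_ne_zero_iff.2 (h.grad_ne_zero hx.1)).smul h1.continuousOn
  norm_normal x hx := by
    have := norm_ne_zero_iff.2 (h.grad_ne_zero hx.1)
    rw [unitGrad, norm_smul, norm_inv, norm_norm, inv_mul_cancel₀ this]
  transverse x hx := by
    rw [inner_unitGrad]
    exact mul_pos (inv_pos.2 (norm_pos_iff.2 (h.grad_ne_zero hx.1))) (h.increasing x hx.1)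
  tangent q hq δ hδ := by
    have hpos := norm_pos_iff.2 (h.grad_ne_zero hq.1)
    have hst : HasStrictFDerivAt φ (fderiv ℝ φ q) q :=
      h.smooth.contDiffAt.hasStrictFDerivAt (by norm_num)
    have hb := hst.isLittleO.bound (mul_pos hδ hpos)
    rw [nhds_prod_eq] at hb
    obtain ⟨O, hO, hOb⟩ := Filter.mem_prod_same_iff.1 hb
    refine ⟨O, hO, fun x hx y hy => ?_⟩
    have : ‖φ x - φ y - (fderiv ℝ φ q) (x - y)‖ ≤ δ * ‖∇ φ q‖ * ‖x - y‖ :=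
      hOb (mk_mem_prod hx.2 hy.2)
    simp only [hx.1.2, hy.1.2, sub_self, zero_sub, norm_neg] at this
    rw [inner_unitGrad, abs_mul, abs_inv, abs_norm, inv_mul_le_iff₀ hpos]
    rw [Real.norm_eq_abs] at this
    linarith
  inj x hx y hy hxy := by
    rw [perpProj_apply, perpProj_apply] at hxy
    have hxe : x = y + (⟪e, x⟫ - ⟪e, y⟫) • e := by
      rw [sub_smul, ← add_sub_assoc, add_sub_right_comm, ← hxy]; abel
    set s := ⟪e, x⟫ - ⟪e, y⟫ with hs
    have hy0 : y = y + (0 : ℝ) • e := by simp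
    have hxW : y + s • e ∈ W := hxe ▸ hx.1
    have hyW : y + (0 : ℝ) • e ∈ W := hy0 ▸ hy.1
    have hx0 : φ (y + s • e) = 0 := hxe ▸ hx.2
    have hy00 : φ (y + (0 : ℝ) • e) = 0 := hy0 ▸ hy.2
    rcases lt_trichotomy s 0 with hlt | heq | hgt
    · exact absurd (h.lt_of_lt hlt hxW hyW) (by rw [hx0, hy00]; exact lt_irrefl _)
    · rw [hxe, heq, zero_smul, add_zero]
    · exact absurd (h.lt_of_lt hgt hyW hxW) (by rw [hx0, hy00]; exact lt_irrefl _)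

/-- Integral over a full line in the direction `e`, for a line that meets the hypersurface at
parameter `s₀`, and for a line that does not meet it. -/
theorem IsGraphChart.integral_line (h : IsGraphChart U W φ e) {η : E → ℝ} {K : Set E}
    (he : ‖e‖ = 1) (hK : IsCompact K) (hKW : K ⊆ W) (hη0 : ∀ x, x ∉ K → η x = 0)
    (hηc : ContinuousOn η (U ∪ chartSurface W φ)) (hηd : ∀ x ∈ U, DifferentiableAt ℝ η x) (y : E)
    (hint : Integrable fun s : ℝ => U.indicator (fun x => fderiv ℝ η x e) (y + s • e)) :
    (∀ s₀ : ℝ, y + s₀ • e ∈ chartSurface W φ →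
      ∫ s : ℝ, U.indicator (fun x => fderiv ℝ η x e) (y + s • e) = η (y + s₀ • e)) ∧
    ((∀ s : ℝ, y + s • e ∉ chartSurface W φ) →
      ∫ s : ℝ, U.indicator (fun x => fderiv ℝ η x e) (y + s • e) = 0) := by
  have hline : ∀ s : ℝ, HasDerivAt (fun s : ℝ => y + s • e) e s := fun s => by
    simpa using ((hasDerivAt_id s).smul_const e).const_add y
  have hlinec : Continuous fun s : ℝ => y + s • e := by fun_prop
  have hoff : ∀ x, x ∉ K → η =ᶠ[𝓝 x] fun _ => 0 := fun x hx =>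
    Filter.mem_of_superset (hK.isClosed.isOpen_compl.mem_nhds hx) hη0
  have hoffd : ∀ x, x ∉ K → DifferentiableAt ℝ η x ∧ fderiv ℝ η x = 0 := fun x hx =>
    ⟨(hoff x hx).differentiableAt_iff.2 (differentiableAt_const 0), by
      rw [(hoff x hx).fderiv_eq]; simp⟩
  have hder : ∀ s : ℝ, (y + s • e ∈ U ∨ y + s • e ∉ K) →
      HasDerivAt (fun s : ℝ => η (y + s • e)) (fderiv ℝ η (y + s • e) e) s := by
    intro s hs
    have hd : DifferentiableAt ℝ η (y + s • e) := by
      rcases hs with hs | hs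
      · exact hηd _ hs
      · exact (hoffd _ hs).1
    exact hd.hasFDerivAt.comp_hasDerivAt s (hline s)
  obtain ⟨M, hM⟩ : ∃ M : ℝ, ∀ s : ℝ, M < |s| → y + s • e ∉ K := by
    obtain ⟨M, hM⟩ := hK.isBounded.exists_norm_le
    refine ⟨M + ‖y‖, fun s hs hmem => ?_⟩
    have h1 := hM _ hmem
    have h2 := norm_sub_le (y + s • e) y
    rw [add_sub_cancel_left, norm_smul, he, mul_one, Real.norm_eq_abs] at h2
    linarith
  have hbot : Tendsto (fun s : ℝ => η (y + s • e)) atBot (𝓝 0) := by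
    refine tendsto_const_nhds.congr' ?_
    filter_upwards [eventually_lt_atBot (-|M|)] with s hs
    exact (hη0 _ (hM s (by rw [abs_of_neg (by linarith [abs_nonneg M])]; linarith [le_abs_self M]))).symm
  have htop : Tendsto (fun s : ℝ => η (y + s • e)) atTop (𝓝 0) := by
    refine tendsto_const_nhds.congr' ?_
    filter_upwards [eventually_gt_atTop |M|] with s hs
    exact (hη0 _ (hM s (lt_of_lt_of_le (lt_of_le_of_lt (le_abs_self M) hs) (le_abs_self s)))).symm
  constructor
  · intro s₀ hs₀
    have hneg : ∀ s < s₀, y + s • e ∈ W → y + s • e ∈ U := fun s hs hsW => by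
      rw [h.mem_iff _ hsW, ← hs₀.2]; exact h.lt_of_lt hs hsW hs₀.1
    have hnonneg : ∀ s ≥ s₀, y + s • e ∈ W → y + s • e ∉ U := fun s hs hsW => by
      rw [h.mem_iff _ hsW, not_lt, ← hs₀.2]
      rcases hs.lt_or_eq with hlt | rfl
      · exact (h.lt_of_lt hlt hs₀.1 hsW).le
      · exact le_rfl
    have hG : (fun s : ℝ => U.indicator (fun x => fderiv ℝ η x e) (y + s • e)) =
        (Iio s₀).indicator fun s => fderiv ℝ η (y + s • e) e := by
      funext s
      by_cases hsK : y + s • e ∈ K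
      · by_cases hs : s < s₀
        · rw [indicator_of_mem (hneg s hs (hKW hsK)), indicator_of_mem (show s ∈ Iio s₀ from hs)]
        · rw [indicator_of_notMem (hnonneg s (not_lt.1 hs) (hKW hsK)),
            indicator_of_notMem (show s ∉ Iio s₀ from hs)]
      · have : fderiv ℝ η (y + s • e) e = 0 := by rw [(hoffd _ hsK).2]; simp
        simp [Set.indicator, this]
    rw [hG] at hint ⊢
    rw [integral_indicator measurableSet_Iio, ← integral_Iic_eq_integral_Iio]
    rw [integrable_indicator_iff measurableSet_Iio, ← integrableOn_Iic_iff_integrableOn_Iio] at hint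
    have hcont : ContinuousWithinAt (fun s : ℝ => η (y + s • e)) (Iic s₀) s₀ := by
      have h1 : ContinuousWithinAt η (U ∪ chartSurface W φ) (y + s₀ • e) := hηc _ (Or.inr hs₀)
      have hW : ∀ᶠ s in 𝓝[Iic s₀] s₀, y + s • e ∈ W :=
        mem_nhdsWithin_of_mem_nhds (hlinec.continuousAt.preimage_mem_nhds (h.isOpen.mem_nhds hs₀.1))
      refine (h1.comp (s := {s : ℝ | y + s • e ∈ U ∪ chartSurface W φ})
        hlinec.continuousWithinAt fun s hs => hs).mono_of_mem_nhdsWithin ?_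
      filter_upwards [hW, self_mem_nhdsWithin] with s hsW hs
      rcases (show s ≤ s₀ from hs).lt_or_eq with hlt | rfl
      · exact Or.inl (hneg s hlt hsW)
      · exact Or.inr hs₀
    have := integral_Iic_of_hasDerivAt_of_tendsto hcont (fun s hs => hder s ?_) hint hbot
    · rw [this, sub_zero]
    · by_cases hsW : y + s • e ∈ W
      · exact Or.inl (hneg s hs hsW)
      · exact Or.inr fun hK' => hsW (hKW hK')
  · intro hno
    by_cases hex : ∃ s₁ : ℝ, y + s₁ • e ∈ W ∧ φ (y + s₁ • e) < 0
    · obtain ⟨s₁, hs₁W, hs₁⟩ := hex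
      have hall : ∀ s : ℝ, y + s • e ∈ W → y + s • e ∈ U := by
        intro s hsW
        rw [h.mem_iff _ hsW]
        by_contra hge
        have hset : OrdConnected {s : ℝ | y + s • e ∈ W} := by
          have : Convex ℝ ((AffineMap.lineMap y (y + e) : ℝ →ᵃ[ℝ] E) ⁻¹' W) :=
            h.convex.affine_preimage _
          have h2 : {s : ℝ | y + s • e ∈ W} = (AffineMap.lineMap y (y + e) : ℝ →ᵃ[ℝ] E) ⁻¹' W := by
            ext s; simp [AffineMap.lineMap_apply, add_comm]
          rw [h2]; exact this.ordConnected
        have hc : ContinuousOn (fun s : ℝ => φ (y + s • e)) (uIcc s₁ s) :=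
          (h.smooth.continuous.comp hlinec).continuousOn
        obtain ⟨s', hs', hs'0⟩ := intermediate_value_uIcc hc
          (mem_uIcc.2 (Or.inl ⟨hs₁.le, not_lt.1 hge⟩))
        exact hno s' ⟨hset.uIcc_subset hs₁W hsW hs', hs'0⟩
      have hG : (fun s : ℝ => U.indicator (fun x => fderiv ℝ η x e) (y + s • e)) =
          fun s => fderiv ℝ η (y + s • e) e := by
        funext s
        by_cases hsK : y + s • e ∈ K
        · rw [indicator_of_mem (hall s (hKW hsK))]
        · have : fderiv ℝ η (y + s • e) e = 0 := by rw [(hoffd _ hsK).2]; simp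
          simp [Set.indicator, this]
      rw [hG] at hint ⊢
      have := integral_of_hasDerivAt_of_tendsto (fun s => hder s ?_) hint hbot htop
      · rw [this, sub_zero]
      · by_cases hsW : y + s • e ∈ W
        · exact Or.inl (hall s hsW)
        · exact Or.inr fun hK' => hsW (hKW hK')
    · push Not at hex
      have hG : (fun s : ℝ => U.indicator (fun x => fderiv ℝ η x e) (y + s • e)) = fun s => 0 := by
        funext s
        by_cases hsK : y + s • e ∈ K
        · refine indicator_of_notMem (fun hU => ?_) _
          rw [h.mem_iff _ (hKW hsK)] at hU
          exact absurd hU (not_lt.2 (hex s (hKW hsK)))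
        · have : fderiv ℝ η (y + s • e) e = 0 := by rw [(hoffd _ hsK).2]; simp
          simp [Set.indicator, this]
      rw [hG]; simp

end DirectionalDivergence

/-! ### Fubini along a transverse direction -/

section LineFubini

set_option linter.unusedSectionVars false

variable {E : Type*} [NormedAddCommGroup E] [InnerProductSpace ℝ E] [FiniteDimensional ℝ E]
  [MeasurableSpace E] [BorelSpace E]

theorem coe_orthogonalProjectionOnto_orthogonal_span {e : E} (he : ‖e‖ = 1) (x : E) :
    (((ℝ ∙ e)ᗮ.orthogonalProjectionOnto x : (ℝ ∙ e)ᗮ) : E) = perpProj e x := by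
  rw [Submodule.coe_orthogonalProjectionOnto_apply, perpProj_apply,
    Submodule.starProjection_orthogonal_val, Submodule.starProjection_unit_singleton ℝ he]

/-- Fubini's theorem for the decomposition of the space into lines in the direction `e`. -/
theorem measurePreserving_add_smul {e : E} (he : ‖e‖ = 1) :
    MeasurePreserving (fun p : (ℝ ∙ e)ᗮ × ℝ => (p.1 : E) + p.2 • e)
      (volume.prod volume) volume := by
  have h1 := ((ℝ ∙ e).measurePreserving_measurableEquivProd (0 : E)).symm
  rw [InnerProductSpace.euclideanHausdorffMeasure_eq_volume] at h1
  have h2 := (LinearIsometryEquiv.toSpanUnitSingleton (𝕜 := ℝ) e he).measurePreserving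
  have h3 := h2.prod (MeasurePreserving.id (volume : Measure ((ℝ ∙ e)ᗮ)))
  have h4 := Measure.measurePreserving_swap (μ := (volume : Measure ((ℝ ∙ e)ᗮ)))
    (ν := (volume : Measure ℝ))
  have h5 := h1.comp (h3.comp h4)
  have h6 : (fun p : (ℝ ∙ e)ᗮ × ℝ => (p.1 : E) + p.2 • e) =
      ((ℝ ∙ e).measurableEquivProd (0 : E)).symm ∘
        (Prod.map (LinearIsometryEquiv.toSpanUnitSingleton (𝕜 := ℝ) e he) id ∘ Prod.swap) := by
    funext p
    simp [add_comm]
  rw [h6]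
  exact h5

variable {U W : Set E} {φ : E → ℝ} {e : E}

/-- Integrating over the hypersurface with density `⟪ν, e⟫` is integrating over its projection. -/
theorem IsTransversePiece.map_projection {S : Set E} {ν : E → E} (he : ‖e‖ = 1)
    (hS : IsTransversePiece S ν e) :
    Measure.map (fun x => (ℝ ∙ e)ᗮ.orthogonalProjectionOnto x)
        (((μHE[finrank ℝ E - 1]).restrict S).withDensity fun x => ENNReal.ofReal ⟪ν x, e⟫) =
      (volume : Measure ((ℝ ∙ e)ᗮ)).restrict {y | (y : E) ∈ perpProj e '' S} := by
  have hm : Measurable fun x : E => (ℝ ∙ e)ᗮ.orthogonalProjectionOnto x :=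
    (ContinuousLinearMap.continuous _).measurable
  ext C hC
  rw [Measure.map_apply hm hC, withDensity_apply _ (hm hC), Measure.restrict_restrict (hm hC),
    inter_comm, ← hS.measure_perpProj_image he inter_subset_left (hS.meas.inter (hm hC)),
    Measure.restrict_apply hC, ← InnerProductSpace.euclideanHausdorffMeasure_eq_volume,
    finrank_orthogonal_span_unit he,
    ← (isometry_subtype_coe : Isometry (Subtype.val : (ℝ ∙ e)ᗮ → E)).euclideanHausdorffMeasure_image]
  congr 1
  ext z
  constructor
  · rintro ⟨x, ⟨hxS, hxC⟩, rfl⟩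
    refine ⟨(ℝ ∙ e)ᗮ.orthogonalProjectionOnto x, ⟨hxC, ?_⟩, ?_⟩
    · exact ⟨x, hxS, (coe_orthogonalProjectionOnto_orthogonal_span he x).symm⟩
    · exact coe_orthogonalProjectionOnto_orthogonal_span he x
  · rintro ⟨y, ⟨hyC, x, hxS, hxy⟩, rfl⟩
    refine ⟨x, ⟨hxS, ?_⟩, hxy⟩
    have : (ℝ ∙ e)ᗮ.orthogonalProjectionOnto x = y :=
      Subtype.ext ((coe_orthogonalProjectionOnto_orthogonal_span he x).trans hxy)
    simpa only [mem_preimage, this] using hyC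

/-- Compact parts of the hypersurface have finite area: the density `⟪ν, e⟫` is bounded below there and
its integral is the measure of a bounded set in `e^⊥`. -/
theorem IsGraphChart.measure_inter_lt_top (h : IsGraphChart U W φ e) (he : ‖e‖ = 1) {K : Set E}
    (hK : IsCompact K) (hKW : K ⊆ W) : μHE[finrank ℝ E - 1] (chartSurface W φ ∩ K) < ⊤ := by
  have hS := h.isTransversePiece
  have hSK : chartSurface W φ ∩ K = K ∩ φ ⁻¹' {0} := by
    ext x
    exact ⟨fun hx => ⟨hx.2, hx.1.2⟩, fun hx => ⟨⟨hKW hx.1, hx.2⟩, hx.1⟩⟩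
  have hc : IsCompact (chartSurface W φ ∩ K) := by
    rw [hSK]
    exact hK.inter_right (isClosed_singleton.preimage h.smooth.continuous)
  rcases (chartSurface W φ ∩ K).eq_empty_or_nonempty with hemp | hne
  · rw [hemp]; simp
  obtain ⟨x₀, hx₀, hmin⟩ := hc.exists_isMinOn hne
    (f := fun x => ⟪unitGrad φ x, e⟫) ((hS.cont.mono inter_subset_left).inner continuousOn_const)
  have hpos := hS.transverse x₀ hx₀.1
  have h1 := hS.measure_perpProj_image he inter_subset_left hc.measurableSet
  have h2 : μHE[finrank ℝ E - 1] (perpProj e '' (chartSurface W φ ∩ K)) < ⊤ := by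
    have h3 : perpProj e '' (chartSurface W φ ∩ K) = Subtype.val ''
        ((fun x => (ℝ ∙ e)ᗮ.orthogonalProjectionOnto x) '' (chartSurface W φ ∩ K)) := by
      rw [image_image]
      exact image_congr fun x _ => (coe_orthogonalProjectionOnto_orthogonal_span he x).symm
    rw [h3, isometry_subtype_coe.euclideanHausdorffMeasure_image,
      ← finrank_orthogonal_span_unit he, InnerProductSpace.euclideanHausdorffMeasure_eq_volume]
    exact (hc.image (ContinuousLinearMap.continuous _)).measure_lt_top
  have h4 : ENNReal.ofReal ⟪unitGrad φ x₀, e⟫ * μHE[finrank ℝ E - 1] (chartSurface W φ ∩ K) ≤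
      μHE[finrank ℝ E - 1] (perpProj e '' (chartSurface W φ ∩ K)) := by
    rw [h1, ← setLIntegral_const]
    exact setLIntegral_mono' hc.measurableSet fun x hx => ENNReal.ofReal_le_ofReal (hmin hx)
  by_contra htop
  rw [not_lt, top_le_iff] at htop
  rw [htop, ENNReal.mul_top (by simpa using hpos)] at h4
  exact absurd (h4.trans_lt h2) (lt_irrefl _)

/-- The divergence theorem for a field of constant direction `e`, localized in a chart. -/
theorem IsGraphChart.integral_fderiv (h : IsGraphChart U W φ e) (he : ‖e‖ = 1) (hU : IsOpen U)
    {η : E → ℝ} {K : Set E} (hK : IsCompact K) (hKW : K ⊆ W) (hη0 : ∀ x, x ∉ K → η x = 0)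
    (hηc : ContinuousOn η (U ∪ chartSurface W φ)) (hηd : ∀ x ∈ U, DifferentiableAt ℝ η x)
    (hint : IntegrableOn (fun x => fderiv ℝ η x e) U) :
    ∫ x in U, fderiv ℝ η x e =
      ∫ x in chartSurface W φ, ⟪unitGrad φ x, e⟫ * η x ∂μHE[finrank ℝ E - 1] := by
  have hS := h.isTransversePiece
  have hmp := measurePreserving_add_smul he
  set G : E → ℝ := U.indicator fun x => fderiv ℝ η x e with hG
  have hGi : Integrable G := hint.integrable_indicator hU.measurableSet
  have hGi' : Integrable (fun p : (ℝ ∙ e)ᗮ × ℝ => G ((p.1 : E) + p.2 • e))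
      (volume.prod volume) := hmp.integrable_comp_of_integrable hGi
  set k : (ℝ ∙ e)ᗮ → ℝ := fun y => ∫ s : ℝ, G ((y : E) + s • e) with hk
  have hki : Integrable k := hGi'.integral_prod_left
  have hm : Measurable fun x : E => (ℝ ∙ e)ᗮ.orthogonalProjectionOnto x :=
    (ContinuousLinearMap.continuous _).measurable
  set A : Set ((ℝ ∙ e)ᗮ) := {y | (y : E) ∈ perpProj e '' chartSurface W φ} with hA
  have hAm : MeasurableSet A := by
    have : MeasurableSet (perpProj e '' chartSurface W φ) :=
      hS.meas.image_of_continuousOn_injOn (perpProj e).continuous.continuousOn hS.inj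
    exact measurable_subtype_coe this
  -- values of the line integrals
  have hval : ∀ᵐ y : (ℝ ∙ e)ᗮ, (∀ x ∈ chartSurface W φ,
      (ℝ ∙ e)ᗮ.orthogonalProjectionOnto x = y → k y = η x) ∧ (y ∉ A → k y = 0) := by
    filter_upwards [hGi'.prod_right_ae] with y hy
    have hl := h.integral_line he hK hKW hη0 hηc hηd (y : E) hy
    have hproj : ∀ x : E, (ℝ ∙ e)ᗮ.orthogonalProjectionOnto x = y → x = (y : E) + ⟪e, x⟫ • e := by
      rintro x rfl
      rw [coe_orthogonalProjectionOnto_orthogonal_span he, perpProj_apply, sub_add_cancel]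
    constructor
    · intro x hx hxy
      have h1 := hl.1 ⟪e, x⟫ (by rw [← hproj x hxy]; exact hx)
      rw [← hproj x hxy] at h1
      exact h1
    · intro hyA
      refine hl.2 fun s hs => hyA ⟨(y : E) + s • e, hs, ?_⟩
      have hye : ⟪e, (y : E)⟫ = 0 := Submodule.mem_orthogonal_singleton_iff_inner_right.1 y.2
      rw [perpProj_apply, inner_add_right, inner_smul_right, hye, real_inner_self_eq_norm_sq, he]
      simp
  have hmap := hS.map_projection he
  have step1 : ∫ x in U, fderiv ℝ η x e = ∫ y, k y := by
    rw [← integral_indicator hU.measurableSet, ← hG, ← hmp.map_eq,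
      integral_map hmp.measurable.aemeasurable, integral_prod _ hGi']
    rw [hmp.map_eq]; exact hGi.aestronglyMeasurable
  have step2 : ∫ y, k y = ∫ y in A, k y := by
    rw [← integral_indicator hAm]
    refine integral_congr_ae ?_
    filter_upwards [hval] with y hy
    by_cases hyA : y ∈ A
    · rw [indicator_of_mem hyA]
    · rw [indicator_of_notMem hyA, hy.2 hyA]
  have hdm : AEMeasurable (fun x => ENNReal.ofReal ⟪unitGrad φ x, e⟫)
      ((μHE[finrank ℝ E - 1]).restrict (chartSurface W φ)) :=
    ((hS.cont.inner continuousOn_const).aemeasurable hS.meas).ennreal_ofReal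
  rw [step1, step2, ← hmap, integral_map hm.aemeasurable (by rw [hmap]; exact hki.1.restrict)]
  have hval' : ∀ᵐ x ∂(((μHE[finrank ℝ E - 1]).restrict (chartSurface W φ)).withDensity
      fun x => ENNReal.ofReal ⟪unitGrad φ x, e⟫),
      ∀ x' ∈ chartSurface W φ, (ℝ ∙ e)ᗮ.orthogonalProjectionOnto x' =
        (ℝ ∙ e)ᗮ.orthogonalProjectionOnto x →
        k ((ℝ ∙ e)ᗮ.orthogonalProjectionOnto x) = η x' := by
    refine ae_of_ae_map hm.aemeasurable (p := fun y => ∀ x' ∈ chartSurface W φ,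
      (ℝ ∙ e)ᗮ.orthogonalProjectionOnto x' = y → k y = η x') ?_
    rw [hmap]
    exact ae_restrict_of_ae (hval.mono fun y hy => hy.1)
  have hmemS : ∀ᵐ x ∂(((μHE[finrank ℝ E - 1]).restrict (chartSurface W φ)).withDensity
      fun x => ENNReal.ofReal ⟪unitGrad φ x, e⟫), x ∈ chartSurface W φ :=
    (withDensity_absolutelyContinuous _ _).ae_le (ae_restrict_mem hS.meas)
  have step3 : ∫ x, k ((ℝ ∙ e)ᗮ.orthogonalProjectionOnto x)
      ∂(((μHE[finrank ℝ E - 1]).restrict (chartSurface W φ)).withDensity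
        fun x => ENNReal.ofReal ⟪unitGrad φ x, e⟫) =
      ∫ x, η x ∂(((μHE[finrank ℝ E - 1]).restrict (chartSurface W φ)).withDensity
        fun x => ENNReal.ofReal ⟪unitGrad φ x, e⟫) := by
    refine integral_congr_ae ?_
    filter_upwards [hval', hmemS] with x hx hxS
    exact hx x hxS rfl
  rw [step3, integral_withDensity_eq_integral_toReal_smul₀ hdm
    (Eventually.of_forall fun _ => ENNReal.ofReal_lt_top)]
  refine setIntegral_congr_fun hS.meas fun x hx => ?_
  simp only [smul_eq_mul]
  rw [ENNReal.toReal_ofReal (hS.transverse x hx).le]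

end LineFubini

/-! ### The divergence theorem in a chart -/

section ChartDivergence

set_option linter.unusedSectionVars false

/-- Both sides of `IsGraphChart.integral_fderiv` are homogeneous in the direction, which therefore need
not be a unit vector. -/
theorem IsGraphChart.integral_fderiv_of_ne_zero {E : Type*} [NormedAddCommGroup E]
    [InnerProductSpace ℝ E] [FiniteDimensional ℝ E] [MeasurableSpace E] [BorelSpace E]
    {U W : Set E} {φ : E → ℝ} {e : E} (h : IsGraphChart U W φ e) (he : e ≠ 0) (hU : IsOpen U)
    {η : E → ℝ} {K : Set E} (hK : IsCompact K) (hKW : K ⊆ W) (hη0 : ∀ x, x ∉ K → η x = 0)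
    (hηc : ContinuousOn η (U ∪ chartSurface W φ)) (hηd : ∀ x ∈ U, DifferentiableAt ℝ η x)
    (hint : IntegrableOn (fun x => fderiv ℝ η x e) U) :
    ∫ x in U, fderiv ℝ η x e =
      ∫ x in chartSurface W φ, ⟪unitGrad φ x, e⟫ * η x ∂μHE[finrank ℝ E - 1] := by
  have hpos : 0 < ‖e‖ := norm_pos_iff.2 he
  have he' : ‖‖e‖⁻¹ • e‖ = 1 := by rw [norm_smul, norm_inv, norm_norm, inv_mul_cancel₀ hpos.ne']
  have h' : IsGraphChart U W φ (‖e‖⁻¹ • e) :=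
    { h with
      increasing := fun x hx => by
        rw [map_smul, smul_eq_mul]
        exact mul_pos (inv_pos.2 hpos) (h.increasing x hx) }
  have hint' : IntegrableOn (fun x => fderiv ℝ η x (‖e‖⁻¹ • e)) U := by
    simp only [map_smul]; exact hint.smul ‖e‖⁻¹
  have key := h'.integral_fderiv he' hU hK hKW hη0 hηc hηd hint'
  simp only [map_smul, inner_smul_right, smul_eq_mul, mul_assoc] at key
  rw [integral_const_mul, integral_const_mul] at key
  exact mul_left_cancel₀ (inv_ne_zero hpos.ne') key

variable {ι : Type*} [Fintype ι] [DecidableEq ι]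

/-- A chart in which the boundary of `U` is a graph simultaneously in the direction `n` and in
the directions `e_i + 2 n`, for all `i`. These directions span the space. -/
structure IsDivChart (U W : Set (EuclideanSpace ℝ ι)) (φ : EuclideanSpace ℝ ι → ℝ)
    (n : EuclideanSpace ℝ ι) : Prop where
  norm_dir : ‖n‖ = 1
  graph : IsGraphChart U W φ n
  graph_basis : ∀ i, IsGraphChart U W φ (EuclideanSpace.single i 1 + (2 : ℝ) • n)

variable {U W : Set (EuclideanSpace ℝ ι)} {φ : EuclideanSpace ℝ ι → ℝ} {n : EuclideanSpace ℝ ι}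

local notation "𝔼" => EuclideanSpace ℝ ι
local notation "σ" => (μHE[finrank ℝ (EuclideanSpace ℝ ι) - 1] : Measure (EuclideanSpace ℝ ι))

theorem IsGraphChart.integrableOn_chartSurface {e : 𝔼} (he : ‖e‖ = 1) (h : IsGraphChart U W φ e)
    {g : 𝔼 → ℝ} {K : Set 𝔼} (hK : IsCompact K) (hKW : K ⊆ W) (hg0 : ∀ x, x ∉ K → g x = 0)
    (hgc : ContinuousOn g (chartSurface W φ)) : IntegrableOn g (chartSurface W φ) σ := by
  have hSK : chartSurface W φ ∩ K = K ∩ φ ⁻¹' {0} := by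
    ext x
    exact ⟨fun hx => ⟨hx.2, hx.1.2⟩, fun hx => ⟨⟨hKW hx.1, hx.2⟩, hx.1⟩⟩
  have hc : IsCompact (chartSurface W φ ∩ K) := by
    rw [hSK]
    exact hK.inter_right (isClosed_singleton.preimage h.smooth.continuous)
  have hfin := h.measure_inter_lt_top he hK hKW
  obtain ⟨M, hM⟩ := hc.exists_bound_of_continuousOn (hgc.mono inter_subset_left)
  have h1 : IntegrableOn g (chartSurface W φ ∩ K) σ := by
    refine IntegrableOn.of_bound hfin ?_ M
      ((ae_restrict_mem hc.measurableSet).mono fun x hx => hM x hx)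
    exact (hgc.mono inter_subset_left).aestronglyMeasurable hc.measurableSet
  refine h1.of_forall_sdiff_eq_zero h.isTransversePiece.meas fun x hx => hg0 x fun hxK =>
    hx.2 ⟨hx.1, hxK⟩

/-- The divergence theorem in a chart for fields with integrable first derivatives. -/
theorem IsDivChart.integral_div_of_integrable (h : IsDivChart U W φ n) (hU : IsOpen U)
    {Q : ι → 𝔼 → ℝ} {K : Set 𝔼} (hK : IsCompact K) (hKW : K ⊆ W)
    (hQ0 : ∀ i x, x ∉ K → Q i x = 0) (hQc : ∀ i, ContinuousOn (Q i) (U ∪ chartSurface W φ))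
    (hQd : ∀ i, ∀ x ∈ U, DifferentiableAt ℝ (Q i) x)
    (hint : ∀ i v, IntegrableOn (fun x => fderiv ℝ (Q i) x v) U) :
    ∫ x in U, ∑ i, fderiv ℝ (Q i) x (EuclideanSpace.single i 1) =
      ∫ x in chartSurface W φ, ∑ i, unitGrad φ x i * Q i x ∂σ := by
  have hνi : ∀ i (v : 𝔼), IntegrableOn (fun x => ⟪unitGrad φ x, v⟫ * Q i x) (chartSurface W φ) σ := by
    intro i v
    refine h.graph.integrableOn_chartSurface h.norm_dir hK hKW
      (fun x hx => by rw [hQ0 i x hx, mul_zero]) ?_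
    exact (h.graph.isTransversePiece.cont.inner continuousOn_const).mul
      ((hQc i).mono subset_union_right)
  have hn0 : n ≠ 0 := by
    intro h0; have := h.norm_dir; rw [h0, norm_zero] at this; exact zero_ne_one this
  have hcomp : ∀ i, ∫ x in U, fderiv ℝ (Q i) x (EuclideanSpace.single i 1) =
      ∫ x in chartSurface W φ, unitGrad φ x i * Q i x ∂σ := by
    intro i
    have h1 := h.graph.integral_fderiv_of_ne_zero hn0 hU hK hKW (hQ0 i) (hQc i) (hQd i) (hint i n)
    by_cases hv0 : (EuclideanSpace.single i 1 + (2 : ℝ) • n : 𝔼) = 0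
    · -- then `W` is empty
      have hW : W = ∅ := by
        refine eq_empty_of_forall_notMem fun x hx => ?_
        have := (h.graph_basis i).increasing x hx
        rw [hv0, map_zero] at this
        exact lt_irrefl _ this
      have hQz : Q i = fun _ => 0 := funext fun x => hQ0 i x fun hx => by
        have := hKW hx
        rw [hW] at this; exact this
      simp [hQz]
    · have h2 := (h.graph_basis i).integral_fderiv_of_ne_zero hv0 hU hK hKW (hQ0 i) (hQc i) (hQd i)
        (hint i _)
      simp only [map_add, map_smul, inner_add_right, inner_smul_right, add_mul, smul_eq_mul,
        mul_assoc] at h2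
      rw [integral_add (hint i _) ((hint i n).const_mul 2), integral_add (hνi i _)
        ((hνi i n).const_mul 2), integral_const_mul, integral_const_mul, h1] at h2
      have h3 := add_right_cancel h2
      rw [h3]
      refine integral_congr_ae (Eventually.of_forall fun x => ?_)
      simp [EuclideanSpace.inner_single_right]
  rw [integral_finsetSum _ fun i _ => hint i _, integral_finsetSum]
  · exact Finset.sum_congr rfl fun i _ => hcomp i
  · intro i _
    have := hνi i (EuclideanSpace.single i 1)
    rw [IntegrableOn] at this
    simpa [EuclideanSpace.inner_single_right] using this

/-- The divergence theorem in a chart, for a field that is `C¹` inside, continuous up to the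
boundary, and of which only the divergence is assumed integrable. The field is translated a
little inwards, where all its derivatives are bounded. -/
theorem IsDivChart.integral_div (h : IsDivChart U W φ n) (hU : IsOpen U)
    {Q : ι → 𝔼 → ℝ} {K : Set 𝔼} (hK : IsCompact K) (hKW : K ⊆ W)
    (hQ0 : ∀ i x, x ∉ K → Q i x = 0) (hQc : ∀ i, ContinuousOn (Q i) (U ∪ chartSurface W φ))
    (hQd : ∀ i, ContDiffOn ℝ 1 (Q i) U)
    (hint : IntegrableOn (fun x => ∑ i, fderiv ℝ (Q i) x (EuclideanSpace.single i 1)) U) :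
    ∫ x in U, ∑ i, fderiv ℝ (Q i) x (EuclideanSpace.single i 1) =
      ∫ x in chartSurface W φ, ∑ i, unitGrad φ x i * Q i x ∂σ := by
  obtain ⟨δ, hδ, hδW⟩ := hK.exists_cthickening_subset_open h.graph.isOpen hKW
  set K' := Metric.cthickening δ K with hK'def
  have hK' : IsCompact K' := hK.cthickening
  set D : 𝔼 → ℝ := fun x => ∑ i, fderiv ℝ (Q i) x (EuclideanSpace.single i 1) with hD
  have hoff : ∀ i x, x ∉ K → Q i =ᶠ[𝓝 x] fun _ => 0 := fun i x hx =>
    Filter.mem_of_superset (hK.isClosed.isOpen_compl.mem_nhds hx) (hQ0 i)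
  have hD0 : ∀ x, x ∉ K → D x = 0 := fun x hx =>
    Finset.sum_eq_zero fun i _ => by rw [(hoff i x hx).fderiv_eq]; simp
  have hshiftK : ∀ s : ℝ, 0 < s → s < δ → ∀ x, x - s • n ∈ K → x ∈ K' := by
    intro s hs hsδ x hx
    refine Metric.mem_cthickening_of_dist_le x _ δ K hx ?_
    rw [dist_eq_norm, sub_sub_cancel, norm_smul, h.norm_dir, mul_one, Real.norm_eq_abs,
      abs_of_pos hs]
    exact hsδ.le
  have hdown : ∀ s : ℝ, 0 < s → ∀ x ∈ W, φ x ≤ 0 → x - s • n ∈ W → x - s • n ∈ U := by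
    intro s hs x hx hφ hxs
    rw [h.graph.mem_iff _ hxs]
    have := h.graph.lt_of_lt (y := x) (s₁ := -s) (s₂ := 0) (by linarith)
      (by rwa [neg_smul, ← sub_eq_add_neg]) (by simpa using hx)
    rw [neg_smul, ← sub_eq_add_neg, zero_smul, add_zero] at this
    linarith
  have hUS : ∀ x ∈ W, (x ∈ U ∪ chartSurface W φ ↔ φ x ≤ 0) := by
    intro x hx
    rw [mem_union, h.graph.mem_iff x hx, le_iff_lt_or_eq]
    exact or_congr_right ⟨fun hx => hx.2, fun h0 => ⟨hx, h0⟩⟩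
  -- the translated field is `C¹` up to the boundary
  have hC1 : ∀ s : ℝ, 0 < s → s < δ → ∀ i, ∀ x ∈ U ∪ chartSurface W φ,
      ContDiffAt ℝ 1 (fun x => Q i (x - s • n)) x := by
    intro s hs hsδ i x hx
    have hsub : ContDiffAt ℝ 1 (fun x : 𝔼 => x - s • n) x := by fun_prop
    by_cases hxK : x - s • n ∈ K
    · have hxW := hδW (hshiftK s hs hsδ x hxK)
      have hxU := hdown s hs x hxW ((hUS x hxW).1 hx) (hKW hxK)
      exact ((hQd i).contDiffAt (hU.mem_nhds hxU)).comp x hsub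
    · have : ContDiffAt ℝ 1 (Q i) (x - s • n) :=
        contDiffAt_const.congr_of_eventuallyEq (hoff i _ hxK)
      exact this.comp x hsub
  have hK'c : IsCompact (K' ∩ φ ⁻¹' Iic 0) :=
    hK'.inter_right (isClosed_Iic.preimage h.graph.smooth.continuous)
  have hK'US : K' ∩ φ ⁻¹' Iic 0 ⊆ U ∪ chartSurface W φ := fun x hx =>
    (hUS x (hδW hx.1)).2 hx.2
  have hfd : ∀ s : ℝ, ∀ i x, fderiv ℝ (fun x => Q i (x - s • n)) x = fderiv ℝ (Q i) (x - s • n) :=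
    fun s i x => fderiv_comp_sub (s • n)
  have hshift : ∀ s : ℝ, 0 < s → s < δ → ∫ x in U, D (x - s • n) =
      ∫ x in chartSurface W φ, ∑ i, unitGrad φ x i * Q i (x - s • n) ∂σ := by
    intro s hs hsδ
    have := h.integral_div_of_integrable hU (Q := fun i x => Q i (x - s • n)) hK' hδW
      (fun i x hx => hQ0 i _ fun hxs => hx (hshiftK s hs hsδ x hxs))
      (fun i x hx => (hC1 s hs hsδ i x hx).continuousAt.continuousWithinAt)
      (fun i x hx => (hC1 s hs hsδ i x (Or.inl hx)).differentiableAt (by norm_num)) ?_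
    · simp only [hfd] at this
      exact this
    · intro i v
      have hc : ContinuousOn (fun x => fderiv ℝ (fun x => Q i (x - s • n)) x v)
          (K' ∩ φ ⁻¹' Iic 0) := fun x hx =>
        (((hC1 s hs hsδ i x (hK'US hx)).fderiv_right (m := 0) (by norm_num)).continuousAt.clm_apply
          continuousAt_const).continuousWithinAt
      refine (hc.integrableOn_compact hK'c).of_forall_sdiff_eq_zero hU.measurableSet ?_
      rintro x ⟨hxU, hxn⟩
      have hxK : x - s • n ∉ K := fun hxs => hxn
        ⟨hshiftK s hs hsδ x hxs, (hUS x (hδW (hshiftK s hs hsδ x hxs))).1 (Or.inl hxU)⟩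
      rw [hfd, (hoff i _ hxK).fderiv_eq]; simp
  -- limit of the volume integrals
  have lim1 : Tendsto (fun s : ℝ => ∫ x in U, D (x - s • n)) (𝓝[>] 0) (𝓝 (∫ x in U, D x)) := by
    have hDi : Integrable (U.indicator D) := hint.integrable_indicator hU.measurableSet
    have heq : ∀ᶠ s : ℝ in 𝓝[>] 0, ∫ x, ((fun x => x + s • n) ⁻¹' U).indicator (U.indicator D) x =
        ∫ x in U, D (x - s • n) := by
      filter_upwards [Ioo_mem_nhdsGT hδ] with s hs
      rw [← integral_indicator hU.measurableSet,
        ← integral_add_right_eq_self (U.indicator fun x => D (x - s • n)) (s • n)]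
      refine integral_congr_ae (Eventually.of_forall fun x => ?_)
      by_cases hxU : x + s • n ∈ U
      · simp only [indicator_of_mem hxU, add_sub_cancel_right]
        rw [indicator_of_mem (show x ∈ (fun x => x + s • n) ⁻¹' U from hxU)]
        by_cases hxK : x ∈ K
        · have hx1 : x + s • n ∈ W := hδW (hshiftK s hs.1 hs.2 _ (by simpa using hxK))
          have := hdown s hs.1 _ hx1 ((h.graph.mem_iff _ hx1).1 hxU).le (by simpa using hKW hxK)
          rw [add_sub_cancel_right] at this
          rw [indicator_of_mem this]
        · rw [hD0 x hxK]
          by_cases hx : x ∈ U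
          · rw [indicator_of_mem hx, hD0 x hxK]
          · rw [indicator_of_notMem hx]
      · simp only [indicator_of_notMem hxU]
        rw [indicator_of_notMem (show x ∉ (fun x => x + s • n) ⁻¹' U from hxU)]
    refine Tendsto.congr' heq ?_
    rw [← integral_indicator hU.measurableSet]
    refine tendsto_integral_filter_of_dominated_convergence (fun x => ‖U.indicator D x‖)
      (Eventually.of_forall fun s => hDi.aestronglyMeasurable.indicator
        (hU.measurableSet.preimage (measurable_id.add_const _)))
      (Eventually.of_forall fun s => Eventually.of_forall fun x => norm_indicator_le_norm_self _ _)
      hDi.norm (Eventually.of_forall fun x => ?_)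
    by_cases hxU : x ∈ U
    · have hc : Tendsto (fun s : ℝ => x + s • n) (𝓝[>] 0) (𝓝 x) := by
        have : Continuous fun s : ℝ => x + s • n := by fun_prop
        simpa using (this.tendsto 0).mono_left nhdsWithin_le_nhds
      refine tendsto_const_nhds.congr' ?_
      filter_upwards [hc (hU.mem_nhds hxU)] with s hs
      rw [indicator_of_mem (show x ∈ (fun x => x + s • n) ⁻¹' U from hs)]
    · refine tendsto_const_nhds.congr fun s => ?_
      simp [Set.indicator, hxU]
  -- limit of the boundary integrals
  have hbd : ∀ i, ∃ M, ∀ x ∈ U ∪ chartSurface W φ, |Q i x| ≤ M := by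
    intro i
    have hc : IsCompact (K ∩ φ ⁻¹' Iic 0) :=
      hK.inter_right (isClosed_Iic.preimage h.graph.smooth.continuous)
    obtain ⟨M, hM⟩ := hc.exists_bound_of_continuousOn
      ((hQc i).mono fun x hx => (hUS x (hKW hx.1)).2 hx.2)
    refine ⟨max M 0, fun x hx => ?_⟩
    by_cases hxK : x ∈ K
    · exact (hM x ⟨hxK, (hUS x (hKW hxK)).1 hx⟩).trans (le_max_left _ _)
    · rw [hQ0 i x hxK, abs_zero]; exact le_max_right _ _
  choose M hM using hbd
  have hSm := h.graph.isTransversePiece.meas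
  have lim2 : Tendsto (fun s : ℝ => ∫ x in chartSurface W φ, ∑ i, unitGrad φ x i * Q i (x - s • n) ∂σ)
      (𝓝[>] 0) (𝓝 (∫ x in chartSurface W φ, ∑ i, unitGrad φ x i * Q i x ∂σ)) := by
    have hνc : ∀ i, ContinuousOn (fun x => unitGrad φ x i) (chartSurface W φ) := fun i => by
      have := h.graph.isTransversePiece.cont
      fun_prop
    have hν1 : ∀ i, ∀ x ∈ chartSurface W φ, |unitGrad φ x i| ≤ 1 := fun i x hx => by
      rw [← h.graph.isTransversePiece.norm_normal x hx]
      exact PiLp.norm_apply_le (unitGrad φ x) i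
    refine tendsto_integral_filter_of_dominated_convergence
      ((chartSurface W φ ∩ K').indicator fun _ => ∑ i, M i) ?_ ?_ ?_ ?_
    · filter_upwards [Ioo_mem_nhdsGT hδ] with s hs
      refine ContinuousOn.aestronglyMeasurable ?_ hSm
      refine continuousOn_finsetSum _ fun i _ => (hνc i).mul fun x hx => ?_
      exact (hC1 s hs.1 hs.2 i x (Or.inr hx)).continuousAt.continuousWithinAt
    · filter_upwards [Ioo_mem_nhdsGT hδ] with s hs
      refine (ae_restrict_mem hSm).mono fun x hx => ?_
      by_cases hxK : x - s • n ∈ K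
      · have hxK' := hshiftK s hs.1 hs.2 x hxK
        rw [indicator_of_mem (show x ∈ chartSurface W φ ∩ K' from ⟨hx, hxK'⟩)]
        refine (norm_sum_le _ _).trans (Finset.sum_le_sum fun i _ => ?_)
        have hxU := hdown s hs.1 x hx.1 hx.2.le (hKW hxK)
        rw [norm_mul, Real.norm_eq_abs, Real.norm_eq_abs]
        calc _ ≤ 1 * M i := mul_le_mul (hν1 i x hx) (hM i _ (Or.inl hxU)) (abs_nonneg _) zero_le_one
          _ = M i := one_mul _
      · rw [Finset.sum_eq_zero fun i _ => by rw [hQ0 i _ hxK, mul_zero], norm_zero]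
        refine indicator_nonneg (fun y hy => Finset.sum_nonneg fun i _ => ?_) x
        exact (abs_nonneg _).trans (hM i y (Or.inr hy.1))
    · rw [integrable_indicator_iff (hSm.inter hK'.measurableSet)]
      refine integrableOn_const ?_
      rw [Measure.restrict_apply (hSm.inter hK'.measurableSet), inter_right_comm, inter_self]
      exact (h.graph.measure_inter_lt_top h.norm_dir hK' hδW).ne
    · refine (ae_restrict_mem hSm).mono fun x hx => ?_
      refine tendsto_finsetSum _ fun i _ => Tendsto.const_mul _ ?_
      have hc : Tendsto (fun s : ℝ => x - s • n) (𝓝[>] 0) (𝓝 x) := by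
        have : Continuous fun s : ℝ => x - s • n := by fun_prop
        simpa using (this.tendsto 0).mono_left nhdsWithin_le_nhds
      refine (hQc i x (Or.inr hx)).tendsto.comp (tendsto_nhdsWithin_iff.2 ⟨hc, ?_⟩)
      filter_upwards [hc (h.graph.isOpen.mem_nhds hx.1), self_mem_nhdsWithin] with s hs hs0
      exact Or.inl (hdown s hs0 x hx.1 hx.2.le hs)
  refine tendsto_nhds_unique lim1 (lim2.congr' ?_)
  filter_upwards [Ioo_mem_nhdsGT hδ] with s hs
  exact (hshift s hs.1 hs.2).symm

end ChartDivergence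

/-! ### Globalization by a partition of unity -/

section GlobalDivergence

set_option linter.unusedSectionVars false

variable {ι : Type*} [Fintype ι] [DecidableEq ι]
variable {U W : Set (EuclideanSpace ℝ ι)} {φ : EuclideanSpace ℝ ι → ℝ} {n : EuclideanSpace ℝ ι}

local notation "𝔼" => EuclideanSpace ℝ ι
local notation "σ" => (μHE[finrank ℝ (EuclideanSpace ℝ ι) - 1] : Measure (EuclideanSpace ℝ ι))

theorem IsGraphChart.mem_frontier_iff {e : 𝔼} (h : IsGraphChart U W φ e) (hU : IsOpen U) {x : 𝔼}
    (hx : x ∈ W) : x ∈ frontier U ↔ φ x = 0 := by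
  rw [hU.frontier_eq, Set.mem_sdiff, h.mem_iff x hx]
  constructor
  · rintro ⟨hcl, hge⟩
    by_contra hne
    have hpos : 0 < φ x := lt_of_le_of_ne (not_lt.1 hge) (Ne.symm hne)
    have hO : IsOpen (W ∩ φ ⁻¹' Ioi 0) := h.isOpen.inter (isOpen_Ioi.preimage h.smooth.continuous)
    obtain ⟨y, ⟨hyW, hy0⟩, hyU⟩ := mem_closure_iff.1 hcl _ hO ⟨hx, hpos⟩
    exact absurd ((h.mem_iff y hyW).1 hyU) (not_lt.2 (le_of_lt hy0))
  · intro h0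
    refine ⟨?_, by rw [h0]; exact lt_irrefl _⟩
    have hc : Tendsto (fun s : ℝ => x + s • e) (𝓝[<] 0) (𝓝 x) := by
      have : Continuous fun s : ℝ => x + s • e := by fun_prop
      simpa using (this.tendsto 0).mono_left nhdsWithin_le_nhds
    refine mem_closure_of_tendsto hc ?_
    filter_upwards [hc (h.isOpen.mem_nhds hx), self_mem_nhdsWithin] with s hs hs0
    rw [h.mem_iff _ hs, ← h0]
    have := h.lt_of_lt (y := x) hs0 hs (by simpa using hx)
    simpa using this

theorem IsGraphChart.chartSurface_eq {e : 𝔼} (h : IsGraphChart U W φ e) (hU : IsOpen U) :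
    chartSurface W φ = frontier U ∩ W := by
  ext x
  exact ⟨fun hx => ⟨(h.mem_frontier_iff hU hx.1).2 hx.2, hx.1⟩,
    fun hx => ⟨hx.2, (h.mem_frontier_iff hU hx.2).1 hx.1⟩⟩

theorem setIntegral_frontier_eq_chartSurface {e : 𝔼} (h : IsGraphChart U W φ e) (hU : IsOpen U)
    {g : 𝔼 → ℝ} (hg : ∀ x, x ∉ W → g x = 0) :
    ∫ x in frontier U, g x ∂σ = ∫ x in chartSurface W φ, g x ∂σ := by
  rw [h.chartSurface_eq hU]
  refine setIntegral_eq_of_subset_of_forall_sdiff_eq_zero isClosed_frontier.measurableSet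
    inter_subset_left fun x hx => hg x fun hxW => hx.2 ⟨hx.1, hxW⟩

/-- The divergence theorem on an open set that is covered by charts, for a field whose divergence
is integrable. -/
theorem integral_div_of_charts (hU : IsOpen U) {ν : 𝔼 → 𝔼} {K : Set 𝔼} (hK : IsCompact K)
    (hchart : ∀ p ∈ K, ∃ W φ n, p ∈ W ∧ IsDivChart U W φ n ∧
      ∀ x ∈ chartSurface W φ, unitGrad φ x = ν x)
    {Q : ι → 𝔼 → ℝ} (hQ0 : ∀ i x, x ∉ K → Q i x = 0) (hQc : ∀ i, ContinuousOn (Q i) (closure U))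
    (hQd : ∀ i, ContDiffOn ℝ 1 (Q i) U)
    (hint : IntegrableOn (fun x => ∑ i, fderiv ℝ (Q i) x (EuclideanSpace.single i 1)) U) :
    ∫ x in U, ∑ i, fderiv ℝ (Q i) x (EuclideanSpace.single i 1) =
      ∫ x in frontier U, ∑ i, ν x i * Q i x ∂σ := by
  choose! W φ n hpW hch hν using hchart
  obtain ⟨t, htcov⟩ := hK.elim_nhds_subcover' (fun p _ => W p) fun p hp =>
    (hch p hp).graph.isOpen.mem_nhds (hpW p hp)
  obtain ⟨f, hf⟩ := SmoothPartitionOfUnity.exists_isSubordinate (modelWithCornersSelf ℝ 𝔼)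
    (s := K) hK.isClosed (fun p : t => W p.1) (fun p => (hch p.1 p.1.2).graph.isOpen)
    (by
      intro x hx
      obtain ⟨p, hp, hxp⟩ := mem_iUnion₂.1 (htcov hx)
      exact mem_iUnion.2 ⟨⟨p, hp⟩, hxp⟩)
  have hfs : ∀ j, ContDiff ℝ ∞ (f j) := fun j => (f j).contMDiff.contDiff
  have hfd : ∀ j, Differentiable ℝ (f j) := fun j => (hfs j).differentiable (by norm_num)
  have hf1 : ∀ x ∈ K, ∑ j, f j x = 1 := fun x hx => by
    rw [← finsum_eq_sum_of_fintype]; exact f.sum_eq_one hx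
  have hfQ : ∀ i x, ∑ j, f j x * Q i x = Q i x := fun i x => by
    by_cases hx : x ∈ K
    · rw [← Finset.sum_mul, hf1 x hx, one_mul]
    · simp [hQ0 i x hx]
  have hf01 : ∀ j x, ‖f j x‖ ≤ 1 := fun j x => by
    rw [Real.norm_eq_abs, abs_of_nonneg (f.nonneg j x)]; exact f.le_one j x
  have hQi : ∀ i, ∀ x ∈ U, DifferentiableAt ℝ (Q i) x := fun i x hx =>
    ((hQd i).differentiableOn (by norm_num)).differentiableAt (hU.mem_nhds hx)
  set Kj : t → Set 𝔼 := fun j => K ∩ tsupport (f j) with hKj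
  have hKjc : ∀ j, IsCompact (Kj j) := fun j => hK.inter_right (isClosed_tsupport _)
  have hKjW : ∀ j, Kj j ⊆ W j.1 := fun j x hx => hf j hx.2
  have hg0 : ∀ j i x, x ∉ Kj j → f j x * Q i x = 0 := by
    intro j i x hx
    by_cases hxK : x ∈ K
    · have : x ∉ tsupport (f j) := fun h => hx ⟨hxK, h⟩
      rw [image_eq_zero_of_notMem_tsupport this, zero_mul]
    · rw [hQ0 i x hxK, mul_zero]
  have hcl : ∀ j : t, U ∪ chartSurface (W j.1) (φ j.1) ⊆ closure U := fun j =>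
    union_subset subset_closure (by
      rw [(hch j.1 j.1.2).graph.chartSurface_eq hU]
      exact fun x hx => frontier_subset_closure hx.1)
  have hgc : ∀ j i, ContinuousOn (fun x => f j x * Q i x) (closure U) := fun j i =>
    (hfs j).continuous.continuousOn.mul (hQc i)
  have hfder : ∀ j, ∀ x ∈ U, ∑ i, fderiv ℝ (fun x => f j x * Q i x) x (EuclideanSpace.single i 1) =
      f j x * (∑ i, fderiv ℝ (Q i) x (EuclideanSpace.single i 1)) +
        ∑ i, fderiv ℝ (f j) x (EuclideanSpace.single i 1) * Q i x := by
    intro j x hx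
    rw [Finset.mul_sum, ← Finset.sum_add_distrib]
    refine Finset.sum_congr rfl fun i _ => ?_
    rw [fderiv_fun_mul (hfd j x) (hQi i x hx)]
    simp [mul_comm]
  have hint2 : ∀ j i, IntegrableOn
      (fun x => fderiv ℝ (f j) x (EuclideanSpace.single i 1) * Q i x) U := by
    intro j i
    have hc : ContinuousOn (fun x => fderiv ℝ (f j) x (EuclideanSpace.single i 1) * Q i x)
        (K ∩ closure U) :=
      (((hfs j).continuous_fderiv (by norm_num)).clm_apply continuous_const).continuousOn.mul
        ((hQc i).mono inter_subset_right)
    refine (hc.integrableOn_compact (hK.inter_right isClosed_closure)).of_forall_sdiff_eq_zero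
      hU.measurableSet fun x hx => ?_
    rw [hQ0 i x fun hxK => hx.2 ⟨hxK, subset_closure hx.1⟩, mul_zero]
  have hint1 : ∀ j, IntegrableOn
      (fun x => f j x * ∑ i, fderiv ℝ (Q i) x (EuclideanSpace.single i 1)) U := fun j =>
    Integrable.bdd_mul hint ((hfs j).continuous.aestronglyMeasurable)
      (Eventually.of_forall (hf01 j))
  have hintj : ∀ j, IntegrableOn (fun x => ∑ i, fderiv ℝ (fun x => f j x * Q i x) x
      (EuclideanSpace.single i 1)) U := fun j => by
    have h2 : IntegrableOn (fun x => ∑ i, fderiv ℝ (f j) x (EuclideanSpace.single i 1) * Q i x) U :=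
      integrable_finsetSum Finset.univ fun i _ => hint2 j i
    exact IntegrableOn.congr_fun ((hint1 j).add h2) (fun x hx => (hfder j x hx).symm)
      hU.measurableSet
  have hloc : ∀ j, ∫ x in U, ∑ i, fderiv ℝ (fun x => f j x * Q i x) x (EuclideanSpace.single i 1) =
      ∫ x in frontier U, ∑ i, ν x i * (f j x * Q i x) ∂σ := by
    intro j
    rw [(hch j.1 j.1.2).integral_div hU (Q := fun i x => f j x * Q i x) (hKjc j) (hKjW j) (hg0 j)
      (fun i => (hgc j i).mono (hcl j)) (fun i => ((hfs j).of_le (by norm_num)).contDiffOn.mul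
        (hQd i)) (hintj j),
      setIntegral_frontier_eq_chartSurface (hch j.1 j.1.2).graph hU]
    · refine setIntegral_congr_fun (hch j.1 j.1.2).graph.isTransversePiece.meas fun x hx => ?_
      simp only [hν j.1 j.1.2 x hx]
    · intro x hx
      exact Finset.sum_eq_zero fun i _ => by rw [hg0 j i x fun h => hx (hKjW j h), mul_zero]
  have hbint : ∀ j, IntegrableOn (fun x => ∑ i, ν x i * (f j x * Q i x)) (frontier U) σ := by
    intro j
    have hG := (hch j.1 j.1.2).graph
    have h1 : IntegrableOn (fun x => ∑ i, unitGrad (φ j.1) x i * (f j x * Q i x))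
        (chartSurface (W j.1) (φ j.1)) σ := by
      refine hG.integrableOn_chartSurface (hch j.1 j.1.2).norm_dir (hKjc j) (hKjW j)
        (fun x hx => Finset.sum_eq_zero fun i _ => by rw [hg0 j i x hx, mul_zero]) ?_
      refine continuousOn_finsetSum _ fun i _ => ContinuousOn.mul ?_
        ((hgc j i).mono (subset_union_right.trans (hcl j)))
      have := hG.isTransversePiece.cont
      fun_prop
    have h2 : IntegrableOn (fun x => ∑ i, ν x i * (f j x * Q i x))
        (chartSurface (W j.1) (φ j.1)) σ :=
      h1.congr_fun (fun x hx => by simp only [hν j.1 j.1.2 x hx]) hG.isTransversePiece.meas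
    refine h2.of_forall_sdiff_eq_zero isClosed_frontier.measurableSet fun x hx => ?_
    refine Finset.sum_eq_zero fun i _ => ?_
    rw [hg0 j i x fun h => hx.2 ?_, mul_zero]
    rw [hG.chartSurface_eq hU]; exact ⟨hx.1, hKjW j h⟩
  calc ∫ x in U, ∑ i, fderiv ℝ (Q i) x (EuclideanSpace.single i 1)
      = ∫ x in U, ∑ j, ∑ i, fderiv ℝ (fun x => f j x * Q i x) x (EuclideanSpace.single i 1) := by
        refine setIntegral_congr_fun hU.measurableSet fun x hx => ?_
        beta_reduce
        rw [Finset.sum_comm]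
        refine Finset.sum_congr rfl fun i _ => ?_
        have hQe : Q i = fun x => ∑ j, f j x * Q i x := funext fun x => (hfQ i x).symm
        conv_lhs => rw [hQe]
        rw [fderiv_fun_sum fun j _ => (hfd j x).fun_mul (hQi i x hx)]
        simp
    _ = ∑ j, ∫ x in U, ∑ i, fderiv ℝ (fun x => f j x * Q i x) x (EuclideanSpace.single i 1) :=
        integral_finsetSum _ fun j _ => hintj j
    _ = ∑ j, ∫ x in frontier U, ∑ i, ν x i * (f j x * Q i x) ∂σ :=
        Finset.sum_congr rfl fun j _ => hloc j
    _ = ∫ x in frontier U, ∑ j, ∑ i, ν x i * (f j x * Q i x) ∂σ :=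
        (integral_finsetSum _ fun j _ => hbint j).symm
    _ = ∫ x in frontier U, ∑ i, ν x i * Q i x ∂σ := by
        refine integral_congr_ae (Eventually.of_forall fun x => ?_)
        beta_reduce
        rw [Finset.sum_comm]
        refine Finset.sum_congr rfl fun i _ => ?_
        rw [← Finset.mul_sum, hfQ]

theorem measure_frontier_inter_lt_top_of_charts (hU : IsOpen U) {K : Set 𝔼} (hK : IsCompact K)
    (hchart : ∀ p ∈ K, ∃ W φ n, p ∈ W ∧ IsDivChart U W φ n) : σ (frontier U ∩ K) < ⊤ := by
  have hloc : ∀ p ∈ K, ∃ O ∈ 𝓝 p, σ (frontier U ∩ O) < ⊤ := by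
    intro p hp
    obtain ⟨W, φ, n, hpW, hch⟩ := hchart p hp
    obtain ⟨r, hr, hrW⟩ := Metric.nhds_basis_closedBall.mem_iff.1
      (hch.graph.isOpen.mem_nhds hpW)
    refine ⟨Metric.closedBall p r, Metric.closedBall_mem_nhds p hr, ?_⟩
    have := hch.graph.measure_inter_lt_top hch.norm_dir (isCompact_closedBall p r) hrW
    rwa [hch.graph.chartSurface_eq hU, inter_assoc, inter_eq_right.2 hrW] at this
  choose! O hO hfin using hloc
  obtain ⟨t, htK, htcov⟩ := hK.elim_nhds_subcover O hO
  refine lt_of_le_of_lt (measure_mono (inter_subset_inter_right _ htcov)) ?_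
  rw [inter_iUnion₂]
  exact (measure_biUnion_lt_top t.finite_toSet fun p hp => hfin p (htK p hp))

end GlobalDivergence

end

/-! ### The divergence theorem for the induced surface measure -/

namespace Ultrahyperbolic

variable {m n : ℕ}

/-- The sign `g^{αα}` of a coordinate direction: `-1` for time, `1` for space. -/
def sgn : Fin m ⊕ Fin n → ℝ := Sum.elim (fun _ => -1) (fun _ => 1)

theorem sgn_mul_self (α : Fin m ⊕ Fin n) : sgn α * sgn α = 1 := by
  rcases α with i | k <;> simp [sgn]

theorem metric_eq_sum (X Y : Spacetime m n) : metric X Y = ∑ α, sgn α * (X α * Y α) := by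
  rw [metric, Fintype.sum_sum_type]
  simp [sgn]

theorem metric_add_right (X Y Z : Spacetime m n) : metric X (Y + Z) = metric X Y + metric X Z := by
  simp only [metric_eq_sum, PiLp.add_apply, mul_add, Finset.sum_add_distrib]

theorem metric_smul_right (c : ℝ) (X Y : Spacetime m n) : metric X (c • Y) = c * metric X Y := by
  simp only [metric_eq_sum, PiLp.smul_apply, smul_eq_mul, Finset.mul_sum]
  exact Finset.sum_congr rfl fun α _ => by ring

theorem metric_comm (X Y : Spacetime m n) : metric X Y = metric Y X := by
  simp only [metric_eq_sum]
  exact Finset.sum_congr rfl fun α _ => by ring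

/-- The isometry that flips the sign of the time coordinates. It turns a `g`-gradient into a
Euclidean one. -/
noncomputable def timeFlip (X : Spacetime m n) : Spacetime m n := WithLp.toLp 2 fun α => sgn α * X α

theorem timeFlip_apply (X : Spacetime m n) (α : Fin m ⊕ Fin n) : timeFlip X α = sgn α * X α := rfl

theorem continuous_timeFlip : Continuous (timeFlip : Spacetime m n → Spacetime m n) := by
  unfold timeFlip
  fun_prop

theorem timeFlip_timeFlip (X : Spacetime m n) : timeFlip (timeFlip X) = X := by
  ext α
  rw [timeFlip_apply, timeFlip_apply, ← mul_assoc, sgn_mul_self, one_mul]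

theorem norm_timeFlip (X : Spacetime m n) : ‖timeFlip X‖ = ‖X‖ := by
  rw [EuclideanSpace.norm_eq, EuclideanSpace.norm_eq]
  congr 1
  refine Finset.sum_congr rfl fun α _ => ?_
  rcases α with i | k <;> simp [timeFlip_apply, sgn]

theorem inner_timeFlip (X Y : Spacetime m n) : ⟪timeFlip X, Y⟫ = metric X Y := by
  rw [metric_eq_sum, PiLp.inner_apply]
  refine Finset.sum_congr rfl fun α _ => ?_
  simp [timeFlip_apply]; ring

theorem timeFlip_smul (c : ℝ) (X : Spacetime m n) : timeFlip (c • X) = c • timeFlip X := by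
  ext α
  simp only [timeFlip_apply, PiLp.smul_apply, smul_eq_mul]
  ring

variable {U : Set (Spacetime m n)} {p N : Spacetime m n} {φ : Spacetime m n → ℝ}

/-- The differential of a defining function is a positive multiple of the conormal `g(N, ·)`. -/
theorem IsOuterUnitNormal.fderiv_eq (hN : IsOuterUnitNormal U p N) (hφ : IsDefiningFunction U p φ)
    (Y : Spacetime m n) : fderiv ℝ φ p Y = fderiv ℝ φ p N * metric N Y := by
  have hpos := hN.outward φ hφ
  have hker : fderiv ℝ φ p (Y + (-(fderiv ℝ φ p Y / fderiv ℝ φ p N)) • N) = 0 := by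
    rw [map_add, map_smul, smul_eq_mul]
    field_simp; ring
  have h := hN.normal φ hφ _ hker
  rw [metric_add_right, metric_smul_right, hN.unit] at h
  field_simp at h
  linarith

theorem IsOuterUnitNormal.ne_zero (hN : IsOuterUnitNormal U p N) : N ≠ 0 := by
  intro h0
  have := hN.unit
  rw [h0] at this
  simp [metric] at this

theorem IsOuterUnitNormal.one_le_norm (hN : IsOuterUnitNormal U p N) : 1 ≤ ‖N‖ := by
  have h1 := real_inner_le_norm (timeFlip N) N
  rw [inner_timeFlip, hN.unit, norm_timeFlip] at h1
  nlinarith [norm_nonneg N]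

/-- The Euclidean unit normal is the normalized time flip of the `g`-unit normal. -/
theorem IsOuterUnitNormal.unitGrad_eq (hN : IsOuterUnitNormal U p N)
    (hφ : IsDefiningFunction U p φ) : unitGrad φ p = ‖N‖⁻¹ • timeFlip N := by
  have hpos := hN.outward φ hφ
  have hg : ∇ φ p = fderiv ℝ φ p N • timeFlip N := by
    refine ext_inner_right ℝ fun Y => ?_
    rw [inner_grad, hN.fderiv_eq hφ Y, inner_smul_left, inner_timeFlip]
    rfl
  rw [unitGrad, hg, norm_smul, norm_timeFlip, smul_smul, Real.norm_of_nonneg hpos.le, mul_inv,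
    mul_right_comm, inv_mul_cancel₀ hpos.ne', one_mul]

/-- A smooth boundary point has a chart in which the function is a defining function of every
boundary point. -/
theorem exists_divChart_frontier (hφ : IsDefiningFunction U p φ) :
    ∃ W n', p ∈ W ∧ IsDivChart U W φ n' ∧
      ∀ x ∈ chartSurface W φ, IsDefiningFunction U x φ := by
  have hφ1 : ContDiff ℝ 1 φ := hφ.smooth.of_le (by exact_mod_cast le_top)
  have hdc := hφ1.continuous_fderiv (by norm_num)
  have hg0 : ∇ φ p ≠ 0 := by
    intro h0
    refine hφ.fderiv_ne_zero (ContinuousLinearMap.ext fun Y => ?_)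
    rw [← inner_grad, h0, inner_zero_left]; rfl
  have hgpos := norm_pos_iff.2 hg0
  set n' : Spacetime m n := ‖∇ φ p‖⁻¹ • ∇ φ p with hn'
  have hn1 : ‖n'‖ = 1 := by
    rw [hn', norm_smul, norm_inv, norm_norm, inv_mul_cancel₀ hgpos.ne']
  have hdn : fderiv ℝ φ p n' = ‖∇ φ p‖ := by
    rw [hn', map_smul, ← inner_grad, real_inner_self_eq_norm_sq, smul_eq_mul]
    field_simp
  have hdb : ∀ α, 0 < fderiv ℝ φ p (EuclideanSpace.single α 1 + (2 : ℝ) • n') := by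
    intro α
    have h1 := abs_real_inner_le_norm (∇ φ p) (EuclideanSpace.single α 1)
    rw [inner_grad, PiLp.norm_single, norm_one, mul_one] at h1
    rw [map_add, map_smul, hdn, smul_eq_mul]
    linarith [(abs_le.1 h1).1]
  have e1 : ∀ᶠ x in 𝓝 p, 0 < fderiv ℝ φ x n' :=
    (hdc.clm_apply continuous_const).continuousAt.eventually
      (lt_mem_nhds (show 0 < fderiv ℝ φ p n' by rw [hdn]; exact hgpos))
  have e2 : ∀ᶠ x in 𝓝 p, ∀ α, 0 < fderiv ℝ φ x (EuclideanSpace.single α 1 + (2 : ℝ) • n') :=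
    eventually_all.2 fun α => (hdc.clm_apply continuous_const).continuousAt.eventually
      (lt_mem_nhds (hdb α))
  obtain ⟨r, hr, hball⟩ := Metric.eventually_nhds_iff_ball.1 (e1.and (e2.and hφ.locally_eq))
  have hgr : ∀ e, (∀ x ∈ Metric.ball p r, 0 < fderiv ℝ φ x e) →
      IsGraphChart U (Metric.ball p r) φ e := fun e he =>
    ⟨Metric.isOpen_ball, convex_ball p r, hφ1, he, fun x hx => (hball x hx).2.2⟩
  refine ⟨Metric.ball p r, n', Metric.mem_ball_self hr,
    ⟨hn1, hgr _ fun x hx => (hball x hx).1, fun α => hgr _ fun x hx => (hball x hx).2.1 α⟩,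
    fun x hx => ⟨hφ.smooth, hx.2, ?_, ?_⟩⟩
  · filter_upwards [Metric.isOpen_ball.mem_nhds hx.1] with q hq using (hball q hq).2.2
  · intro h0
    have := (hball x hx.1).1
    rw [h0] at this
    exact lt_irrefl _ this

/-- Away from the boundary an affine function serves as chart function, with empty surface. -/
theorem exists_divChart_of_notMem_frontier [Nonempty (Fin m ⊕ Fin n)] (hp : p ∉ frontier U) :
    ∃ W φ n', p ∈ W ∧ IsDivChart U W φ n' ∧ chartSurface W φ = ∅ := by
  obtain ⟨α₀⟩ := ‹Nonempty (Fin m ⊕ Fin n)›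
  set n' : Spacetime m n := EuclideanSpace.single α₀ 1 with hn'
  have hn1 : ‖n'‖ = 1 := by rw [hn', PiLp.norm_single, norm_one]
  obtain ⟨r, hr, hside⟩ : ∃ r > 0, Metric.ball p r ⊆ U ∨ Metric.ball p r ⊆ Uᶜ := by
    by_cases hi : p ∈ interior U
    · obtain ⟨r, hr, hb⟩ := Metric.isOpen_iff.1 isOpen_interior p hi
      exact ⟨r, hr, Or.inl (hb.trans interior_subset)⟩
    · have hc : p ∈ (closure U)ᶜ := fun h => hp ⟨h, hi⟩
      obtain ⟨r, hr, hb⟩ := Metric.isOpen_iff.1 isClosed_closure.isOpen_compl p hc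
      exact ⟨r, hr, Or.inr (hb.trans (compl_subset_compl.2 subset_closure))⟩
  have main : ∀ c : ℝ, (∀ x ∈ Metric.ball p r, ⟪n', x - p⟫ + c ≠ 0) →
      (∀ x ∈ Metric.ball p r, (x ∈ U ↔ ⟪n', x - p⟫ + c < 0)) →
      ∃ W φ n', p ∈ W ∧ IsDivChart U W φ n' ∧ chartSurface W φ = ∅ := by
    intro c hc hmem
    set ψ : Spacetime m n → ℝ := fun x => ⟪n', x - p⟫ + c with hψ
    have hψd : ∀ x, HasFDerivAt ψ (innerSL ℝ n') x := fun x => by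
      have h1 : HasFDerivAt (fun x : Spacetime m n => x - p) (ContinuousLinearMap.id ℝ _) x :=
        (hasFDerivAt_id x).sub_const p
      exact ((innerSL ℝ n').hasFDerivAt.comp x h1).add_const c
    have hψs : ContDiff ℝ 1 ψ :=
      (contDiff_const.inner ℝ (contDiff_id.sub contDiff_const)).add contDiff_const
    have hgr : ∀ e, 0 < ⟪n', e⟫ → IsGraphChart U (Metric.ball p r) ψ e := fun e he =>
      ⟨Metric.isOpen_ball, convex_ball p r, hψs, fun x _ => by
        rw [(hψd x).fderiv]; exact he, hmem⟩
    refine ⟨Metric.ball p r, ψ, n', Metric.mem_ball_self hr, ⟨hn1, hgr _ ?_, fun α => hgr _ ?_⟩, ?_⟩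
    · rw [real_inner_self_eq_norm_sq, hn1]; norm_num
    · have h1 := abs_real_inner_le_norm n' (EuclideanSpace.single α 1)
      rw [hn1, PiLp.norm_single, norm_one, mul_one] at h1
      rw [inner_add_right, inner_smul_right, real_inner_self_eq_norm_sq, hn1]
      linarith [(abs_le.1 h1).1]
    · exact eq_empty_of_forall_notMem fun x hx => hc x hx.1 hx.2
  have hbd : ∀ x ∈ Metric.ball p r, |⟪n', x - p⟫| < r := fun x hx => by
    have h1 := abs_real_inner_le_norm n' (x - p)
    rw [hn1, one_mul, ← dist_eq_norm] at h1
    exact lt_of_le_of_lt h1 hx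
  rcases hside with hs | hs
  · refine main (-r) (fun x hx => ?_) fun x hx => ?_
    · have := abs_lt.1 (hbd x hx); linarith
    · have := abs_lt.1 (hbd x hx)
      exact ⟨fun _ => by linarith, fun _ => hs hx⟩
  · refine main r (fun x hx => ?_) fun x hx => ?_
    · have := abs_lt.1 (hbd x hx); linarith
    · have := abs_lt.1 (hbd x hx)
      exact ⟨fun h => absurd h (hs hx), fun h => by linarith⟩

/-- Every point has a chart in which the divergence theorem holds and in which the Euclidean normal is
expressed through the `g`-unit normal. -/
theorem exists_divChart [Nonempty (Fin m ⊕ Fin n)] (hU : IsOpen U) (hs : HasSmoothBoundary U)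
    {𝒩 : Spacetime m n → Spacetime m n} (hN : ∀ p ∈ frontier U, IsOuterUnitNormal U p (𝒩 p))
    (p : Spacetime m n) : ∃ W φ n', p ∈ W ∧ IsDivChart U W φ n' ∧
      ∀ x ∈ chartSurface W φ, unitGrad φ x = ‖𝒩 x‖⁻¹ • timeFlip (𝒩 x) := by
  by_cases hp : p ∈ frontier U
  · obtain ⟨φ, hφ⟩ := hs p hp
    obtain ⟨W, n', hpW, hch, hdef⟩ := exists_divChart_frontier hφ
    refine ⟨W, φ, n', hpW, hch, fun x hx => ?_⟩
    have hxf : x ∈ frontier U := (hch.graph.mem_frontier_iff hU hx.1).2 hx.2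
    exact (hN x hxf).unitGrad_eq (hdef x hx)
  · obtain ⟨W, φ, n', hpW, hch, hemp⟩ := exists_divChart_of_notMem_frontier hp
    exact ⟨W, φ, n', hpW, hch, by simp [hemp]⟩

theorem continuousOn_normal (hU : IsOpen U) (hs : HasSmoothBoundary U)
    {𝒩 : Spacetime m n → Spacetime m n} (hN : ∀ p ∈ frontier U, IsOuterUnitNormal U p (𝒩 p)) :
    ContinuousOn 𝒩 (frontier U) := by
  intro p hp
  obtain ⟨φ, hφ⟩ := hs p hp
  obtain ⟨W, n', hpW, hch, hdef⟩ := exists_divChart_frontier hφ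
  have hWS : frontier U ∩ W = chartSurface W φ := (hch.graph.chartSurface_eq hU).symm
  have hformula : ∀ x ∈ frontier U ∩ W,
      𝒩 x = (√(metric (timeFlip (unitGrad φ x)) (timeFlip (unitGrad φ x))))⁻¹ •
        timeFlip (unitGrad φ x) := by
    intro x hx
    have hxN := hN x hx.1
    have hn0 : 0 < ‖𝒩 x‖ := norm_pos_iff.2 hxN.ne_zero
    rw [hxN.unitGrad_eq (hdef x (hWS ▸ hx)), timeFlip_smul, timeFlip_timeFlip, metric_smul_right,
      metric_comm, metric_smul_right, hxN.unit, mul_one, Real.sqrt_mul_self (by positivity),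
      inv_inv, smul_smul, mul_inv_cancel₀ hn0.ne', one_smul]
  have hpos : ∀ x ∈ frontier U ∩ W,
      √(metric (timeFlip (unitGrad φ x)) (timeFlip (unitGrad φ x))) ≠ 0 := by
    intro x hx h0
    have h1 := hformula x hx
    rw [h0, inv_zero, zero_smul] at h1
    exact (hN x hx.1).ne_zero h1
  have hνc : ContinuousOn (fun x => timeFlip (unitGrad φ x)) (frontier U ∩ W) := by
    rw [hWS]
    exact continuous_timeFlip.comp_continuousOn hch.graph.isTransversePiece.cont
  have hmc : Continuous fun X : Spacetime m n => metric X X := by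
    unfold metric; fun_prop
  have hc : ContinuousOn 𝒩 (frontier U ∩ W) := by
    refine ContinuousOn.congr ?_ hformula
    exact ((Real.continuous_sqrt.comp hmc).comp_continuousOn hνc |>.inv₀ hpos).smul hνc
  exact (hc p ⟨hp, hpW⟩).mono_of_mem_nhdsWithin
    (inter_mem_nhdsWithin _ (hch.graph.isOpen.mem_nhds hpW))

theorem finrank_spacetime : Module.finrank ℝ (Spacetime m n) = m + n := by simp

/-- Compact parts of the boundary have finite Euclidean area. -/
theorem measure_frontier_inter_lt_top [Nonempty (Fin m ⊕ Fin n)] (hU : IsOpen U)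
    (hs : HasSmoothBoundary U) {𝒩 : Spacetime m n → Spacetime m n}
    (hN : ∀ p ∈ frontier U, IsOuterUnitNormal U p (𝒩 p)) {K : Set (Spacetime m n)}
    (hK : IsCompact K) :
    (Measure.euclideanHausdorffMeasure (m + n - 1) : Measure (Spacetime m n)) (frontier U ∩ K) < ⊤ := by
  have := measure_frontier_inter_lt_top_of_charts hU hK fun p _ => by
    obtain ⟨W, φ, n', hpW, hch, -⟩ := exists_divChart hU hs hN p
    exact ⟨W, φ, n', hpW, hch⟩
  rwa [finrank_spacetime] at this

theorem restrict_inducedSurfaceMeasure (𝒩 : Spacetime m n → Spacetime m n)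
    {A : Set (Spacetime m n)} (hA : MeasurableSet A) :
    (inducedSurfaceMeasure 𝒩).restrict A =
      ((Measure.euclideanHausdorffMeasure (m + n - 1)).restrict A).withDensity
        fun p => ENNReal.ofReal ‖𝒩 p‖⁻¹ := by
  rw [inducedSurfaceMeasure, restrict_withDensity hA]

/-- The divergence theorem, with the boundary integral expressed through the metric `g`. -/
theorem integral_divergence [Nonempty (Fin m ⊕ Fin n)] (hU : IsOpen U) (hs : HasSmoothBoundary U)
    {𝒩 : Spacetime m n → Spacetime m n} (hN : ∀ p ∈ frontier U, IsOuterUnitNormal U p (𝒩 p))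
    {Q : Fin m ⊕ Fin n → Spacetime m n → ℝ} {K : Set (Spacetime m n)} (hK : IsCompact K)
    (hQ0 : ∀ α x, x ∉ K → Q α x = 0) (hQc : ∀ α, ContinuousOn (Q α) (closure U))
    (hQd : ∀ α, ContDiffOn ℝ 1 (Q α) U)
    (hint : IntegrableOn (fun x => ∑ α, partialDeriv α (Q α) x) U) :
    ∫ x in U, ∑ α, partialDeriv α (Q α) x =
      ∫ x in frontier U, metric (𝒩 x) (WithLp.toLp 2 fun α => Q α x)
        ∂(inducedSurfaceMeasure 𝒩) := by
  have h1 := integral_div_of_charts hU (ν := fun x => ‖𝒩 x‖⁻¹ • timeFlip (𝒩 x)) hK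
    (fun p _ => exists_divChart hU hs hN p) hQ0 hQc hQd hint
  rw [finrank_spacetime] at h1
  have hdm : AEMeasurable (fun x => ENNReal.ofReal ‖𝒩 x‖⁻¹)
      ((Measure.euclideanHausdorffMeasure (m + n - 1)).restrict (frontier U)) := by
    have := (continuousOn_normal hU hs hN).aemeasurable isClosed_frontier.measurableSet
      (μ := Measure.euclideanHausdorffMeasure (m + n - 1))
    exact this.norm.inv.ennreal_ofReal
  rw [restrict_inducedSurfaceMeasure 𝒩 isClosed_frontier.measurableSet,
    integral_withDensity_eq_integral_toReal_smul₀ hdm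
      (Eventually.of_forall fun _ => ENNReal.ofReal_lt_top)]
  refine h1.trans (integral_congr_ae (Eventually.of_forall fun x => ?_))
  simp only [smul_eq_mul]
  rw [ENNReal.toReal_ofReal (by positivity), metric_eq_sum, Finset.mul_sum]
  refine Finset.sum_congr rfl fun α _ => ?_
  simp only [PiLp.smul_apply, smul_eq_mul, timeFlip_apply]
  ring

end Ultrahyperbolic

/-! ### The differential of a function vanishing on the boundary -/

namespace Ultrahyperbolic

variable {m n : ℕ} {U : Set (Spacetime m n)} {p N : Spacetime m n} {φ : Spacetime m n → ℝ}

/-- The closure of a domain with smooth boundary has unique differentials, because its tangent cone at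
a boundary point contains a half-space. -/
theorem uniqueDiffOn_closure (hU : IsOpen U) (hs : HasSmoothBoundary U) :
    UniqueDiffOn ℝ (closure U) := by
  intro p hp
  by_cases hpU : p ∈ U
  · exact (hU.uniqueDiffWithinAt hpU).mono subset_closure
  have hpf : p ∈ frontier U := by rw [hU.frontier_eq]; exact ⟨hp, hpU⟩
  obtain ⟨φ, hφ⟩ := hs p hpf
  have hd : DifferentiableAt ℝ φ p := (hφ.smooth.differentiable (by norm_num)) p
  -- the tangent cone contains the open half-space of inward-pointing directions
  have hsub : {Y | fderiv ℝ φ p Y < 0} ⊆ tangentConeAt ℝ (closure U) p := by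
    intro Y hY
    have hline : HasDerivAt (fun s : ℝ => p + s • Y) Y 0 := by
      simpa using ((hasDerivAt_id (0 : ℝ)).smul_const Y).const_add p
    have hder : HasDerivAt (fun s : ℝ => φ (p + s • Y)) (fderiv ℝ φ p Y) 0 := by
      have h0 : HasFDerivAt φ (fderiv ℝ φ p) (p + (0 : ℝ) • Y) := by simpa using hd.hasFDerivAt
      exact h0.comp_hasDerivAt 0 hline
    have hslope := hasDerivAt_iff_tendsto_slope.1 hder
    have hneg : ∀ᶠ s in 𝓝[≠] (0 : ℝ), slope (fun s : ℝ => φ (p + s • Y)) 0 s < 0 :=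
      hslope.eventually (gt_mem_nhds hY)
    have hloc : ∀ᶠ s in 𝓝[>] (0 : ℝ), (p + s • Y ∈ U ↔ φ (p + s • Y) < 0) := by
      have : Tendsto (fun s : ℝ => p + s • Y) (𝓝[>] 0) (𝓝 p) := by
        simpa using hline.continuousAt.tendsto.mono_left nhdsWithin_le_nhds
      exact this.eventually hφ.locally_eq
    have hle : 𝓝[>] (0 : ℝ) ≤ 𝓝[≠] 0 := nhdsWithin_mono _ fun s hs => ne_of_gt hs
    refine mem_tangentConeAt_of_add_smul_mem (l := 𝓝[>] (0 : ℝ)) (c := id) hle ?_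
    filter_upwards [hle hneg, hloc, self_mem_nhdsWithin] with s h1 h2 h3
    refine subset_closure (h2.2 ?_)
    rw [slope_def_field, zero_smul, add_zero, hφ.eq_zero, sub_zero, sub_zero] at h1
    have h3' : (0 : ℝ) < s := h3
    rw [div_lt_iff₀ h3', zero_mul] at h1
    exact h1
  refine ⟨?_, subset_closure hp⟩
  have hopen : IsOpen {Y | fderiv ℝ φ p Y < 0} :=
    isOpen_Iio.preimage (fderiv ℝ φ p).continuous
  have hne : ({Y | fderiv ℝ φ p Y < 0}).Nonempty := by
    by_contra hemp
    rw [not_nonempty_iff_eq_empty] at hemp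
    refine hφ.fderiv_ne_zero (ContinuousLinearMap.ext fun Y => ?_)
    have h1 : ¬ fderiv ℝ φ p Y < 0 := fun h => by
      have : Y ∈ ({Y | fderiv ℝ φ p Y < 0}) := h
      rw [hemp] at this; exact this
    have h2 : ¬ fderiv ℝ φ p (-Y) < 0 := fun h => by
      have : -Y ∈ ({Y | fderiv ℝ φ p Y < 0}) := h
      rw [hemp] at this; exact this
    rw [map_neg] at h2
    change fderiv ℝ φ p Y = 0
    linarith
  have htop : Submodule.span ℝ (tangentConeAt ℝ (closure U) p) = ⊤ := by
    refine Submodule.eq_top_of_nonempty_interior' _ (hne.mono ?_)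
    exact interior_maximal (hsub.trans Submodule.subset_span) hopen
  rw [htop]
  exact dense_univ

/-- If `z` vanishes on the boundary near `p`, its differential annihilates the tangent vectors. -/
theorem fderivWithin_eq_zero_of_tangent (hU : IsOpen U) (hφ : IsDefiningFunction U p φ)
    {O : Set (Spacetime m n)} (hO : IsOpen O) (hpO : p ∈ O) {z : Spacetime m n → ℝ}
    (hz : DifferentiableWithinAt ℝ z (closure U) p) (hz0 : ∀ q ∈ frontier U ∩ O, z q = 0)
    {Y : Spacetime m n} (hY : fderiv ℝ φ p Y = 0) : fderivWithin ℝ z (closure U) p Y = 0 := by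
  obtain ⟨W, n', hpW, hch, -⟩ := exists_divChart_frontier hφ
  have hst : HasStrictFDerivAt φ (fderiv ℝ φ p) p :=
    hφ.smooth.contDiffAt.hasStrictFDerivAt (by norm_num)
  have hrange : (fderiv ℝ φ p).range = ⊤ := by
    refine LinearMap.range_eq_top.2 (LinearMap.surjective fun h0 => hφ.fderiv_ne_zero ?_)
    exact ContinuousLinearMap.ext fun Y => LinearMap.congr_fun h0 Y
  set y : (fderiv ℝ φ p).ker := ⟨Y, hY⟩
  set c : ℝ → Spacetime m n := fun s => hst.implicitFunction φ _ hrange (φ p) (s • y) with hc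
  have hline : HasDerivAt (fun s : ℝ => s • y) y 0 := by
    simpa using (hasDerivAt_id (0 : ℝ)).smul_const y
  have hcd : HasDerivAt c Y 0 := by
    have h1 : HasFDerivAt (hst.implicitFunction φ _ hrange (φ p)) (fderiv ℝ φ p).ker.subtypeL
        ((0 : ℝ) • y) := by
      rw [zero_smul]; exact (hst.to_implicitFunction hrange).hasFDerivAt
    exact h1.comp_hasDerivAt 0 hline
  have hc0 : c 0 = p := by
    simp [hc]
  have hcφ : ∀ᶠ s in 𝓝 (0 : ℝ), φ (c s) = 0 := by
    have h1 := hst.map_implicitFunction_eq hrange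
    have h2 : Tendsto (fun s : ℝ => (φ p, s • y)) (𝓝 0) (𝓝 (φ p, 0)) := by
      have h3 := hline.continuousAt.tendsto
      rw [zero_smul] at h3
      exact tendsto_const_nhds.prodMk_nhds h3
    filter_upwards [h2.eventually h1] with s hs
    exact hs.trans hφ.eq_zero
  have hct : Tendsto c (𝓝 0) (𝓝 p) := by
    have := hcd.continuousAt.tendsto
    rwa [hc0] at this
  have hfr : ∀ᶠ s in 𝓝 (0 : ℝ), c s ∈ frontier U ∩ O := by
    filter_upwards [hcφ, hct (hch.graph.isOpen.mem_nhds hpW), hct (hO.mem_nhds hpO)]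
      with s h1 h2 h3
    exact ⟨(hch.graph.mem_frontier_iff hU h2).2 h1, h3⟩
  have hzd : HasFDerivWithinAt z (fderivWithin ℝ z (closure U) p) (closure U) (c 0) := by
    rw [hc0]; exact hz.hasFDerivWithinAt
  have hcomp : HasDerivWithinAt (z ∘ c) (fderivWithin ℝ z (closure U) p Y)
      {s | c s ∈ closure U} 0 :=
    hzd.comp_hasDerivWithinAt 0 hcd.hasDerivWithinAt fun s hs => hs
  have hcomp' : HasDerivAt (z ∘ c) (fderivWithin ℝ z (closure U) p Y) 0 :=
    hcomp.hasDerivAt (hfr.mono fun s hs => frontier_subset_closure hs.1)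
  have hzero : HasDerivAt (z ∘ c) 0 0 := by
    refine (hasDerivAt_const (0 : ℝ) (0 : ℝ)).congr_of_eventuallyEq ?_
    exact hfr.mono fun s hs => hz0 _ hs
  exact hcomp'.unique hzero

/-- The differential of a function that vanishes on the boundary is a multiple of the conormal. -/
theorem IsOuterUnitNormal.fderivWithin_eq (hU : IsOpen U) (hN : IsOuterUnitNormal U p N)
    (hφ : IsDefiningFunction U p φ) {O : Set (Spacetime m n)} (hO : IsOpen O) (hpO : p ∈ O)
    {z : Spacetime m n → ℝ} (hz : DifferentiableWithinAt ℝ z (closure U) p)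
    (hz0 : ∀ q ∈ frontier U ∩ O, z q = 0) (Y : Spacetime m n) :
    fderivWithin ℝ z (closure U) p Y = fderivWithin ℝ z (closure U) p N * metric N Y := by
  have hker : fderiv ℝ φ p (Y + (-metric N Y) • N) = 0 := by
    rw [map_add, map_smul, smul_eq_mul, hN.fderiv_eq hφ Y]; ring
  have := fderivWithin_eq_zero_of_tangent hU hφ hO hpO hz hz0 hker
  rw [map_add, map_smul, smul_eq_mul] at this
  linarith

end Ultrahyperbolic

/-! ### The pointwise inequality between real numbers -/

namespace Ultrahyperbolic

/-- The coefficient `Γ` with `∇F = -Γ S`, where `e^{-F}` is the square root of the weight, in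
terms of `φ = √f` and `δ = √((1 + εu)(1 - εv))`. -/
noncomputable def gamCoef (a b φ δ : ℝ) : ℝ := a * (δ + b * φ) / (φ ^ 2 * δ ^ 3)

/-- The coefficient of the zeroth-order term produced by the weight alone. -/
noncomputable def zeroCoef (a b ε r φ δ : ℝ) : ℝ :=
  a ^ 2 * b * (δ + b * φ) / (2 * φ * δ ^ 4) + a ^ 2 * ε * (δ + b * φ) ^ 2 / (2 * r * δ ^ 4)
    - a * b * (1 / 4 + ε * φ ^ 2 / (2 * r)) / (2 * φ * δ ^ 3)
    - ε * a * (1 / (4 * r * δ ^ 2) + b * φ / (2 * r * δ ^ 3))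

theorem zeroCoef_ge {a b ε r φ δ : ℝ} (ha : 4 ≤ a) (hb : 0 < b) (hε : 0 < ε) (hr : 0 < r)
    (hφ : 0 < φ) (hδ : 0 < δ) (hδ1 : δ ≤ 1) (hφr : 2 * φ ≤ r) (hεr : ε * r ≤ 1 / 100) :
    3 / 8 * (a ^ 2 * b / φ) ≤ zeroCoef a b ε r φ δ := by
  have ha0 : 0 < a := by linarith
  have h1 : a ^ 2 * b / (2 * φ * δ ^ 3) ≤ a ^ 2 * b * (δ + b * φ) / (2 * φ * δ ^ 4) := by
    rw [div_le_div_iff₀ (by positivity) (by positivity)]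
    have : 0 ≤ a ^ 2 * b * (b * φ) * (2 * φ * δ ^ 3) := by positivity
    nlinarith [this]
  have h2 : a ^ 2 * ε / (2 * r * δ ^ 2) + a ^ 2 * ε * (b * φ) / (r * δ ^ 3) ≤
      a ^ 2 * ε * (δ + b * φ) ^ 2 / (2 * r * δ ^ 4) := by
    have : a ^ 2 * ε * (δ + b * φ) ^ 2 / (2 * r * δ ^ 4) =
        a ^ 2 * ε / (2 * r * δ ^ 2) + a ^ 2 * ε * (b * φ) / (r * δ ^ 3)
          + a ^ 2 * ε * (b * φ) ^ 2 / (2 * r * δ ^ 4) := by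
      field_simp; ring
    rw [this]
    have : 0 ≤ a ^ 2 * ε * (b * φ) ^ 2 / (2 * r * δ ^ 4) := by positivity
    linarith
  have h3 : ε * a * (1 / (4 * r * δ ^ 2)) ≤ a ^ 2 * ε / (2 * r * δ ^ 2) := by
    rw [mul_one_div, div_le_div_iff₀ (by positivity) (by positivity)]
    have : 0 ≤ ε * a * (2 * r * δ ^ 2) * (2 * a - 1) :=
      mul_nonneg (by positivity) (by linarith)
    nlinarith [this]
  have h4 : ε * a * (b * φ / (2 * r * δ ^ 3)) ≤ a ^ 2 * ε * (b * φ) / (r * δ ^ 3) := by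
    rw [← mul_div_assoc, div_le_div_iff₀ (by positivity) (by positivity)]
    have : 0 ≤ ε * a * (b * φ) * (r * δ ^ 3) * (2 * a - 1) :=
      mul_nonneg (by positivity) (by linarith)
    nlinarith [this]
  have h5 : ε * φ ^ 2 / (2 * r) ≤ 1 / 100 := by
    rw [div_le_iff₀ (by positivity)]
    have : φ ^ 2 ≤ r * r := by nlinarith
    nlinarith
  have h6 : 3 / 8 * (a ^ 2 * b / φ) ≤ a ^ 2 * b / (2 * φ * δ ^ 3)
      - a * b * (1 / 4 + ε * φ ^ 2 / (2 * r)) / (2 * φ * δ ^ 3) := by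
    rw [← sub_div, le_div_iff₀ (by positivity)]
    have e1 : 3 / 8 * (a ^ 2 * b / φ) * (2 * φ * δ ^ 3) = 3 / 4 * (a ^ 2 * b) * δ ^ 3 := by
      field_simp; ring
    rw [e1]
    have e2 : δ ^ 3 ≤ 1 := pow_le_one₀ hδ.le hδ1
    have e3 : 3 / 4 * (a ^ 2 * b) * δ ^ 3 ≤ 3 / 4 * (a ^ 2 * b) * 1 := by gcongr
    have e4 : a * b * (1 / 4 + ε * φ ^ 2 / (2 * r)) ≤ a * b * (1 / 4 + 1 / 100) := by gcongr
    have e5 : 0 ≤ a * b * (a / 4 - 26 / 100) := mul_nonneg (by positivity) (by linarith)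
    nlinarith
  unfold zeroCoef
  rw [mul_add (ε * a)]
  linarith

theorem exterior_bounds {ε r τ φ δ : ℝ} (hε : 0 < ε) (hr : 0 < r) (hφ : 0 < φ) (hδ : 0 < δ)
    (hf : 4 * φ ^ 2 = r ^ 2 - τ ^ 2) (hD : δ ^ 2 = 1 - ε * r + ε ^ 2 * φ ^ 2)
    (hεr : ε * r ≤ 1 / 100) : 2 * φ ≤ r ∧ 99 / 100 ≤ δ ∧ δ ≤ 1 := by
  have hφr : 2 * φ ≤ r := abs_le_of_sq_le_sq' (by nlinarith [sq_nonneg τ]) hr.le |>.2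
  have hεr0 : 0 < ε * r := by positivity
  have h1 : ε * φ ≤ ε * r := by gcongr; linarith
  have h2 : 0 < ε * φ := by positivity
  have h3 : (ε * φ) ^ 2 ≤ ε * r * (1 / 100) := by
    rw [sq]; gcongr; linarith
  rw [mul_pow] at h3
  have h4 : 0 ≤ ε ^ 2 * φ ^ 2 := by positivity
  refine ⟨hφr, abs_le_of_sq_le_sq' (by linarith) hδ.le |>.2,
    abs_le_of_sq_le_sq' (by linarith) zero_le_one |>.2⟩

theorem gamCoef_bounds {a b φ δ : ℝ} (ha : 0 < a) (hb : 0 < b) (hφ : 0 < φ)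
    (hbφ : b * φ ≤ 1 / 2) (hδ2 : 99 / 100 ≤ δ) (hδ1 : δ ≤ 1) :
    a ≤ gamCoef a b φ δ * φ ^ 2 ∧ gamCoef a b φ δ * φ ^ 2 ≤ 2 * a := by
  have hδ : 0 < δ := by linarith
  have hbφ0 : 0 < b * φ := by positivity
  have hΓφ : gamCoef a b φ δ * φ ^ 2 = a * ((δ + b * φ) / δ ^ 3) := by
    rw [gamCoef]; field_simp
  rw [hΓφ]
  constructor
  · have : 1 ≤ (δ + b * φ) / δ ^ 3 := by
      rw [le_div_iff₀ (by positivity)]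
      have : δ ^ 3 ≤ δ ^ 1 := pow_le_pow_of_le_one hδ.le hδ1 (by norm_num)
      linarith
    calc a = a * 1 := (mul_one a).symm
      _ ≤ _ := by gcongr
  · have : (δ + b * φ) / δ ^ 3 ≤ 2 := by
      rw [div_le_iff₀ (by positivity)]
      have : (99 / 100 : ℝ) ^ 3 ≤ δ ^ 3 := pow_le_pow_left₀ (by norm_num) hδ2 3
      norm_num at this
      linarith
    rw [mul_comm 2 a]
    gcongr

/-- The sum of the two null derivatives `Y`, `V` is the radial derivative, which the derivative
along the vector field of the multiplier controls up to a small multiple of `Y ^ 2 + V ^ 2`. -/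
theorem sq_add_le_of_multiplier {ε r τ φ yτ yr S Y V : ℝ} (hε : 0 < ε)
    (hf : 4 * φ ^ 2 = r ^ 2 - τ ^ 2) (hεr0 : 0 < ε * r) (hεr : ε * r ≤ 1 / 100)
    (hτr : τ ^ 2 ≤ r ^ 2)
    (hY : Y = (τ - r) / 2 * (yτ - yr)) (hV : V = (τ + r) / 2 * (yτ + yr))
    (hS : S = (1 - ε * r) / 2 * (τ * yτ + r * yr) + ε * φ ^ 2 * yr) :
    (Y + V) ^ 2 ≤ 9 * S ^ 2 + 1 / 2 * (Y ^ 2 + V ^ 2) := by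
  have hN : 0 ≤ Y ^ 2 + V ^ 2 := by positivity
  have he2 : (ε * φ ^ 2 * yr) ^ 2 ≤ 1 / 10000 * (Y ^ 2 + V ^ 2) := by
    have hfy : φ ^ 2 * yr = ((τ + r) / 2 * Y - (τ - r) / 2 * V) / 2 := by
      have : φ ^ 2 = (r ^ 2 - τ ^ 2) / 4 := by linarith
      rw [this, hY, hV]; ring
    have h1 : (φ ^ 2 * yr) ^ 2 ≤ r ^ 2 * (Y ^ 2 + V ^ 2) := by
      have hu : ((τ + r) / 2) ^ 2 + ((τ - r) / 2) ^ 2 ≤ r ^ 2 := by nlinarith only [hτr]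
      have h2 : ((τ + r) / 2 * Y - (τ - r) / 2 * V) ^ 2 ≤
          (((τ + r) / 2) ^ 2 + ((τ - r) / 2) ^ 2) * (Y ^ 2 + V ^ 2) := by
        nlinarith only [sq_nonneg ((τ + r) / 2 * V + (τ - r) / 2 * Y)]
      have h3 : (((τ + r) / 2) ^ 2 + ((τ - r) / 2) ^ 2) * (Y ^ 2 + V ^ 2) ≤
          r ^ 2 * (Y ^ 2 + V ^ 2) := by gcongr
      rw [hfy, div_pow]
      have h4 : 0 ≤ ((τ + r) / 2 * Y - (τ - r) / 2 * V) ^ 2 := sq_nonneg _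
      linarith
    calc (ε * φ ^ 2 * yr) ^ 2 = ε ^ 2 * (φ ^ 2 * yr) ^ 2 := by ring
      _ ≤ ε ^ 2 * (r ^ 2 * (Y ^ 2 + V ^ 2)) := by gcongr
      _ = (ε * r) ^ 2 * (Y ^ 2 + V ^ 2) := by ring
      _ ≤ (1 / 100) ^ 2 * (Y ^ 2 + V ^ 2) := by gcongr
      _ = _ := by norm_num
  have hSe : (1 - ε * r) / 2 * (Y + V) = S - ε * φ ^ 2 * yr := by
    rw [hS, hY, hV]; ring
  have h1 : ((1 - ε * r) / 2 * (Y + V)) ^ 2 ≤ 2 * S ^ 2 + 2 * (ε * φ ^ 2 * yr) ^ 2 := by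
    rw [hSe]; nlinarith only [sq_nonneg (S + ε * φ ^ 2 * yr)]
  have h2 : (99 / 200 : ℝ) ^ 2 * (Y + V) ^ 2 ≤ ((1 - ε * r) / 2 * (Y + V)) ^ 2 := by
    rw [mul_pow]
    have : (99 / 200 : ℝ) ≤ (1 - ε * r) / 2 := by linarith
    gcongr
  norm_num at h2
  nlinarith only [sq_nonneg S, hN, h1, h2, he2]

theorem abs_mul_sq_le {z g a κ : ℝ} (hg : 0 ≤ g) (hga : g ≤ 2 * a) (h0 : 0 ≤ κ) (h1 : κ ≤ 1) :
    (z * g * κ) ^ 2 ≤ 4 * (a ^ 2 * z ^ 2) := by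
  have h2 : (g * κ) ^ 2 ≤ (2 * a * 1) ^ 2 := by
    have : 0 ≤ 2 * a := hg.trans hga
    gcongr
  calc (z * g * κ) ^ 2 = z ^ 2 * (g * κ) ^ 2 := by ring
    _ ≤ z ^ 2 * (2 * a * 1) ^ 2 := by gcongr
    _ = _ := by ring

/-- Passage from the null derivatives `Y`, `V` of the conjugated function back to those of the
function itself, at the cost of a zeroth-order term. -/
theorem null_derivatives_le {a ε r τ φ z zτ zr yτ yr Γ : ℝ}
    (hτ : 0 ≤ τ) (hτr : τ ≤ r) (hε : 0 < ε)
    (hf : 4 * φ ^ 2 = r ^ 2 - τ ^ 2) (hεr : ε * r ≤ 1 / 100)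
    (hΓ0 : 0 < Γ) (hΓ2 : Γ * φ ^ 2 ≤ 2 * a)
    (hyτ : yτ = zτ - z * Γ * ((1 - ε * r) * τ / 2))
    (hyr : yr = zr + z * Γ * ((1 - ε * r) * r / 2 + ε * φ ^ 2)) :
    ((τ - r) / 2 * (zτ - zr)) ^ 2 + ((τ + r) / 2 * (zτ + zr)) ^ 2 ≤
      2 * (((τ - r) / 2 * (yτ - yr)) ^ 2 + ((τ + r) / 2 * (yτ + yr)) ^ 2)
        + 16 * (a ^ 2 * z ^ 2) := by
  have hr : 0 ≤ r := hτ.trans hτr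
  obtain ⟨u, hu⟩ : ∃ u, u = (τ - r) / 2 := ⟨_, rfl⟩
  obtain ⟨v, hv⟩ : ∃ v, v = (τ + r) / 2 := ⟨_, rfl⟩
  have huv : φ ^ 2 = -(u * v) := by rw [hu, hv]; linarith
  have hrv : r = v - u := by rw [hu, hv]; ring
  have hτv : τ = v + u := by rw [hu, hv]; ring
  have hYz : u * (zτ - zr) = u * (yτ - yr) - z * (Γ * φ ^ 2) * (1 - ε * v) := by
    rw [hyτ, hyr, huv, hrv, hτv]; ring
  have hVz : v * (zτ + zr) = v * (yτ + yr) - z * (Γ * φ ^ 2) * (1 + ε * u) := by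
    rw [hyτ, hyr, huv, hrv, hτv]; ring
  have hp : 0 ≤ Γ * φ ^ 2 := by positivity
  have hv0 : 0 ≤ ε * v := mul_nonneg hε.le (by linarith)
  have hu0 : 0 ≤ ε * -u := mul_nonneg hε.le (by linarith)
  have hvr : ε * v ≤ ε * r := by gcongr; linarith
  have hur : ε * -u ≤ ε * r := by gcongr; linarith
  have hκ1 := abs_mul_sq_le (z := z) (κ := 1 - ε * v) hp hΓ2 (by linarith) (by linarith)
  have hκ2 := abs_mul_sq_le (z := z) (κ := 1 + ε * u) hp hΓ2 (by linarith) (by linarith)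
  rw [← hu, ← hv, hYz, hVz]
  nlinarith only [hκ1, hκ2, sq_nonneg (u * (yτ - yr) + z * (Γ * φ ^ 2) * (1 - ε * v)),
    sq_nonneg (v * (yτ + yr) + z * (Γ * φ ^ 2) * (1 + ε * u))]

/-- The pointwise lower bound for the divergence of the current divided by the weight, as an
inequality between real numbers. The unknowns stand for the value `z`, the radial derivatives
`zτ`, `zr` and the angular quantities `Ax`, `At` of a function, for `L = □z`, and for the
derivatives `yτ`, `yr` of the conjugated function. -/
theorem current_lower_bound {a b ε r τ φ δ z zτ zr yτ yr Ax At L w q s : ℝ}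
    (ha : 4 ≤ a) (hb : 0 < b) (hε : 0 < ε) (hr : 0 < r) (hτ : 0 ≤ τ) (hφ : 0 < φ) (hδ : 0 < δ)
    (hf : 4 * φ ^ 2 = r ^ 2 - τ ^ 2) (hD : δ ^ 2 = 1 - ε * r + ε ^ 2 * φ ^ 2)
    (hεr : ε * r ≤ 1 / 100) (hbr : b * r ≤ 1) (hεb : ε ≤ b / 100)
    (hAx : 0 ≤ Ax) (hAt : 0 ≤ At) (hw : w ^ 2 ≤ a ^ 2 / 16) (hq : 0 ≤ q)
    (hyτ : yτ = zτ - z * gamCoef a b φ δ * ((1 - ε * r) * τ / 2))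
    (hyr : yr = zr + z * gamCoef a b φ δ * ((1 - ε * r) * r / 2 + ε * φ ^ 2))
    (hs : s = (1 - ε * r) / 2 * (τ * yτ + r * yr) + ε * φ ^ 2 * yr + w * z) :
    1 / 16 * (ε / r * (((τ - r) / 2 * (zτ - zr)) ^ 2 + ((τ + r) / 2 * (zτ + zr)) ^ 2
        + φ ^ 2 * Ax + φ ^ 2 * At) + b * a ^ 2 / φ * z ^ 2) - φ ^ 2 * L ^ 2 / (4 * a) ≤
      L * s - ε * φ ^ 2 / (2 * r) * (-yτ ^ 2 + yr ^ 2 + Ax - At) + ε * φ ^ 2 / r * Ax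
        + 2 * gamCoef a b φ δ * s ^ 2 + (zeroCoef a b ε r φ δ + q) * z ^ 2 := by
  have ha0 : 0 < a := by linarith
  have hφ2 : 0 < φ ^ 2 := by positivity
  have hτ2 : τ ^ 2 ≤ r ^ 2 := by linarith
  have hτr : τ ≤ r := abs_le_of_sq_le_sq' hτ2 hr.le |>.2
  obtain ⟨hφr, hδ2, hδ1⟩ := exterior_bounds hε hr hφ hδ hf hD hεr
  have hεr0 : 0 < ε * r := by positivity
  have hbφ : b * φ ≤ 1 / 2 := by
    have : b * (2 * φ) ≤ b * r := by gcongr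
    linarith
  obtain ⟨hΓ1, hΓ2⟩ := gamCoef_bounds ha0 hb hφ hbφ hδ2 hδ1
  have c4 := zeroCoef_ge ha hb hε hr hφ hδ hδ1 hφr hεr
  generalize gamCoef a b φ δ = Γ at *
  generalize zeroCoef a b ε r φ δ = Z at *
  have hΓ0 : 0 < Γ := pos_of_mul_pos_left (ha0.trans_le hΓ1) hφ2.le
  -- absorption of the source term
  have c3 : -(Γ * s ^ 2) - φ ^ 2 * L ^ 2 / (4 * a) ≤ L * s := by
    have h1 : a / φ ^ 2 ≤ Γ := by rw [div_le_iff₀ hφ2]; exact hΓ1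
    have h2 : a / φ ^ 2 * s ^ 2 ≤ Γ * s ^ 2 := by gcongr
    have h3 : 0 ≤ (2 * a * s + φ ^ 2 * L) ^ 2 / (4 * a * φ ^ 2) := by positivity
    have h4 : (2 * a * s + φ ^ 2 * L) ^ 2 / (4 * a * φ ^ 2) =
        a / φ ^ 2 * s ^ 2 + L * s + φ ^ 2 * L ^ 2 / (4 * a) := by
      field_simp; ring
    linarith
  obtain ⟨Y, hY⟩ : ∃ Y, Y = (τ - r) / 2 * (yτ - yr) := ⟨_, rfl⟩
  obtain ⟨V, hV⟩ : ∃ V, V = (τ + r) / 2 * (yτ + yr) := ⟨_, rfl⟩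
  obtain ⟨S, hS⟩ : ∃ S, S = (1 - ε * r) / 2 * (τ * yτ + r * yr) + ε * φ ^ 2 * yr := ⟨_, rfl⟩
  have hsS : S = s - w * z := by rw [hS, hs]; ring
  have c5 := sq_add_le_of_multiplier hε hf hεr0 hεr hτ2 hY hV hS
  have hεr' : 0 < ε / r := by positivity
  have hSs : S ^ 2 ≤ 2 * s ^ 2 + 2 * (w ^ 2 * z ^ 2) := by
    rw [hsS]; nlinarith only [sq_nonneg (s + w * z)]
  have c6a : 9 / 2 * (ε / r) * s ^ 2 ≤ Γ * s ^ 2 := by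
    have h1 : 9 / 2 * (ε / r) ≤ Γ := by
      refine le_of_mul_le_mul_right ?_ hφ2
      have h2 : 9 / 2 * (ε / r) * φ ^ 2 ≤ 9 / 2 * (ε / r) * r ^ 2 := by
        gcongr; linarith
      have h3 : 9 / 2 * (ε / r) * r ^ 2 = 9 / 2 * (ε * r) := by field_simp
      linarith
    gcongr
  have hεbr : ε / r ≤ 1 / 200 * (b / φ) := by
    rw [← mul_div_assoc, div_le_div_iff₀ hr hφ]
    calc ε * φ ≤ b / 100 * (r / 2) := by gcongr; linarith
      _ = _ := by ring
  have c6b : 9 / 2 * (ε / r) * (w ^ 2 * z ^ 2) ≤ 9 / 6400 * (b / φ * (a ^ 2 * z ^ 2)) := by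
    calc 9 / 2 * (ε / r) * (w ^ 2 * z ^ 2)
        ≤ 9 / 2 * (1 / 200 * (b / φ)) * (a ^ 2 / 16 * z ^ 2) := by gcongr
      _ = _ := by ring
  have c7 : -(ε * φ ^ 2 / (2 * r) * (-yτ ^ 2 + yr ^ 2)) =
      ε / r * (1 / 4 * (Y ^ 2 + V ^ 2) - 1 / 4 * (Y + V) ^ 2) := by
    have h1 : φ ^ 2 * (yτ ^ 2 - yr ^ 2) = -(Y * V) := by
      have : φ ^ 2 = (r ^ 2 - τ ^ 2) / 4 := by linarith
      rw [this, hY, hV]; ring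
    have h2 : -(ε * φ ^ 2 / (2 * r) * (-yτ ^ 2 + yr ^ 2)) =
        ε / r * (1 / 2 * (φ ^ 2 * (yτ ^ 2 - yr ^ 2))) := by
      field_simp; ring
    rw [h2, h1]; ring
  have c8 := null_derivatives_le hτ hτr hε hf hεr hΓ0 hΓ2 hyτ hyr
  rw [← hY, ← hV] at c8
  have c10 : ε / r * (((τ - r) / 2 * (zτ - zr)) ^ 2 + ((τ + r) / 2 * (zτ + zr)) ^ 2) ≤
      ε / r * (2 * (Y ^ 2 + V ^ 2)) + 16 / 200 * (b / φ * (a ^ 2 * z ^ 2)) := by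
    have h1 := mul_le_mul_of_nonneg_left c8 hεr'.le
    have h2 : ε / r * (16 * (a ^ 2 * z ^ 2)) ≤ 1 / 200 * (b / φ) * (16 * (a ^ 2 * z ^ 2)) := by
      gcongr
    linarith
  have c11 : ε / r * (1 / 4 * (Y + V) ^ 2) ≤
      ε / r * (1 / 4 * (9 * S ^ 2 + 1 / 2 * (Y ^ 2 + V ^ 2))) := by gcongr
  have c12 : ε / r * (9 / 4 * S ^ 2) ≤ ε / r * (9 / 4 * (2 * s ^ 2 + 2 * (w ^ 2 * z ^ 2))) := by
    gcongr
  have c13 : 3 / 8 * (b / φ * (a ^ 2 * z ^ 2)) ≤ Z * z ^ 2 := by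
    have := mul_le_mul_of_nonneg_right c4 (sq_nonneg z)
    calc _ = 3 / 8 * (a ^ 2 * b / φ) * z ^ 2 := by ring
      _ ≤ _ := this
  have c14 : 0 ≤ q * z ^ 2 := by positivity
  have c15 : 0 ≤ ε / r * (φ ^ 2 * Ax + φ ^ 2 * At) := by positivity
  have c16 : -(ε * φ ^ 2 / (2 * r) * (Ax - At)) + ε * φ ^ 2 / r * Ax =
      1 / 2 * (ε / r * (φ ^ 2 * Ax + φ ^ 2 * At)) := by
    field_simp; ring
  have c17' : 0 ≤ b / φ := by positivity
  have c17 : b * a ^ 2 / φ * z ^ 2 = b / φ * (a ^ 2 * z ^ 2) := by ring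
  rw [c17]
  generalize ε * φ ^ 2 / (2 * r) = k₁ at *
  generalize ε * φ ^ 2 / r = k₂ at *
  generalize ε / r = k₃ at *
  generalize b / φ = k₄ at *
  generalize φ ^ 2 * L ^ 2 / (4 * a) = k₅ at *
  linarith only [c3, c6a, c6b, c7, c10, c11, c12, c13, c14, c15, c16,
    mul_nonneg hεr'.le (add_nonneg (sq_nonneg Y) (sq_nonneg V)),
    mul_nonneg c17' (mul_nonneg (sq_nonneg a) (sq_nonneg z))]
end Ultrahyperbolic

namespace Ultrahyperbolic

variable {m n : ℕ}

/-! ### Divergence and gradient for the flat metric -/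

/-- The divergence of a vector field. -/
noncomputable def divergence (V : Spacetime m n → Spacetime m n) (p : Spacetime m n) : ℝ :=
  ∑ α, partialDeriv α (fun x => V x α) p

/-- The vector `g`-dual to a linear form. -/
noncomputable def sharp : (Spacetime m n →L[ℝ] ℝ) →L[ℝ] Spacetime m n :=
  ∑ α, (ContinuousLinearMap.apply ℝ ℝ (EuclideanSpace.single α 1)).smulRight
    (EuclideanSpace.single α (sgn α))

theorem sharp_apply (ℓ : Spacetime m n →L[ℝ] ℝ) (α : Fin m ⊕ Fin n) :
    sharp ℓ α = sgn α * ℓ (EuclideanSpace.single α 1) := by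
  simp only [sharp, _root_.sum_apply, ContinuousLinearMap.smulRight_apply,
    ContinuousLinearMap.apply_apply, WithLp.ofLp_sum, Finset.sum_apply, PiLp.smul_apply,
    PiLp.single_apply, smul_eq_mul, mul_ite, mul_zero, Finset.sum_ite_eq,
    Finset.mem_univ, if_true]
  exact mul_comm _ _

theorem clm_apply_eq_sum (ℓ : Spacetime m n →L[ℝ] ℝ) (Y : Spacetime m n) :
    ℓ Y = ∑ α, Y α * ℓ (EuclideanSpace.single α 1) := by
  conv_lhs => rw [← (EuclideanSpace.basisFun (Fin m ⊕ Fin n) ℝ).sum_repr Y]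
  simp [map_sum]

theorem metric_sharp_left (ℓ : Spacetime m n →L[ℝ] ℝ) (Y : Spacetime m n) :
    metric (sharp ℓ) Y = ℓ Y := by
  rw [metric_eq_sum, clm_apply_eq_sum ℓ Y]
  refine Finset.sum_congr rfl fun α _ => ?_
  rw [sharp_apply]
  linear_combination Y α * ℓ (EuclideanSpace.single α 1) * sgn_mul_self α

theorem metric_add_left (X Y Z : Spacetime m n) : metric (X + Y) Z = metric X Z + metric Y Z := by
  rw [metric_comm, metric_add_right, metric_comm Z, metric_comm Z]

theorem metric_smul_left (c : ℝ) (X Y : Spacetime m n) : metric (c • X) Y = c * metric X Y := by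
  rw [metric_comm, metric_smul_right, metric_comm Y]

theorem ext_metric {X Y : Spacetime m n} (h : ∀ Z, metric X Z = metric Y Z) : X = Y := by
  have : timeFlip X = timeFlip Y := ext_inner_right ℝ fun Z => by
    rw [inner_timeFlip, inner_timeFlip, h]
  rw [← timeFlip_timeFlip X, this, timeFlip_timeFlip]

theorem sharp_eq {ℓ : Spacetime m n →L[ℝ] ℝ} {X : Spacetime m n} (h : ∀ Y, ℓ Y = metric X Y) :
    sharp ℓ = X :=
  ext_metric fun Y => by rw [metric_sharp_left, h]

section

variable {h k : Spacetime m n → ℝ} {V W : Spacetime m n → Spacetime m n} {p : Spacetime m n}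

theorem divergence_eq (hV : DifferentiableAt ℝ V p) :
    divergence V p = ∑ α, fderiv ℝ V p (EuclideanSpace.single α 1) α := by
  refine Finset.sum_congr rfl fun α _ => ?_
  have := ((EuclideanSpace.proj α : Spacetime m n →L[ℝ] ℝ).hasFDerivAt.comp p
    hV.hasFDerivAt).fderiv
  rw [partialDeriv]
  erw [this]
  rfl

theorem divergence_smul (hh : DifferentiableAt ℝ h p) (hV : DifferentiableAt ℝ V p) :
    divergence (fun x => h x • V x) p = h p * divergence V p + fderiv ℝ h p (V p) := by
  rw [divergence_eq (hh.fun_smul hV), divergence_eq hV, clm_apply_eq_sum _ (V p), Finset.mul_sum,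
    ← Finset.sum_add_distrib]
  refine Finset.sum_congr rfl fun α _ => ?_
  rw [fderiv_fun_smul hh hV]
  simp [mul_comm]

theorem divergence_add (hV : DifferentiableAt ℝ V p) (hW : DifferentiableAt ℝ W p) :
    divergence (fun x => V x + W x) p = divergence V p + divergence W p := by
  rw [divergence_eq (hV.fun_add hW), divergence_eq hV, divergence_eq hW, ← Finset.sum_add_distrib]
  refine Finset.sum_congr rfl fun α _ => ?_
  rw [fderiv_fun_add hV hW]
  rfl

theorem divergence_sub (hV : DifferentiableAt ℝ V p) (hW : DifferentiableAt ℝ W p) :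
    divergence (fun x => V x - W x) p = divergence V p - divergence W p := by
  rw [divergence_eq (hV.fun_sub hW), divergence_eq hV, divergence_eq hW, ← Finset.sum_sub_distrib]
  refine Finset.sum_congr rfl fun α _ => ?_
  rw [fderiv_fun_sub hV hW]
  rfl

theorem divergence_congr (hVW : V =ᶠ[𝓝 p] W) : divergence V p = divergence W p := by
  refine Finset.sum_congr rfl fun α _ => ?_
  have : (fun x => V x α) =ᶠ[𝓝 p] fun x => W x α := hVW.mono fun x hx => by
    simp only [hx]
  rw [partialDeriv, this.fderiv_eq, partialDeriv]

theorem box_eq_divergence (z : Spacetime m n → ℝ) (hz : ContDiffAt ℝ 2 z p) :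
    box z p = divergence (fun x => sharp (fderiv ℝ z x)) p := by
  have hd : DifferentiableAt ℝ (fderiv ℝ z) p :=
    (hz.fderiv_right (m := 1) (by norm_num)).differentiableAt (by norm_num)
  have hpd : ∀ α, DifferentiableAt ℝ (partialDeriv α z) p := fun α =>
    hd.clm_apply (differentiableAt_const _)
  have key : ∀ α, partialDeriv α (fun x => sharp (fderiv ℝ z x) α) p =
      sgn α * partialDeriv α (partialDeriv α z) p := by
    intro α
    have : (fun x => sharp (fderiv ℝ z x) α) = fun x => sgn α * partialDeriv α z x := by
      funext x; rw [sharp_apply]; rfl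
    rw [this, partialDeriv, fderiv_const_mul (hpd α)]
    rfl
  rw [divergence, Finset.sum_congr rfl fun α _ => key α, Fintype.sum_sum_type, box]
  simp [sgn]

/-- The derivative of a scalar product with a dual vector field. -/
theorem fderiv_fderiv_apply (hz : ContDiffAt ℝ 2 h p) (hV : DifferentiableAt ℝ V p)
    (Y : Spacetime m n) :
    fderiv ℝ (fun x => fderiv ℝ h x (V x)) p Y =
      fderiv ℝ (fderiv ℝ h) p Y (V p) + fderiv ℝ h p (fderiv ℝ V p Y) := by
  have hd : DifferentiableAt ℝ (fderiv ℝ h) p :=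
    (hz.fderiv_right (m := 1) (by norm_num)).differentiableAt (by norm_num)
  rw [fderiv_clm_apply hd hV]
  simp [add_comm]

end

/-- The divergence of the current attached to a function `ψ`, a multiplier field `S` with
zeroth-order part `w`, and a potential `A`: only the deformation of `S` enters, since the second
derivatives of `ψ` combine to `box ψ` by their symmetry. -/
theorem divergence_current {ψ w A : Spacetime m n → ℝ} {S W : Spacetime m n → Spacetime m n}
    {p : Spacetime m n} (hψ : ContDiffAt ℝ 2 ψ p) (hS : DifferentiableAt ℝ S p)
    (hw : DifferentiableAt ℝ w p) (hA : DifferentiableAt ℝ A p) (hW : DifferentiableAt ℝ W p)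
    (hwW : ∀ Y, fderiv ℝ w p Y = metric (W p) Y) :
    divergence (fun x => (fderiv ℝ ψ x (S x)) • sharp (fderiv ℝ ψ x)
        - (1 / 2 * fderiv ℝ ψ x (sharp (fderiv ℝ ψ x))) • S x
        + (w x * ψ x) • sharp (fderiv ℝ ψ x) - (1 / 2 * ψ x ^ 2) • W x
        + (1 / 2 * A x * ψ x ^ 2) • S x) p =
      (box ψ p + A p * ψ p) * (fderiv ℝ ψ p (S p) + w p * ψ p)
        + fderiv ℝ ψ p (fderiv ℝ S p (sharp (fderiv ℝ ψ p)))
        + (w p - 1 / 2 * divergence S p) * fderiv ℝ ψ p (sharp (fderiv ℝ ψ p))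
        + (1 / 2 * fderiv ℝ A p (S p) + A p * (1 / 2 * divergence S p - w p)
            - 1 / 2 * divergence W p) * ψ p ^ 2 := by
  have hψ1 : DifferentiableAt ℝ ψ p := hψ.differentiableAt (by norm_num)
  have hd : DifferentiableAt ℝ (fderiv ℝ ψ) p :=
    (hψ.fderiv_right (m := 1) (by norm_num)).differentiableAt (by norm_num)
  have hG : DifferentiableAt ℝ (fun x => sharp (fderiv ℝ ψ x)) p :=
    sharp.differentiableAt.comp p hd
  have hSψ : DifferentiableAt ℝ (fun x => fderiv ℝ ψ x (S x)) p := hd.clm_apply hS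
  have hGψ : DifferentiableAt ℝ (fun x => fderiv ℝ ψ x (sharp (fderiv ℝ ψ x))) p :=
    hd.clm_apply hG
  have hGψ' : DifferentiableAt ℝ (fun x => 1 / 2 * fderiv ℝ ψ x (sharp (fderiv ℝ ψ x))) p :=
    hGψ.const_mul _
  have hwψ : DifferentiableAt ℝ (fun x => w x * ψ x) p := hw.mul hψ1
  have hψ2 : DifferentiableAt ℝ (fun x => 1 / 2 * ψ x ^ 2) p := (hψ1.pow 2).const_mul _
  have hAψ : DifferentiableAt ℝ (fun x => 1 / 2 * A x * ψ x ^ 2) p :=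
    (hA.const_mul _).mul (hψ1.pow 2)
  have hsymm := hψ.isSymmSndFDerivAt (by simp)
  have d1 := hSψ.fun_smul hG
  have d2 := hGψ'.fun_smul hS
  have d3 := hwψ.fun_smul hG
  have d4 := hψ2.fun_smul hW
  have d5 := hAψ.fun_smul hS
  rw [divergence_add (((d1.fun_sub d2).fun_add d3).fun_sub d4) d5,
    divergence_sub ((d1.fun_sub d2).fun_add d3) d4, divergence_add (d1.fun_sub d2) d3,
    divergence_sub d1 d2, divergence_smul hSψ hG,
    divergence_smul hGψ' hS, divergence_smul hwψ hG, divergence_smul hψ2 hW,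
    divergence_smul hAψ hS, ← box_eq_divergence ψ hψ]
  have e1 := fderiv_fderiv_apply hψ hS (sharp (fderiv ℝ ψ p))
  have e2 : fderiv ℝ (fun x => 1 / 2 * fderiv ℝ ψ x (sharp (fderiv ℝ ψ x))) p (S p) =
      fderiv ℝ (fderiv ℝ ψ) p (S p) (sharp (fderiv ℝ ψ p)) := by
    have hc : fderiv ℝ (fun x => sharp (fderiv ℝ ψ x)) p (S p) =
        sharp (fderiv ℝ (fderiv ℝ ψ) p (S p)) := by
      have := (sharp.hasFDerivAt.comp p hd.hasFDerivAt).fderiv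
      erw [this]; rfl
    rw [fderiv_const_mul hGψ]
    simp only [_root_.smul_apply, smul_eq_mul]
    rw [fderiv_fderiv_apply hψ hG, hc, ← metric_sharp_left (fderiv ℝ ψ p), metric_comm,
      metric_sharp_left]
    ring
  have e3 : fderiv ℝ (fun x => w x * ψ x) p (sharp (fderiv ℝ ψ p)) =
      w p * fderiv ℝ ψ p (sharp (fderiv ℝ ψ p)) + ψ p * fderiv ℝ ψ p (W p) := by
    rw [fderiv_fun_mul hw hψ1]
    simp only [_root_.add_apply, _root_.smul_apply, smul_eq_mul]
    rw [hwW, metric_comm, metric_sharp_left]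
  have e4 : fderiv ℝ (fun x => 1 / 2 * ψ x ^ 2) p (W p) = ψ p * fderiv ℝ ψ p (W p) := by
    rw [fderiv_const_mul (hψ1.fun_pow 2), fderiv_fun_pow 2 hψ1]
    simp
    ring
  have e5 : fderiv ℝ (fun x => 1 / 2 * A x * ψ x ^ 2) p (S p) =
      1 / 2 * fderiv ℝ A p (S p) * ψ p ^ 2 + A p * ψ p * fderiv ℝ ψ p (S p) := by
    rw [fderiv_fun_mul (hA.const_mul _) (hψ1.fun_pow 2), fderiv_const_mul hA, fderiv_fun_pow 2 hψ1]
    simp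
    ring
  have e6 : fderiv ℝ (fderiv ℝ ψ) p (sharp (fderiv ℝ ψ p)) (S p) =
      fderiv ℝ (fderiv ℝ ψ) p (S p) (sharp (fderiv ℝ ψ p)) := hsymm _ _
  rw [e1, e2, e3, e4, e5, e6]
  ring

end Ultrahyperbolic

namespace Ultrahyperbolic

variable {m n : ℕ}

/-! ### The radial geometry of the exterior of the null cone -/

/-- The linear form `g`-dual to a vector. -/
noncomputable def flat : Spacetime m n →L[ℝ] Spacetime m n →L[ℝ] ℝ :=
  ∑ α, (EuclideanSpace.proj α : Spacetime m n →L[ℝ] ℝ).smulRight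
    (sgn α • (EuclideanSpace.proj α : Spacetime m n →L[ℝ] ℝ))

theorem flat_apply (X Y : Spacetime m n) : flat X Y = metric X Y := by
  rw [metric_eq_sum, flat]
  simp only [_root_.sum_apply, ContinuousLinearMap.smulRight_apply, _root_.smul_apply,
    smul_eq_mul]
  refine Finset.sum_congr rfl fun α _ => ?_
  change X α * (sgn α * Y α) = _
  ring

theorem sharp_flat (X : Spacetime m n) : sharp (flat X) = X := sharp_eq fun Y => flat_apply X Y

/-- The projection `(t, x) ↦ (0, x)`. -/
noncomputable def spaceVec : Spacetime m n →L[ℝ] Spacetime m n :=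
  ∑ k : Fin n, (EuclideanSpace.proj (Sum.inr k) : Spacetime m n →L[ℝ] ℝ).smulRight
    (EuclideanSpace.single (Sum.inr k) 1)

theorem spaceVec_inl (X : Spacetime m n) (i : Fin m) : spaceVec X (Sum.inl i) = 0 := by
  simp [spaceVec]

theorem spaceVec_inr (X : Spacetime m n) (k : Fin n) : spaceVec X (Sum.inr k) = X (Sum.inr k) := by
  simp [spaceVec, Finset.sum_apply, Pi.single_apply]

theorem dRad_eq (p : Spacetime m n) : dRad p = (rad p)⁻¹ • spaceVec p := by
  ext α
  rcases α with i | k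
  · simp [dRad, spaceVec_inl]
  · simp [dRad, spaceVec_inr]; ring

theorem rad_sq (p : Spacetime m n) : rad p ^ 2 = ∑ k : Fin n, p (Sum.inr k) ^ 2 := by
  rw [rad, EuclideanSpace.norm_sq_eq]
  simp [spacePart]

theorem tau_sq (p : Spacetime m n) : tau p ^ 2 = ∑ i : Fin m, p (Sum.inl i) ^ 2 := by
  rw [tau, EuclideanSpace.norm_sq_eq]
  simp [timePart]

theorem metric_spaceVec_left (X Y : Spacetime m n) :
    metric (spaceVec X) Y = ∑ k : Fin n, X (Sum.inr k) * Y (Sum.inr k) := by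
  simp [metric, spaceVec_inl, spaceVec_inr]

theorem metric_spaceVec_self (p : Spacetime m n) : metric (spaceVec p) p = rad p ^ 2 := by
  rw [metric_spaceVec_left, rad_sq]
  exact Finset.sum_congr rfl fun k _ => by ring

theorem metric_self (p : Spacetime m n) : metric p p = 4 * fFun p := by
  rw [fFun_eq, ← rad, ← tau, rad_sq, tau_sq, metric]
  simp only [sq]
  ring

theorem four_mul_fFun (p : Spacetime m n) : 4 * fFun p = rad p ^ 2 - tau p ^ 2 := by
  rw [fFun_eq, ← rad, ← tau]; ring

theorem rad_nonneg (p : Spacetime m n) : 0 ≤ rad p := norm_nonneg _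

theorem tau_nonneg (p : Spacetime m n) : 0 ≤ tau p := norm_nonneg _

theorem rad_pos {p : Spacetime m n} (hp : 0 < fFun p) : 0 < rad p := by
  refine (rad_nonneg p).lt_of_ne fun h => ?_
  have := four_mul_fFun p
  rw [← h] at this
  nlinarith [sq_nonneg (tau p)]

theorem hasFDerivAt_fFun (p : Spacetime m n) :
    HasFDerivAt fFun (flat ((1 / 2 : ℝ) • p)) p := by
  have h1 : HasFDerivAt (fun x : Spacetime m n => flat x x) _ p :=
    (flat : Spacetime m n →L[ℝ] _).hasFDerivAt.clm_apply (hasFDerivAt_id p)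
  have h2 := h1.const_mul (1 / 4 : ℝ)
  refine (h2.congr_of_eventuallyEq (Eventually.of_forall fun x => ?_)).congr_fderiv ?_
  · change fFun x = 1 / 4 * flat x x
    rw [flat_apply, metric_self]; ring
  · ext Y
    simp [flat_apply, metric_comm Y p]
    ring

theorem hasFDerivAt_rad {p : Spacetime m n} (hp : 0 < rad p) :
    HasFDerivAt rad (flat (dRad p)) p := by
  have h1 : HasFDerivAt (fun x : Spacetime m n => flat (spaceVec x) x) _ p :=
    ((flat : Spacetime m n →L[ℝ] _).comp spaceVec).hasFDerivAt.clm_apply (hasFDerivAt_id p)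
  have h0 : flat (spaceVec p) p = rad p ^ 2 := by rw [flat_apply, metric_spaceVec_self]
  have h2 := h1.sqrt (by rw [h0]; positivity)
  refine (h2.congr_of_eventuallyEq (Eventually.of_forall fun x => ?_)).congr_fderiv ?_
  · change rad x = √(flat (spaceVec x) x)
    rw [flat_apply, metric_spaceVec_self, Real.sqrt_sq (rad_nonneg x)]
  · ext Y
    rw [h0, Real.sqrt_sq hp.le, dRad_eq]
    have : metric (spaceVec Y) p = metric (spaceVec p) Y := by
      rw [metric_spaceVec_left, metric_spaceVec_left]
      exact Finset.sum_congr rfl fun k _ => by ring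
    simp [flat_apply, this]
    field_simp
    ring

theorem metric_dRad_self {p : Spacetime m n} (hp : 0 < rad p) : metric (dRad p) p = rad p := by
  rw [dRad_eq, metric_smul_left, metric_spaceVec_self]
  field_simp

theorem spaceVec_spaceVec (X : Spacetime m n) : spaceVec (spaceVec X) = spaceVec X := by
  ext α
  rcases α with i | k
  · rw [spaceVec_inl, spaceVec_inl]
  · rw [spaceVec_inr]

theorem metric_dRad_spaceVec {p : Spacetime m n} (hp : 0 < rad p) :
    metric (dRad p) (spaceVec p) = rad p := by
  rw [dRad_eq, metric_smul_left, metric_spaceVec_left]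
  simp only [spaceVec_inr]
  have := rad_sq p
  simp only [sq] at this
  rw [← this]
  field_simp

theorem metric_dRad_dRad {p : Spacetime m n} (hp : 0 < rad p) : metric (dRad p) (dRad p) = 1 := by
  conv_lhs => rw [dRad_eq p, metric_smul_right]
  rw [← dRad_eq, metric_dRad_spaceVec hp]
  field_simp

theorem metric_dRad_dTau (p : Spacetime m n) : metric (dRad p) (dTau p) = 0 := by
  simp [metric, dRad, dTau]

theorem metric_self_dTau (p : Spacetime m n) : metric p (dTau p) = -tau p := by
  have : ∑ i : Fin m, p (Sum.inl i) * (p (Sum.inl i) / tau p) = tau p := by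
    have h1 : ∑ i : Fin m, p (Sum.inl i) * (p (Sum.inl i) / tau p) = tau p ^ 2 / tau p := by
      rw [tau_sq, Finset.sum_div]
      exact Finset.sum_congr rfl fun i _ => by ring
    rw [h1, sq, mul_self_div_self]
  simp [metric, dTau, this]

theorem self_eq (p : Spacetime m n) : p = tau p • dTau p + rad p • dRad p := by
  ext α
  rcases α with i | k
  · have : p (Sum.inl i) = tau p * (p (Sum.inl i) / tau p) := by
      rcases eq_or_ne (tau p) 0 with h | h
      · have h1 := tau_sq p
        rw [h] at h1
        have h2 := (Finset.sum_eq_zero_iff_of_nonneg (fun i _ => sq_nonneg _)).1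
          (show ∑ i : Fin m, p (Sum.inl i) ^ 2 = 0 by rw [← h1]; ring) i (Finset.mem_univ i)
        rw [h, zero_mul]
        exact pow_eq_zero_iff (two_ne_zero) |>.1 h2
      · field_simp
    simpa [dTau, dRad] using this
  · have : p (Sum.inr k) = rad p * (p (Sum.inr k) / rad p) := by
      rcases eq_or_ne (rad p) 0 with h | h
      · have h1 := rad_sq p
        rw [h] at h1
        have h2 := (Finset.sum_eq_zero_iff_of_nonneg (fun i _ => sq_nonneg _)).1
          (show ∑ k : Fin n, p (Sum.inr k) ^ 2 = 0 by rw [← h1]; ring) k (Finset.mem_univ k)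
        rw [h, zero_mul]
        exact pow_eq_zero_iff (two_ne_zero) |>.1 h2
      · field_simp
    simpa [dTau, dRad] using this

theorem hasFDerivAt_inv_rad {p : Spacetime m n} (hp : 0 < rad p) :
    HasFDerivAt (fun x : Spacetime m n => (rad x)⁻¹) (-(rad p ^ 2)⁻¹ • flat (dRad p)) p :=
  (hasDerivAt_inv hp.ne').comp_hasFDerivAt p (hasFDerivAt_rad hp)

theorem hasFDerivAt_dRad {p : Spacetime m n} (hp : 0 < rad p) :
    HasFDerivAt dRad ((rad p)⁻¹ • spaceVec - (rad p)⁻¹ • (flat (dRad p)).smulRight (dRad p)) p := by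
  have h1 := (hasFDerivAt_inv_rad hp).smul (spaceVec (m := m) (n := n)).hasFDerivAt
  refine (h1.congr_of_eventuallyEq (Eventually.of_forall fun x => ?_)).congr_fderiv ?_
  · simp [dRad_eq]
  · ext Y : 1
    simp [dRad_eq p, smul_smul]
    rw [sub_eq_add_neg, ← neg_smul]
    congr 2
    field_simp
    rw [neg_smul]

theorem divergence_id (p : Spacetime m n) : divergence (fun x => x) p = m + n := by
  rw [divergence_eq (V := fun x => x) differentiableAt_id]
  simp

theorem divergence_spaceVec (p : Spacetime m n) : divergence (fun x => spaceVec x) p = n := by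
  rw [divergence_eq spaceVec.differentiableAt, spaceVec.fderiv, Fintype.sum_sum_type]
  simp [spaceVec_inl, spaceVec_inr]

theorem divergence_dRad {p : Spacetime m n} (hp : 0 < rad p) :
    divergence dRad p = (n - 1) / rad p := by
  have h := hasFDerivAt_inv_rad hp
  have : (dRad : Spacetime m n → _) = fun x => (rad x)⁻¹ • spaceVec x := funext dRad_eq
  rw [this]
  erw [divergence_smul h.differentiableAt spaceVec.differentiableAt, h.fderiv]
  rw [divergence_spaceVec]
  simp [flat_apply, metric_dRad_spaceVec hp]
  field_simp
  ring

end Ultrahyperbolic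

namespace Ultrahyperbolic

variable {m n : ℕ}

/-! ### The multiplier field, the weight and the conjugated operator -/

/-- The denominator `(1 + εu)(1 - εv)` of the weight. -/
noncomputable def denom (ε : ℝ) (p : Spacetime m n) : ℝ := 1 - ε * rad p + ε ^ 2 * fFun p

theorem denom_eq (ε : ℝ) (p : Spacetime m n) :
    denom ε p = (1 + ε * nullU p) * (1 - ε * nullV p) := by
  simp only [denom, fFun, nullU, nullV]; ring

/-- The multiplier field `S`, the `g`-gradient direction of the weight. -/
noncomputable def multField (ε : ℝ) (p : Spacetime m n) : Spacetime m n :=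
  (1 / 2 * (1 - ε * rad p)) • p + (ε * fFun p) • dRad p

/-- The zeroth-order part `w` of the multiplier `S + w`. -/
noncomputable def multWeight (ε : ℝ) (p : Spacetime m n) : ℝ :=
  ((m : ℝ) + n - 2) / 4 * (1 - ε * rad p) + 1 / 2 * ε * (n - 2) * (fFun p * (rad p)⁻¹)

/-- The `g`-gradient of `multWeight`. -/
noncomputable def multWeightGrad (ε : ℝ) (p : Spacetime m n) : Spacetime m n :=
  (-(((m : ℝ) + n - 2) / 4 * ε) - 1 / 2 * ε * (n - 2) * (fFun p * (rad p)⁻¹ ^ 2)) • dRad p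
    + (1 / 4 * ε * (n - 2) * (rad p)⁻¹) • p

/-- The square root of the Carleman weight. -/
noncomputable def weightRoot (a b ε : ℝ) (p : Spacetime m n) : ℝ :=
  Real.exp (a * (Real.log (fFun p) - Real.log (denom ε p)
    + 2 * b * (√(fFun p) / √(denom ε p))))

/-- The coefficient `gamCoef` as a function on spacetime. -/
noncomputable def gam (a b ε : ℝ) (p : Spacetime m n) : ℝ :=
  gamCoef a b √(fFun p) √(denom ε p)

/-- The potential of the conjugated operator. -/
noncomputable def potential (a b ε : ℝ) (p : Spacetime m n) : ℝ :=
  gam a b ε p ^ 2 * fFun p * denom ε p - 1 / 2 * (a * b) * (√(fFun p))⁻¹ * (√(denom ε p))⁻¹ ^ 3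
    - ε * fFun p * (rad p)⁻¹ * gam a b ε p

section

variable {a b ε : ℝ} {p : Spacetime m n}

theorem hasFDerivAt_denom (hr : 0 < rad p) :
    HasFDerivAt (denom ε) (flat ((ε ^ 2 / 2) • p - ε • dRad p)) p := by
  have h := (((hasFDerivAt_rad hr).const_mul ε).const_sub 1).add
    ((hasFDerivAt_fFun p).const_mul (ε ^ 2))
  refine h.congr_fderiv ?_
  ext Y
  simp [map_sub]
  ring

theorem hasFDerivAt_sqrt_fFun (hf : 0 < fFun p) :
    HasFDerivAt (fun x : Spacetime m n => √(fFun x)) ((1 / (4 * √(fFun p))) • flat p) p := by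
  refine ((hasFDerivAt_fFun p).sqrt hf.ne').congr_fderiv ?_
  ext Y
  simp
  ring

theorem hasFDerivAt_sqrt_denom (hr : 0 < rad p) (hD : 0 < denom ε p) :
    HasFDerivAt (fun x : Spacetime m n => √(denom ε x))
      ((1 / (2 * √(denom ε p))) • flat ((ε ^ 2 / 2) • p - ε • dRad p)) p :=
  (hasFDerivAt_denom hr).sqrt hD.ne'

theorem metric_multField (Y : Spacetime m n) : metric (multField ε p) Y =
    1 / 2 * (1 - ε * rad p) * metric p Y + ε * fFun p * metric (dRad p) Y := by
  rw [multField, metric_add_left, metric_smul_left, metric_smul_left]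

theorem metric_multField_self (hr : 0 < rad p) :
    metric (multField ε p) p = fFun p * (2 - ε * rad p) := by
  rw [metric_multField, metric_self, metric_dRad_self hr]
  ring

theorem metric_multField_dRad (hr : 0 < rad p) :
    metric (multField ε p) (dRad p) = 1 / 2 * (1 - ε * rad p) * rad p + ε * fFun p := by
  rw [metric_multField, metric_dRad_dRad hr, metric_comm p, metric_dRad_self hr]
  ring

theorem metric_multField_dTau :
    metric (multField ε p) (dTau p) = -(1 / 2 * (1 - ε * rad p) * tau p) := by
  rw [metric_multField, metric_dRad_dTau, metric_self_dTau]
  ring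

theorem metric_multField_multField (hr : 0 < rad p) :
    metric (multField ε p) (multField ε p) = fFun p * denom ε p := by
  rw [metric_multField, metric_comm p, metric_comm (dRad p),
    metric_multField_self hr, metric_multField_dRad hr, denom]
  ring

theorem flat_p_multField (hr : 0 < rad p) :
    flat p (multField ε p) = fFun p * (2 - ε * rad p) := by
  rw [flat_apply, metric_comm, metric_multField_self hr]

theorem flat_dRad_multField (hr : 0 < rad p) :
    flat (dRad p) (multField ε p) = 1 / 2 * (1 - ε * rad p) * rad p + ε * fFun p := by
  rw [flat_apply, metric_comm, metric_multField_dRad hr]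

/-- The weight is a function whose gradient is parallel to the multiplier field. -/
theorem hasFDerivAt_weightRoot (hf : 0 < fFun p) (hD : 0 < denom ε p) :
    HasFDerivAt (weightRoot a b ε)
      (flat ((gam a b ε p * weightRoot a b ε p) • multField ε p)) p := by
  have hr := rad_pos hf
  have hδ := Real.sqrt_pos.2 hD
  have hφ := Real.sqrt_pos.2 hf
  have h1 := ((hasFDerivAt_fFun p).log hf.ne').sub ((hasFDerivAt_denom (ε := ε) hr).log hD.ne')
  have hi : HasFDerivAt (fun x : Spacetime m n => (√(denom ε x))⁻¹) _ p :=
    (hasDerivAt_inv hδ.ne').comp_hasFDerivAt p (hasFDerivAt_sqrt_denom hr hD)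
  have h2 := ((hasFDerivAt_sqrt_fFun hf).mul hi).const_mul (2 * b)
  have h3 := ((h1.add h2).const_mul a).exp
  refine (h3.congr_of_eventuallyEq (Eventually.of_forall fun x => ?_)).congr_fderiv ?_
  · simp [weightRoot, div_eq_mul_inv]
  · ext Y
    have e1 : √(fFun p) ^ 2 = fFun p := Real.sq_sqrt hf.le
    have e2 : √(denom ε p) ^ 2 = denom ε p := Real.sq_sqrt hD.le
    have e3 : Real.exp (a * (Real.log (fFun p) - Real.log (denom ε p)
        + 2 * b * (√(fFun p) * (√(denom ε p))⁻¹))) = weightRoot a b ε p := by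
      simp [weightRoot, div_eq_mul_inv]
    have e4 : 1 - ε * rad p = √(denom ε p) ^ 2 - ε ^ 2 * √(fFun p) ^ 2 := by
      rw [e1, e2, denom]; ring
    simp only [_root_.smul_apply, _root_.add_apply, _root_.sub_apply, flat_apply, 
      metric_multField, map_smul, map_sub, smul_eq_mul]
    simp only [Pi.add_apply, Pi.sub_apply, Pi.mul_apply]
    rw [e3, e4, gam, gamCoef]
    generalize weightRoot a b ε p = E at *
    generalize √(denom ε p) = δ at *
    generalize √(fFun p) = φ at *
    rw [← e1, ← e2]
    generalize metric p Y = k₁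
    generalize metric (dRad p) Y = k₂
    field_simp
    ring

theorem hasFDerivAt_multField (hr : 0 < rad p) :
    HasFDerivAt (multField ε) ((1 / 2 * (1 - ε * rad p)) • ContinuousLinearMap.id ℝ _
      - ((1 / 2 * ε) • flat (dRad p)).smulRight p + (ε • flat ((1 / 2 : ℝ) • p)).smulRight (dRad p)
      + (ε * fFun p) • ((rad p)⁻¹ • spaceVec
          - (rad p)⁻¹ • (flat (dRad p)).smulRight (dRad p))) p := by
  have h1 := ((((hasFDerivAt_rad hr).const_mul ε).const_sub 1).const_mul (1 / 2)).smul
    (hasFDerivAt_id p)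
  have h2 := ((hasFDerivAt_fFun p).const_mul ε).smul (hasFDerivAt_dRad hr)
  refine ((h1.add h2).congr_of_eventuallyEq (Eventually.of_forall fun x => ?_)).congr_fderiv ?_
  · simp [multField]
  · ext Y : 1
    simp
    module

theorem fderiv_apply_fderiv_multField (hr : 0 < rad p) (ℓ : Spacetime m n →L[ℝ] ℝ) :
    ℓ (fderiv ℝ (multField ε) p (sharp ℓ)) = 1 / 2 * (1 - ε * rad p) * ℓ (sharp ℓ)
      + ε * fFun p * (rad p)⁻¹ * (ℓ (spaceVec (sharp ℓ)) - ℓ (dRad p) ^ 2) := by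
  have h1 : flat (dRad p) (sharp ℓ) = ℓ (dRad p) := by
    rw [flat_apply, metric_comm, metric_sharp_left]
  have h2 : flat p (sharp ℓ) = ℓ p := by
    rw [flat_apply, metric_comm, metric_sharp_left]
  rw [(hasFDerivAt_multField hr).fderiv]
  simp [h1, h2]
  ring

theorem divergence_multField (hr : 0 < rad p) : divergence (multField ε) p =
    1 / 2 * (1 - ε * rad p) * (m + n) + ε * fFun p * (rad p)⁻¹ * (n - 1) := by
  have h1 := (((hasFDerivAt_rad hr).const_mul ε).const_sub 1).const_mul (1 / 2)
  have h2 := (hasFDerivAt_fFun p).const_mul ε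
  have h3 := hasFDerivAt_dRad hr
  change divergence (fun x => (1 / 2 * (1 - ε * rad x)) • x + (ε * fFun x) • dRad x) p = _
  rw [divergence_add (h1.differentiableAt.fun_smul differentiableAt_fun_id)
    (h2.differentiableAt.fun_smul h3.differentiableAt),
    divergence_smul h1.differentiableAt differentiableAt_fun_id,
    divergence_smul h2.differentiableAt h3.differentiableAt, divergence_id, divergence_dRad hr,
    h1.fderiv, h2.fderiv]
  simp [flat_apply, metric_dRad_self hr, metric_comm p]
  field_simp
  ring

theorem hasFDerivAt_multWeight (hr : 0 < rad p) :
    HasFDerivAt (multWeight ε) (flat (multWeightGrad ε p)) p := by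
  have h1 := (((hasFDerivAt_rad hr).const_mul ε).const_sub 1).const_mul (((m : ℝ) + n - 2) / 4)
  have h2 := ((hasFDerivAt_fFun p).mul (hasFDerivAt_inv_rad hr)).const_mul (1 / 2 * ε * (n - 2))
  refine (h1.add h2).congr_fderiv ?_
  ext Y
  simp [multWeightGrad]
  ring

theorem divergence_multWeightGrad (hr : 0 < rad p) : -(1 / 2 * divergence (multWeightGrad ε) p) =
    ε / rad p * (((m : ℝ) + n - 2) / 8
      + ((n : ℝ) - 2) * (n - 3) * fFun p / (4 * rad p ^ 2)) := by
  have hi := hasFDerivAt_inv_rad hr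
  have h1 := (((hasFDerivAt_fFun p).fun_mul (hi.pow 2)).const_mul
    (1 / 2 * ε * ((n : ℝ) - 2))).const_sub (-(((m : ℝ) + n - 2) / 4 * ε))
  have h2 := hi.const_mul (1 / 4 * ε * ((n : ℝ) - 2))
  have h3 := hasFDerivAt_dRad hr
  change -(1 / 2 * divergence (fun x => (-(((m : ℝ) + n - 2) / 4 * ε)
    - 1 / 2 * ε * (n - 2) * (fFun x * (rad x)⁻¹ ^ 2)) • dRad x
    + (1 / 4 * ε * (n - 2) * (rad x)⁻¹) • x) p) = _
  rw [divergence_add (h1.differentiableAt.fun_smul h3.differentiableAt)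
    (h2.differentiableAt.fun_smul differentiableAt_fun_id),
    divergence_smul h1.differentiableAt h3.differentiableAt,
    divergence_smul h2.differentiableAt differentiableAt_fun_id, divergence_id, divergence_dRad hr]
  erw [h1.fderiv, h2.fderiv]
  simp [flat_apply, metric_dRad_self hr, metric_comm p, metric_dRad_dRad hr]
  field_simp
  ring

end

end Ultrahyperbolic

namespace Ultrahyperbolic

variable {m n : ℕ} {a b ε : ℝ} {p : Spacetime m n}

theorem exists_hasFDerivAt_inv_sqrt_fFun (hf : 0 < fFun p) :
    ∃ L : Spacetime m n →L[ℝ] ℝ, HasFDerivAt (fun x : Spacetime m n => (√(fFun x))⁻¹) L p ∧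
      L (multField ε p) = -((1 / 2 - ε * rad p / 4) * (√(fFun p))⁻¹) := by
  have hφ := Real.sqrt_pos.2 hf
  refine ⟨_, (hasDerivAt_inv hφ.ne').comp_hasFDerivAt p (hasFDerivAt_sqrt_fFun hf), ?_⟩
  simp only [_root_.smul_apply, flat_p_multField (rad_pos hf), smul_eq_mul]
  have e1 : √(fFun p) ^ 2 = fFun p := Real.sq_sqrt hf.le
  generalize √(fFun p) = φ at *
  rw [← e1]
  field_simp
  ring

theorem exists_hasFDerivAt_inv_sqrt_denom (hr : 0 < rad p) (hD : 0 < denom ε p) :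
    ∃ L : Spacetime m n →L[ℝ] ℝ, HasFDerivAt (fun x : Spacetime m n => (√(denom ε x))⁻¹) L p ∧
      L (multField ε p) = ε * rad p / 4 * (√(denom ε p))⁻¹ := by
  have hδ := Real.sqrt_pos.2 hD
  refine ⟨_, (hasDerivAt_inv hδ.ne').comp_hasFDerivAt p (hasFDerivAt_sqrt_denom hr hD), ?_⟩
  simp only [_root_.smul_apply, map_sub, map_smul, _root_.sub_apply, flat_p_multField hr,
    flat_dRad_multField hr, smul_eq_mul]
  have e2 : √(denom ε p) ^ 2 = 1 - ε * rad p + ε ^ 2 * fFun p := Real.sq_sqrt hD.le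
  generalize √(denom ε p) = δ at *
  field_simp
  linear_combination (-4 * ε * rad p) * e2

theorem fderiv_fFun_multField (hr : 0 < rad p) :
    fderiv ℝ fFun p (multField ε p) = (1 - ε * rad p / 2) * fFun p := by
  rw [(hasFDerivAt_fFun p).fderiv, map_smul, _root_.smul_apply, flat_p_multField hr, smul_eq_mul]
  ring

theorem fderiv_denom_multField (hr : 0 < rad p) :
    fderiv ℝ (denom ε) p (multField ε p) = -(ε * rad p / 2 * denom ε p) := by
  rw [(hasFDerivAt_denom hr).fderiv]
  simp only [map_sub, map_smul, _root_.smul_apply, _root_.sub_apply, flat_p_multField hr,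
    flat_dRad_multField hr, smul_eq_mul, denom]
  ring

theorem gam_eq (hf : 0 < fFun p) (hD : 0 < denom ε p) : gam a b ε p =
    a * ((√(fFun p))⁻¹ ^ 2 * (√(denom ε p))⁻¹ ^ 2)
      + a * b * ((√(fFun p))⁻¹ * (√(denom ε p))⁻¹ ^ 3) := by
  have hδ := Real.sqrt_pos.2 hD
  have hφ := Real.sqrt_pos.2 hf
  rw [gam, gamCoef]
  field_simp

/-- The points where the weight and its logarithm are smooth. -/
def weightRegion (m n : ℕ) (ε : ℝ) : Set (Spacetime m n) := {p | 0 < fFun p ∧ 0 < denom ε p}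

theorem continuous_rad : Continuous (rad : Spacetime m n → ℝ) := by
  unfold rad spacePart
  fun_prop

theorem continuous_tau : Continuous (tau : Spacetime m n → ℝ) := by
  unfold tau timePart
  fun_prop

theorem continuous_fFun : Continuous (fFun : Spacetime m n → ℝ) := by
  have : (fFun : Spacetime m n → ℝ) = fun p => (rad p ^ 2 - tau p ^ 2) / 4 := by
    funext p; rw [← four_mul_fFun]; ring
  rw [this]
  exact ((continuous_rad.pow 2).sub (continuous_tau.pow 2)).div_const 4

theorem continuous_denom : Continuous (denom ε : Spacetime m n → ℝ) := by
  unfold denom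
  exact (continuous_const.sub (continuous_rad.const_mul ε)).add (continuous_fFun.const_mul _)

theorem isOpen_coneExterior : IsOpen (coneExterior m n) :=
  isOpen_lt continuous_const continuous_fFun

theorem isOpen_weightRegion : IsOpen (weightRegion m n ε) :=
  (isOpen_lt continuous_const continuous_fFun).inter (isOpen_lt continuous_const continuous_denom)

/-- The derivative of `gam` along the multiplier field. -/
theorem exists_hasFDerivAt_gam (hp : p ∈ weightRegion m n ε) :
    ∃ L : Spacetime m n →L[ℝ] ℝ, HasFDerivAt (gam a b ε) L p ∧ L (multField ε p) =
      -((1 - ε * rad p) * gam a b ε p)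
        + 1 / 2 * (a * b) * ((√(fFun p))⁻¹ * (√(denom ε p))⁻¹ ^ 3) := by
  obtain ⟨L₁, h₁, e₁⟩ := exists_hasFDerivAt_inv_sqrt_fFun (ε := ε) hp.1
  obtain ⟨L₂, h₂, e₂⟩ := exists_hasFDerivAt_inv_sqrt_denom (rad_pos hp.1) hp.2
  have h := (((h₁.pow 2).fun_mul (h₂.pow 2)).const_mul a).fun_add
    ((h₁.fun_mul (h₂.pow 3)).const_mul (a * b))
  refine ⟨_, h.congr_of_eventuallyEq ?_, ?_⟩
  · filter_upwards [isOpen_weightRegion.mem_nhds hp] with x hx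
    exact gam_eq hx.1 hx.2
  · rw [gam_eq hp.1 hp.2]
    simp only [_root_.smul_apply, _root_.add_apply, smul_eq_mul, nsmul_eq_mul, e₁, e₂]
    push_cast
    ring

/-- The derivative of the potential along the multiplier field gives the coefficient of the
zeroth-order term. -/
theorem exists_hasFDerivAt_potential (hp : p ∈ weightRegion m n ε) :
    ∃ L : Spacetime m n →L[ℝ] ℝ, HasFDerivAt (potential a b ε) L p ∧ 1 / 2 * L (multField ε p)
      + (1 / 2 * (1 - ε * rad p) + ε * fFun p / (2 * rad p)) * potential a b ε p =
        zeroCoef a b ε (rad p) √(fFun p) √(denom ε p) := by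
  have hr := rad_pos hp.1
  obtain ⟨L₁, h₁, e₁⟩ := exists_hasFDerivAt_inv_sqrt_fFun (ε := ε) hp.1
  obtain ⟨L₂, h₂, e₂⟩ := exists_hasFDerivAt_inv_sqrt_denom hr hp.2
  obtain ⟨L₃, h₃, e₃⟩ := exists_hasFDerivAt_gam (a := a) (b := b) hp
  have e₄ := fderiv_fFun_multField (ε := ε) hr
  rw [(hasFDerivAt_fFun p).fderiv] at e₄
  have e₅ := fderiv_denom_multField (ε := ε) hr
  rw [(hasFDerivAt_denom hr).fderiv] at e₅
  have h := ((((h₃.pow 2).fun_mul (hasFDerivAt_fFun p)).fun_mul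
    (hasFDerivAt_denom (ε := ε) hr)).fun_sub ((h₁.const_mul (1 / 2 * (a * b))).fun_mul
      (h₂.pow 3))).fun_sub ((((hasFDerivAt_fFun p).const_mul ε).fun_mul
        (hasFDerivAt_inv_rad hr)).fun_mul h₃)
  refine ⟨_, h, ?_⟩
  simp only [_root_.smul_apply, _root_.add_apply, _root_.sub_apply, smul_eq_mul, nsmul_eq_mul,
    e₁, e₂, e₃, e₄, e₅, flat_dRad_multField hr]
  rw [potential, gam, gamCoef, zeroCoef]
  have hδ := Real.sqrt_pos.2 hp.2
  have hφ := Real.sqrt_pos.2 hp.1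
  have i1 : √(fFun p) ^ 2 = fFun p := Real.sq_sqrt hp.1.le
  have i2 : √(denom ε p) ^ 2 = denom ε p := Real.sq_sqrt hp.2.le
  have i3 : denom ε p = 1 - ε * rad p + ε ^ 2 * fFun p := rfl
  generalize √(denom ε p) = δ at *
  generalize √(fFun p) = φ at *
  generalize rad p = r at *
  clear h h₁ h₂ h₃ e₁ e₂ e₃ e₄ e₅
  rw [← i1, ← i2]
  push_cast
  field_simp
  ring

end Ultrahyperbolic

namespace Ultrahyperbolic

variable {m n : ℕ} {a b ε : ℝ} {p : Spacetime m n} {z : Spacetime m n → ℝ}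

theorem metric_sharp_right (X : Spacetime m n) (ℓ : Spacetime m n →L[ℝ] ℝ) :
    metric X (sharp ℓ) = ℓ X := by rw [metric_comm, metric_sharp_left]

theorem metric_spaceVec_comm (X Y : Spacetime m n) :
    metric X (spaceVec Y) = metric (spaceVec X) Y := by
  rw [metric_comm, metric_spaceVec_left, metric_spaceVec_left]
  exact Finset.sum_congr rfl fun k _ => mul_comm _ _

theorem spaceVec_self (hr : 0 < rad p) : spaceVec p = rad p • dRad p := by
  rw [dRad_eq, smul_smul, mul_inv_cancel₀ hr.ne', one_smul]

theorem spaceVec_dRad : spaceVec (dRad p) = dRad p := by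
  rw [dRad_eq, map_smul, spaceVec_spaceVec]

theorem spaceVec_multField (hr : 0 < rad p) : spaceVec (multField ε p) =
    (1 / 2 * (1 - ε * rad p) * rad p + ε * fFun p) • dRad p := by
  rw [multField, map_add, map_smul, map_smul, spaceVec_self hr, spaceVec_dRad]
  module

theorem spaceAngular_eq (hr : 0 < rad p) : spaceAngular z p =
    fderiv ℝ z p (spaceVec (sharp (fderiv ℝ z p))) - fderiv ℝ z p (dRad p) ^ 2 := by
  have h1 : ∑ k : Fin n, partialDeriv (Sum.inr k) z p * p (Sum.inr k) =
      rad p * fderiv ℝ z p (dRad p) := by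
    rw [← smul_eq_mul (rad p), ← map_smul, ← spaceVec_self hr,
      ← metric_sharp_right (spaceVec p), metric_spaceVec_left]
    refine Finset.sum_congr rfl fun k _ => ?_
    rw [sharp_apply]
    simp [sgn, partialDeriv, mul_comm]
  have h2 : fderiv ℝ z p (spaceVec (sharp (fderiv ℝ z p))) =
      ∑ k : Fin n, partialDeriv (Sum.inr k) z p ^ 2 := by
    rw [← metric_sharp_right (spaceVec _), metric_spaceVec_left]
    refine Finset.sum_congr rfl fun k _ => ?_
    rw [sharp_apply]
    simp [sgn, partialDeriv, sq]
  rw [h2, spaceAngular, EuclideanSpace.norm_sq_eq]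
  generalize fderiv ℝ z p (dRad p) = c at *
  have h3 : ∀ k : Fin n, ‖(gradSpace z p - c • ((rad p)⁻¹ • spacePart p)) k‖ ^ 2 =
      partialDeriv (Sum.inr k) z p ^ 2
        - 2 * c * (rad p)⁻¹ * (partialDeriv (Sum.inr k) z p * p (Sum.inr k))
        + c ^ 2 * (rad p)⁻¹ ^ 2 * p (Sum.inr k) ^ 2 := by
    intro k
    rw [Real.norm_eq_abs, sq_abs]
    simp only [gradSpace, spacePart, PiLp.sub_apply, PiLp.smul_apply, smul_eq_mul]
    ring
  rw [Finset.sum_congr rfl fun k _ => h3 k, Finset.sum_add_distrib, Finset.sum_sub_distrib,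
    ← Finset.mul_sum, ← Finset.mul_sum, h1, ← rad_sq]
  field_simp
  ring

/-- At `τ = 0` the field `dTau` is zero by convention, and the formula holds there as well. -/
theorem timeAngular_eq : timeAngular z p =
    fderiv ℝ z p (dTau p) ^ 2 - ∑ i : Fin m, partialDeriv (Sum.inl i) z p ^ 2 := by
  have h1 : ∑ i : Fin m, partialDeriv (Sum.inl i) z p * p (Sum.inl i) * (tau p)⁻¹ =
      fderiv ℝ z p (dTau p) := by
    rw [clm_apply_eq_sum, Fintype.sum_sum_type]
    simp only [dTau, Sum.elim_inl, Sum.elim_inr, zero_mul, Finset.sum_const_zero, add_zero]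
    refine Finset.sum_congr rfl fun i _ => ?_
    rw [partialDeriv]; ring
  have h3 : ∀ (c : ℝ) (i : Fin m), ‖(gradTime z p - c • ((tau p)⁻¹ • timePart p)) i‖ ^ 2 =
      partialDeriv (Sum.inl i) z p ^ 2
        - 2 * c * (partialDeriv (Sum.inl i) z p * p (Sum.inl i) * (tau p)⁻¹)
        + c ^ 2 * (tau p)⁻¹ ^ 2 * p (Sum.inl i) ^ 2 := by
    intro c i
    rw [Real.norm_eq_abs, sq_abs]
    simp only [gradTime, timePart, PiLp.sub_apply, PiLp.smul_apply, smul_eq_mul]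
    ring
  rw [timeAngular, EuclideanSpace.norm_sq_eq, Finset.sum_congr rfl fun i _ => h3 _ i,
    Finset.sum_add_distrib, Finset.sum_sub_distrib,
    ← Finset.mul_sum, ← Finset.mul_sum, h1, ← tau_sq]
  rcases eq_or_ne (tau p) 0 with h | h
  · have : fderiv ℝ z p (dTau p) = 0 := by rw [← h1, h]; simp
    rw [this]; ring
  · field_simp
    ring

theorem fderiv_sharp_self (hr : 0 < rad p) :
    fderiv ℝ z p (sharp (fderiv ℝ z p)) = spaceAngular z p + fderiv ℝ z p (dRad p) ^ 2
      + timeAngular z p - fderiv ℝ z p (dTau p) ^ 2 := by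
  have h2 : fderiv ℝ z p (spaceVec (sharp (fderiv ℝ z p))) =
      ∑ k : Fin n, partialDeriv (Sum.inr k) z p ^ 2 := by
    rw [← metric_sharp_right (spaceVec _), metric_spaceVec_left]
    refine Finset.sum_congr rfl fun k _ => ?_
    rw [sharp_apply]
    simp [sgn, partialDeriv, sq]
  rw [spaceAngular_eq hr, timeAngular_eq, h2, clm_apply_eq_sum, Fintype.sum_sum_type]
  simp only [sharp_apply, sgn, Sum.elim_inl, Sum.elim_inr, partialDeriv]
  simp only [neg_mul, one_mul, Finset.sum_neg_distrib, ← sq]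
  ring

theorem fderiv_multField_apply (ℓ : Spacetime m n →L[ℝ] ℝ) : ℓ (multField ε p) =
    1 / 2 * (1 - ε * rad p) * (tau p * ℓ (dTau p) + rad p * ℓ (dRad p))
      + ε * fFun p * ℓ (dRad p) := by
  have h : ℓ p = tau p * ℓ (dTau p) + rad p * ℓ (dRad p) := by
    conv_lhs => rw [self_eq p]
    simp
  rw [multField, map_add, map_smul, map_smul, h]
  simp

/-- The vector `g`-dual to the differential of the conjugated function, divided by the square root
of the weight. -/
noncomputable def conjGrad (a b ε : ℝ) (c : ℝ) (ℓ : Spacetime m n →L[ℝ] ℝ) (p : Spacetime m n) :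
    Spacetime m n := sharp ℓ + (c * gam a b ε p) • multField ε p

theorem metric_conjGrad (c : ℝ) (ℓ : Spacetime m n →L[ℝ] ℝ) (Y : Spacetime m n) :
    metric (conjGrad a b ε c ℓ p) Y = ℓ Y + c * gam a b ε p * metric (multField ε p) Y := by
  rw [conjGrad, metric_add_left, metric_smul_left, metric_sharp_left]

/-- The gradient of the conjugated function splits into radial and angular parts. The weight is radial,
so that the angular parts are those of `z`. -/
theorem metric_conjGrad_self (hr : 0 < rad p) (c : ℝ) :
    metric (conjGrad a b ε c (fderiv ℝ z p) p) (conjGrad a b ε c (fderiv ℝ z p) p) =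
      -metric (conjGrad a b ε c (fderiv ℝ z p) p) (dTau p) ^ 2
        + metric (conjGrad a b ε c (fderiv ℝ z p) p) (dRad p) ^ 2
        + spaceAngular z p + timeAngular z p := by
  rw [metric_conjGrad, metric_conjGrad, metric_conjGrad, metric_comm (multField ε p) (conjGrad ..),
    metric_conjGrad, conjGrad, map_add, map_smul, fderiv_sharp_self hr,
    metric_multField_multField hr, metric_multField_dTau, metric_multField_dRad hr,
    fderiv_multField_apply, denom, smul_eq_mul]
  have := four_mul_fFun p
  generalize gam a b ε p = Γ
  linear_combination (1 / 4 * c ^ 2 * Γ ^ 2 * (1 - ε * rad p) ^ 2) * this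

theorem metric_conjGrad_spaceVec (hr : 0 < rad p) (c : ℝ) :
    metric (conjGrad a b ε c (fderiv ℝ z p) p) (spaceVec (conjGrad a b ε c (fderiv ℝ z p) p)) =
      metric (conjGrad a b ε c (fderiv ℝ z p) p) (dRad p) ^ 2 + spaceAngular z p := by
  have h1 : spaceVec (conjGrad a b ε c (fderiv ℝ z p) p) = spaceVec (sharp (fderiv ℝ z p))
      + (c * gam a b ε p * (1 / 2 * (1 - ε * rad p) * rad p + ε * fFun p)) • dRad p := by
    rw [conjGrad, map_add, map_smul, spaceVec_multField hr, smul_smul]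
  rw [h1, metric_add_right, metric_smul_right, metric_conjGrad, metric_conjGrad,
    metric_spaceVec_comm, spaceVec_multField hr, metric_smul_left, metric_sharp_right,
    metric_multField_dRad hr, spaceAngular_eq hr]
  ring

end Ultrahyperbolic

namespace Ultrahyperbolic

variable {m n : ℕ} {a b ε : ℝ} {p : Spacetime m n} {z : Spacetime m n → ℝ}

/-! ### The divergence of the weighted current -/

/-- The current divided by the weight, as a function of the value `c` and the differential `ℓ` of
the solution. -/
noncomputable def reducedCurrent (a b ε : ℝ) (c : ℝ) (ℓ : Spacetime m n →L[ℝ] ℝ)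
    (p : Spacetime m n) : Spacetime m n :=
  metric (conjGrad a b ε c ℓ p) (multField ε p) • conjGrad a b ε c ℓ p
    - (1 / 2 * metric (conjGrad a b ε c ℓ p) (conjGrad a b ε c ℓ p)) • multField ε p
    + (multWeight ε p * c) • conjGrad a b ε c ℓ p - (1 / 2 * c ^ 2) • multWeightGrad ε p
    + (1 / 2 * potential a b ε p * c ^ 2) • multField ε p

/-- The weighted current, as a function of the value `c` and the differential `ℓ` of the
solution. -/
noncomputable def current (a b ε : ℝ) (c : ℝ) (ℓ : Spacetime m n →L[ℝ] ℝ) (p : Spacetime m n) :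
    Spacetime m n := weightRoot a b ε p ^ 2 • reducedCurrent a b ε c ℓ p

theorem sharp_fderiv_conj (hp : p ∈ weightRegion m n ε) (hz : DifferentiableAt ℝ z p) :
    sharp (fderiv ℝ (fun x => weightRoot a b ε x * z x) p) =
      weightRoot a b ε p • conjGrad a b ε (z p) (fderiv ℝ z p) p := by
  have h := hasFDerivAt_weightRoot (a := a) (b := b) hp.1 hp.2
  rw [(h.fun_mul hz.hasFDerivAt).fderiv, map_add, map_smul, map_smul, sharp_flat, conjGrad]
  module

theorem fderiv_conj (hp : p ∈ weightRegion m n ε) (hz : DifferentiableAt ℝ z p)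
    (Y : Spacetime m n) : fderiv ℝ (fun x => weightRoot a b ε x * z x) p Y =
      weightRoot a b ε p * metric (conjGrad a b ε (z p) (fderiv ℝ z p) p) Y := by
  rw [← metric_sharp_left, sharp_fderiv_conj hp hz, metric_smul_left]

/-- Conjugation of the ultrahyperbolic operator with the weight. -/
theorem box_conj (hp : p ∈ weightRegion m n ε) (hz : ContDiffAt ℝ 2 z p)
    (hψ : ContDiffAt ℝ 2 (fun x => weightRoot a b ε x * z x) p) :
    box (fun x => weightRoot a b ε x * z x) p
        + potential a b ε p * (weightRoot a b ε p * z p) =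
      weightRoot a b ε p * (box z p + 2 * gam a b ε p *
        (metric (conjGrad a b ε (z p) (fderiv ℝ z p) p) (multField ε p)
          + multWeight ε p * z p)) := by
  have hr := rad_pos hp.1
  have hz1 : DifferentiableAt ℝ z p := hz.differentiableAt (by norm_num)
  have hE := hasFDerivAt_weightRoot (a := a) (b := b) hp.1 hp.2
  obtain ⟨L, hL, hLS⟩ := exists_hasFDerivAt_gam (a := a) (b := b) hp
  have hS := (hasFDerivAt_multField (ε := ε) hr).differentiableAt
  have hG : DifferentiableAt ℝ (fun x => sharp (fderiv ℝ z x)) p :=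
    sharp.differentiableAt.comp p
      ((hz.fderiv_right (m := 1) (by norm_num)).differentiableAt (by norm_num))
  have hc := (hz1.hasFDerivAt.fun_mul hL).fun_mul hE
  have hev : (fun x => sharp (fderiv ℝ (fun x => weightRoot a b ε x * z x) x)) =ᶠ[𝓝 p]
      fun x => weightRoot a b ε x • sharp (fderiv ℝ z x)
        + (z x * gam a b ε x * weightRoot a b ε x) • multField ε x := by
    filter_upwards [isOpen_weightRegion.mem_nhds hp, hz.eventually (by simp)] with x hx hzx
    rw [sharp_fderiv_conj hx (hzx.differentiableAt (by norm_num)), conjGrad]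
    module
  rw [box_eq_divergence _ hψ, divergence_congr hev,
    divergence_add (hE.differentiableAt.fun_smul hG) (hc.differentiableAt.fun_smul hS),
    divergence_smul hE.differentiableAt hG, divergence_smul hc.differentiableAt hS,
    ← box_eq_divergence _ hz, divergence_multField hr, hE.fderiv, hc.fderiv]
  simp only [_root_.add_apply, _root_.smul_apply, smul_eq_mul, hLS, flat_apply,
    metric_sharp_right, metric_multField_multField hr, metric_conjGrad,
    map_smul]
  rw [potential, multWeight]
  ring

/-- The divergence of the weighted current: a sum of squares with controlled coefficients, up to
the source term and the angular part of the gradient. -/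
theorem divergence_weightedCurrent (hp : p ∈ weightRegion m n ε) (hz : ContDiffAt ℝ 2 z p)
    (hE : ContDiffAt ℝ 2 (weightRoot a b ε) p) {yτ yr s : ℝ}
    (hyτ : yτ = fderiv ℝ z p (dTau p)
      - z p * gam a b ε p * ((1 - ε * rad p) * tau p / 2))
    (hyr : yr = fderiv ℝ z p (dRad p)
      + z p * gam a b ε p * ((1 - ε * rad p) * rad p / 2 + ε * fFun p))
    (hs : s = (1 - ε * rad p) / 2 * (tau p * yτ + rad p * yr) + ε * fFun p * yr
      + multWeight ε p * z p) :
    divergence (fun x => current a b ε (z x) (fderiv ℝ z x) x) p =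
      weightRoot a b ε p ^ 2 * (box z p * s - ε * fFun p / (2 * rad p) *
          (-yτ ^ 2 + yr ^ 2 + spaceAngular z p - -timeAngular z p)
        + ε * fFun p / rad p * spaceAngular z p + 2 * gam a b ε p * s ^ 2
        + (zeroCoef a b ε (rad p) √(fFun p) √(denom ε p)
          + ε / rad p * (((m : ℝ) + n - 2) / 8
            + ((n : ℝ) - 2) * (n - 3) * fFun p / (4 * rad p ^ 2))) * z p ^ 2) := by
  have hr := rad_pos hp.1
  have hz1 : DifferentiableAt ℝ z p := hz.differentiableAt (by norm_num)
  have hψ : ContDiffAt ℝ 2 (fun x => weightRoot a b ε x * z x) p := hE.mul hz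
  have hS := (hasFDerivAt_multField (ε := ε) hr).differentiableAt
  have hw := hasFDerivAt_multWeight (ε := ε) hr
  obtain ⟨L, hL, hLS⟩ := exists_hasFDerivAt_potential (a := a) (b := b) hp
  have hW : DifferentiableAt ℝ (multWeightGrad ε) p := by
    have hi := hasFDerivAt_inv_rad hr
    have h1 := (((hasFDerivAt_fFun p).fun_mul (hi.pow 2)).const_mul
      (1 / 2 * ε * ((n : ℝ) - 2))).const_sub (-(((m : ℝ) + n - 2) / 4 * ε))
    have h2 := hi.const_mul (1 / 4 * ε * ((n : ℝ) - 2))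
    exact (h1.differentiableAt.fun_smul (hasFDerivAt_dRad hr).differentiableAt).fun_add
      (h2.differentiableAt.fun_smul differentiableAt_fun_id)
  have hyτ' : yτ = metric (conjGrad a b ε (z p) (fderiv ℝ z p) p) (dTau p) := by
    rw [hyτ, metric_conjGrad, metric_multField_dTau]; ring
  have hyr' : yr = metric (conjGrad a b ε (z p) (fderiv ℝ z p) p) (dRad p) := by
    rw [hyr, metric_conjGrad, metric_multField_dRad hr]; ring
  have hs' : s = metric (conjGrad a b ε (z p) (fderiv ℝ z p) p) (multField ε p)
      + multWeight ε p * z p := by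
    have := fderiv_multField_apply (ε := ε) (p := p)
      (flat (conjGrad a b ε (z p) (fderiv ℝ z p) p))
    simp only [flat_apply, ← hyτ', ← hyr'] at this
    rw [this, hs]; ring
  have hev : (fun x => current a b ε (z x) (fderiv ℝ z x) x) =ᶠ[𝓝 p] fun x =>
      (fderiv ℝ (fun x => weightRoot a b ε x * z x) x (multField ε x)) •
          sharp (fderiv ℝ (fun x => weightRoot a b ε x * z x) x)
        - (1 / 2 * fderiv ℝ (fun x => weightRoot a b ε x * z x) x
          (sharp (fderiv ℝ (fun x => weightRoot a b ε x * z x) x))) • multField ε x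
        + (multWeight ε x * (weightRoot a b ε x * z x)) •
          sharp (fderiv ℝ (fun x => weightRoot a b ε x * z x) x)
        - (1 / 2 * (weightRoot a b ε x * z x) ^ 2) • multWeightGrad ε x
        + (1 / 2 * potential a b ε x * (weightRoot a b ε x * z x) ^ 2) • multField ε x := by
    filter_upwards [isOpen_weightRegion.mem_nhds hp, hz.eventually (by simp)] with x hx hzx
    have hzx1 := hzx.differentiableAt (by norm_num)
    simp only [fderiv_conj hx hzx1, sharp_fderiv_conj hx hzx1, metric_smul_right]
    rw [current, reducedCurrent]
    module
  rw [divergence_congr hev, divergence_current hψ hS hw.differentiableAt hL.differentiableAt hW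
    (fun Y => by rw [hw.fderiv, flat_apply]), box_conj hp hz hψ,
    fderiv_apply_fderiv_multField hr, hL.fderiv, divergence_multField hr]
  simp only [fderiv_conj hp hz1, sharp_fderiv_conj hp hz1, map_smul, metric_smul_right,
    metric_conjGrad_spaceVec hr, metric_conjGrad_self hr, ← hyτ', ← hyr']
  have hdw := divergence_multWeightGrad (ε := ε) hr
  rw [← hdw, ← hLS, hs']
  generalize divergence (multWeightGrad ε) p = DW
  generalize metric (conjGrad a b ε (z p) (fderiv ℝ z p) p) (multField ε p) = σ
  generalize weightRoot a b ε p = E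
  generalize potential a b ε p = A at *
  generalize L (multField ε p) = LS at *
  rw [multWeight]
  field_simp
  ring

end Ultrahyperbolic

namespace Ultrahyperbolic

variable {m n : ℕ} {a b ε : ℝ} {p : Spacetime m n} {z : Spacetime m n → ℝ}

/-! ### Regularity of the current and the pointwise estimate -/

theorem contDiff_fFun {k : ℕ∞} : ContDiff ℝ k (fFun : Spacetime m n → ℝ) := by
  have : (fFun : Spacetime m n → ℝ) = fun p => flat p p / 4 := by
    funext p; rw [flat_apply, metric_self]; ring
  rw [this]
  exact ((flat : Spacetime m n →L[ℝ] _).contDiff.clm_apply contDiff_id).div_const 4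

theorem contDiffAt_rad {k : ℕ∞} (hr : 0 < rad p) : ContDiffAt ℝ k rad p := by
  have h : ContDiff ℝ k (spacePart : Spacetime m n → _) := by
    unfold spacePart
    fun_prop
  exact h.contDiffAt.norm ℝ fun h0 => hr.ne' (by rw [rad, h0, norm_zero])

theorem contDiffAt_inv_rad {k : ℕ∞} (hr : 0 < rad p) :
    ContDiffAt ℝ k (fun x : Spacetime m n => (rad x)⁻¹) p := (contDiffAt_rad hr).inv hr.ne'

theorem contDiffAt_dRad {k : ℕ∞} (hr : 0 < rad p) : ContDiffAt ℝ k dRad p := by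
  have : (dRad : Spacetime m n → _) = fun x => (rad x)⁻¹ • spaceVec x := funext dRad_eq
  rw [this]
  exact (contDiffAt_inv_rad hr).smul spaceVec.contDiff.contDiffAt

theorem contDiffAt_denom {k : ℕ∞} (hr : 0 < rad p) : ContDiffAt ℝ k (denom ε) p :=
  (contDiffAt_const.sub (contDiffAt_const.mul (contDiffAt_rad hr))).add
    (contDiffAt_const.mul contDiff_fFun.contDiffAt)

theorem contDiffAt_sqrt_fFun {k : ℕ∞} (hf : 0 < fFun p) :
    ContDiffAt ℝ k (fun x : Spacetime m n => √(fFun x)) p :=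
  contDiff_fFun.contDiffAt.sqrt hf.ne'

theorem contDiffAt_sqrt_denom {k : ℕ∞} (hp : p ∈ weightRegion m n ε) :
    ContDiffAt ℝ k (fun x : Spacetime m n => √(denom ε x)) p :=
  (contDiffAt_denom (rad_pos hp.1)).sqrt hp.2.ne'

theorem contDiffAt_weightRoot {k : ℕ∞} (hp : p ∈ weightRegion m n ε) :
    ContDiffAt ℝ k (weightRoot a b ε) p :=
  (contDiffAt_const.mul (((contDiff_fFun.contDiffAt.log hp.1.ne').sub
    ((contDiffAt_denom (rad_pos hp.1)).log hp.2.ne')).add (contDiffAt_const.mul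
      ((contDiffAt_sqrt_fFun hp.1).div (contDiffAt_sqrt_denom hp)
        (Real.sqrt_pos.2 hp.2).ne')))).exp

theorem contDiffAt_gam {k : ℕ∞} (hp : p ∈ weightRegion m n ε) :
    ContDiffAt ℝ k (gam a b ε) p := by
  have h1 := contDiffAt_sqrt_fFun (k := k) hp.1
  have h2 := contDiffAt_sqrt_denom (k := k) hp
  have := Real.sqrt_pos.2 hp.1
  have := Real.sqrt_pos.2 hp.2
  exact (contDiffAt_const.mul (h2.add (contDiffAt_const.mul h1))).div
    ((h1.pow 2).mul (h2.pow 3)) (by positivity)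

theorem contDiffAt_potential {k : ℕ∞} (hp : p ∈ weightRegion m n ε) :
    ContDiffAt ℝ k (potential a b ε) p := by
  have h1 := (contDiffAt_sqrt_fFun (k := k) hp.1).inv (Real.sqrt_pos.2 hp.1).ne'
  have h2 := (contDiffAt_sqrt_denom (k := k) hp).inv (Real.sqrt_pos.2 hp.2).ne'
  have h3 := contDiffAt_gam (a := a) (b := b) (k := k) hp
  have h4 : ContDiffAt ℝ k (fFun : Spacetime m n → ℝ) p := contDiff_fFun.contDiffAt
  exact ((((h3.pow 2).mul h4).mul (contDiffAt_denom (rad_pos hp.1))).sub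
    ((contDiffAt_const.mul h1).mul (h2.pow 3))).sub
      (((contDiffAt_const.mul h4).mul (contDiffAt_inv_rad (rad_pos hp.1))).mul h3)

theorem contDiffAt_multField {k : ℕ∞} (hr : 0 < rad p) : ContDiffAt ℝ k (multField ε) p :=
  ((contDiffAt_const.mul (contDiffAt_const.sub (contDiffAt_const.mul (contDiffAt_rad hr)))).smul
    contDiffAt_id).add ((contDiffAt_const.mul contDiff_fFun.contDiffAt).smul (contDiffAt_dRad hr))

theorem contDiffAt_multWeight {k : ℕ∞} (hr : 0 < rad p) : ContDiffAt ℝ k (multWeight ε) p :=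
  (contDiffAt_const.mul (contDiffAt_const.sub (contDiffAt_const.mul (contDiffAt_rad hr)))).add
    (contDiffAt_const.mul (contDiff_fFun.contDiffAt.mul (contDiffAt_inv_rad hr)))

theorem contDiffAt_multWeightGrad {k : ℕ∞} (hr : 0 < rad p) :
    ContDiffAt ℝ k (multWeightGrad ε) p :=
  ((contDiffAt_const.sub (contDiffAt_const.mul (contDiff_fFun.contDiffAt.mul
    ((contDiffAt_inv_rad hr).pow 2)))).smul (contDiffAt_dRad hr)).add
      ((contDiffAt_const.mul (contDiffAt_inv_rad hr)).smul contDiffAt_id)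

theorem contDiffAt_metric {F : Type*} [NormedAddCommGroup F] [NormedSpace ℝ F] {k : ℕ∞}
    {X Y : F → Spacetime m n} {q : F} (hX : ContDiffAt ℝ k X q) (hY : ContDiffAt ℝ k Y q) :
    ContDiffAt ℝ k (fun x => Ultrahyperbolic.metric (X x) (Y x)) q := by
  simp only [← flat_apply]
  exact ((flat : Spacetime m n →L[ℝ] _).contDiff.contDiffAt.comp q hX).clm_apply hY

section

variable {F : Type*} [NormedAddCommGroup F] [NormedSpace ℝ F] {k : ℕ∞} {q : F} {c : F → ℝ}
  {ℓ : F → Spacetime m n →L[ℝ] ℝ} {x : F → Spacetime m n}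

theorem contDiffAt_conjGrad (hq : x q ∈ weightRegion m n ε) (hc : ContDiffAt ℝ k c q)
    (hl : ContDiffAt ℝ k ℓ q) (hx : ContDiffAt ℝ k x q) :
    ContDiffAt ℝ k (fun y => conjGrad a b ε (c y) (ℓ y) (x y)) q := by
  have hS : ContDiffAt ℝ k (fun y => multField ε (x y)) q :=
    (contDiffAt_multField (rad_pos hq.1)).comp q hx
  have hg : ContDiffAt ℝ k (fun y => gam a b ε (x y)) q := (contDiffAt_gam hq).comp q hx
  have hs : ContDiffAt ℝ k (fun y => sharp (ℓ y)) q := sharp.contDiff.contDiffAt.comp q hl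
  exact hs.add ((hc.mul hg).smul hS)

theorem contDiffAt_reducedCurrent (hq : x q ∈ weightRegion m n ε) (hc : ContDiffAt ℝ k c q)
    (hl : ContDiffAt ℝ k ℓ q) (hx : ContDiffAt ℝ k x q) :
    ContDiffAt ℝ k (fun y => reducedCurrent a b ε (c y) (ℓ y) (x y)) q := by
  have hr := rad_pos hq.1
  have hS : ContDiffAt ℝ k (fun y => multField ε (x y)) q := (contDiffAt_multField hr).comp q hx
  have hW : ContDiffAt ℝ k (fun y => multWeightGrad ε (x y)) q :=
    (contDiffAt_multWeightGrad hr).comp q hx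
  have hw : ContDiffAt ℝ k (fun y => multWeight ε (x y)) q :=
    (contDiffAt_multWeight hr).comp q hx
  have hA : ContDiffAt ℝ k (fun y => potential a b ε (x y)) q :=
    (contDiffAt_potential hq).comp q hx
  have hG := contDiffAt_conjGrad (a := a) (b := b) hq hc hl hx
  unfold reducedCurrent
  exact (((((contDiffAt_metric hG hS).smul hG).sub ((contDiffAt_const.mul (contDiffAt_metric hG hG)).smul hS)).add
    ((hw.mul hc).smul hG)).sub ((contDiffAt_const.mul (hc.pow 2)).smul hW)).add
      (((contDiffAt_const.mul hA).mul (hc.pow 2)).smul hS)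

/-- The current depends smoothly on the point and on the value and the differential of the
solution. -/
theorem contDiffAt_current (hq : x q ∈ weightRegion m n ε) (hc : ContDiffAt ℝ k c q)
    (hl : ContDiffAt ℝ k ℓ q) (hx : ContDiffAt ℝ k x q) :
    ContDiffAt ℝ k (fun y => current a b ε (c y) (ℓ y) (x y)) q := by
  have hE : ContDiffAt ℝ k (fun y => weightRoot a b ε (x y)) q :=
    (contDiffAt_weightRoot hq).comp q hx
  exact (hE.pow 2).smul (contDiffAt_reducedCurrent hq hc hl hx)

end

theorem tau_lt_rad (hf : 0 < fFun p) : tau p < rad p := by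
  have := four_mul_fFun p
  exact lt_of_pow_lt_pow_left₀ 2 (rad_nonneg p) (by linarith)

theorem null_factors_pos (hε : 0 < ε) (hf : 0 < fFun p) (hεr : ε * rad p ≤ 1 / 100) :
    0 < 1 + ε * nullU p ∧ 0 < 1 - ε * nullV p := by
  have h1 := tau_lt_rad hf
  have h2 := tau_nonneg p
  have h3 : ε * tau p ≤ ε * rad p := by gcongr
  have h4 : 0 ≤ ε * tau p := by positivity
  unfold nullU nullV
  constructor <;> linarith

theorem mem_weightRegion (hε : 0 < ε) (hf : 0 < fFun p) (hεr : ε * rad p ≤ 1 / 100) :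
    p ∈ weightRegion m n ε := by
  obtain ⟨h1, h2⟩ := null_factors_pos hε hf hεr
  exact ⟨hf, by rw [denom_eq]; positivity⟩

theorem carlemanWeight_eq (hε : 0 < ε) (hf : 0 < fFun p) (hεr : ε * rad p ≤ 1 / 100) :
    carlemanWeight a b ε p = weightRoot a b ε p ^ 2 := by
  obtain ⟨h1, h2⟩ := null_factors_pos hε hf hεr
  have hD := (mem_weightRegion hε hf hεr).2
  rw [carlemanWeight, ← Real.sqrt_mul h1.le, ← denom_eq, weightRoot, ← Real.exp_nat_mul,
    ← Real.exp_log (div_pos hf hD), ← Real.exp_add, ← Real.exp_mul, Real.log_div hf.ne' hD.ne']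
  congr 1
  push_cast
  ring

theorem multWeight_sq_le (hm : 1 ≤ m) (hn : 1 ≤ n) (ha : ((m : ℝ) + n) ^ 2 ≤ a) (hε : 0 < ε)
    (hf : 0 < fFun p) (hεr : ε * rad p ≤ 1 / 100) : multWeight ε p ^ 2 ≤ a ^ 2 / 16 := by
  have hr := rad_pos hf
  have hm' : (1 : ℝ) ≤ m := by exact_mod_cast hm
  have hn' : (1 : ℝ) ≤ n := by exact_mod_cast hn
  have h4 : 0 < ε * rad p := by positivity
  have h1 : fFun p * (rad p)⁻¹ ≤ rad p / 4 := by
    rw [← div_eq_mul_inv, div_le_iff₀ hr]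
    have := four_mul_fFun p
    nlinarith [sq_nonneg (tau p)]
  have h2 : 0 ≤ ε * (fFun p * (rad p)⁻¹) := by positivity
  have h3 : ε * (fFun p * (rad p)⁻¹) ≤ 1 / 400 := by
    have : ε * (fFun p * (rad p)⁻¹) ≤ ε * (rad p / 4) := by gcongr
    linarith
  have hw : multWeight ε p = ((m : ℝ) + n - 2) / 4 * (1 - ε * rad p)
      + 1 / 2 * (n - 2) * (ε * (fFun p * (rad p)⁻¹)) := by rw [multWeight]; ring
  have hub : |multWeight ε p| ≤ ((m : ℝ) + n) / 2 := by
    rw [hw]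
    generalize ε * (fFun p * (rad p)⁻¹) = e at *
    have k1 : 0 ≤ ((m : ℝ) + n - 2) / 4 * (1 - ε * rad p) :=
      mul_nonneg (by linarith) (by linarith)
    have k2 : ((m : ℝ) + n - 2) / 4 * (1 - ε * rad p) ≤ ((m : ℝ) + n - 2) / 4 :=
      mul_le_of_le_one_right (by linarith) (by linarith)
    rw [abs_le]
    constructor <;> nlinarith
  have h5 : multWeight ε p ^ 2 ≤ (((m : ℝ) + n) / 2) ^ 2 :=
    sq_le_sq' (abs_le.1 hub).1 (abs_le.1 hub).2
  have h6 : 4 ≤ a := by nlinarith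
  nlinarith [mul_nonneg (by linarith : (0 : ℝ) ≤ a) (sub_nonneg.2 h6)]

/-- The coefficient `-□w / 2` of `ψ²` that the function `w` contributes is nonnegative, for all
dimensions. -/
theorem coef_nonneg (hm : 1 ≤ m) (hn : 1 ≤ n) (hε : 0 < ε) (hf : 0 < fFun p) :
    0 ≤ ε / rad p * (((m : ℝ) + n - 2) / 8
      + ((n : ℝ) - 2) * (n - 3) * fFun p / (4 * rad p ^ 2)) := by
  have hr := rad_pos hf
  have hm' : (1 : ℝ) ≤ m := by exact_mod_cast hm
  have hn' : (1 : ℝ) ≤ n := by exact_mod_cast hn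
  -- no integer lies strictly between the roots `2` and `3`
  have h : 0 ≤ ((n : ℝ) - 2) * (n - 3) := by
    rcases Nat.lt_or_ge n 3 with h | h
    · have : (n : ℝ) ≤ 2 := by exact_mod_cast Nat.lt_succ_iff.1 h
      exact mul_nonneg_of_nonpos_of_nonpos (by linarith) (by linarith)
    · have : (3 : ℝ) ≤ n := by exact_mod_cast h
      exact mul_nonneg (by linarith) (by linarith)
  have : 0 ≤ ((m : ℝ) + n - 2) / 8 := by linarith
  positivity

/-- The pointwise estimate: the divergence of the current dominates the densities of the left-hand
side up to the source density. -/
theorem densities_le_divergence (hm : 1 ≤ m) (hn : 1 ≤ n) (ha : ((m : ℝ) + n) ^ 2 ≤ a)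
    (hε : 0 < ε) (hb : 0 < b) (hεb : ε ≤ b / 100) (hf : 0 < fFun p) (hbr : b * rad p ≤ 1)
    (hz : ContDiffAt ℝ 2 z p) :
    1 / 16 * (ε * firstOrderDensity a b ε z p + b * a ^ 2 * zeroOrderDensity a b ε z p)
        - 1 / (4 * a) * boxDensity a b ε z p ≤
      divergence (fun x => current a b ε (z x) (fderiv ℝ z x) x) p := by
  have hr := rad_pos hf
  have hm' : (1 : ℝ) ≤ m := by exact_mod_cast hm
  have hn' : (1 : ℝ) ≤ n := by exact_mod_cast hn
  have ha4 : 4 ≤ a := by nlinarith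
  have hεr : ε * rad p ≤ 1 / 100 := by nlinarith
  have hp := mem_weightRegion hε hf hεr
  have e1 : √(fFun p) ^ 2 = fFun p := Real.sq_sqrt hf.le
  have e2 : √(denom ε p) ^ 2 = denom ε p := Real.sq_sqrt hp.2.le
  have hmain := current_lower_bound (a := a) (b := b) (ε := ε) (r := rad p) (τ := tau p)
    (φ := √(fFun p)) (δ := √(denom ε p)) (z := z p) (zτ := fderiv ℝ z p (dTau p))
    (zr := fderiv ℝ z p (dRad p)) (Ax := spaceAngular z p) (At := -timeAngular z p)
    (L := box z p) (w := multWeight ε p) ha4 hb hε hr (tau_nonneg p) (Real.sqrt_pos.2 hf)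
    (Real.sqrt_pos.2 hp.2) (by rw [e1, four_mul_fFun]) (by rw [e1, e2, denom]) hεr hbr hεb
    (sq_nonneg _) (by rw [timeAngular, neg_neg]; exact sq_nonneg _)
    (multWeight_sq_le hm hn ha hε hf hεr) (coef_nonneg hm hn hε hf) rfl rfl rfl
  rw [e1] at hmain
  rw [divergence_weightedCurrent hp hz (by exact_mod_cast contDiffAt_weightRoot (k := 2) hp)
    rfl rfl rfl]
  rw [firstOrderDensity, zeroOrderDensity, boxDensity, carlemanWeight_eq hε hf hεr, sq_abs,
    sq_abs, sq_abs, dU, dV, map_sub, map_add, nullU, nullV]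
  refine le_trans (le_of_eq ?_) (mul_le_mul_of_nonneg_left hmain (sq_nonneg _))
  ring

end Ultrahyperbolic

namespace Ultrahyperbolic

/-! ### Bounds near the null cone -/

/-- Boundedness of a function on a set. -/
def BddOn {X F : Type*} [Norm F] (s : Set X) (f : X → F) : Prop := ∃ C, ∀ x ∈ s, ‖f x‖ ≤ C

namespace BddOn

variable {X F : Type*} [NormedAddCommGroup F] {s : Set X} {f g : X → F}
  {h k : X → ℝ}

theorem const (c : F) : BddOn s fun _ => c := ⟨‖c‖, fun _ _ => le_rfl⟩

theorem add (hf : BddOn s f) (hg : BddOn s g) : BddOn s fun x => f x + g x := by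
  obtain ⟨C, hC⟩ := hf
  obtain ⟨D, hD⟩ := hg
  exact ⟨C + D, fun x hx => (norm_add_le _ _).trans (add_le_add (hC x hx) (hD x hx))⟩

theorem sub (hf : BddOn s f) (hg : BddOn s g) : BddOn s fun x => f x - g x := by
  obtain ⟨C, hC⟩ := hf
  obtain ⟨D, hD⟩ := hg
  exact ⟨C + D, fun x hx => (norm_sub_le _ _).trans (add_le_add (hC x hx) (hD x hx))⟩

theorem congr (hf : BddOn s f) (hfg : ∀ x ∈ s, g x = f x) : BddOn s g := by
  obtain ⟨C, hC⟩ := hf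
  exact ⟨C, fun x hx => by rw [hfg x hx]; exact hC x hx⟩

variable [NormedSpace ℝ F]

theorem smul (hh : BddOn s h) (hf : BddOn s f) : BddOn s fun x => h x • f x := by
  obtain ⟨C, hC⟩ := hh
  obtain ⟨D, hD⟩ := hf
  refine ⟨C * D, fun x hx => ?_⟩
  rw [norm_smul]
  exact mul_le_mul (hC x hx) (hD x hx) (norm_nonneg _) ((norm_nonneg _).trans (hC x hx))

theorem mul (hh : BddOn s h) (hk : BddOn s k) : BddOn s fun x => h x * k x := hh.smul hk

theorem pow (hh : BddOn s h) (j : ℕ) : BddOn s fun x => h x ^ j := by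
  obtain ⟨C, hC⟩ := hh
  refine ⟨C ^ j, fun x hx => ?_⟩
  rw [norm_pow]
  exact pow_le_pow_left₀ (norm_nonneg _) (hC x hx) j

theorem comp_clm {G : Type*} [NormedAddCommGroup G] [NormedSpace ℝ G] (T : F →L[ℝ] G)
    (hf : BddOn s f) : BddOn s fun x => T (f x) := by
  obtain ⟨C, hC⟩ := hf
  refine ⟨‖T‖ * C, fun x hx => (T.le_opNorm _).trans ?_⟩
  exact mul_le_mul_of_nonneg_left (hC x hx) (norm_nonneg _)

theorem clm_apply {ℓ : X → F →L[ℝ] ℝ} (hl : BddOn s ℓ) (hf : BddOn s f) :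
    BddOn s fun x => ℓ x (f x) := by
  obtain ⟨C, hC⟩ := hl
  obtain ⟨D, hD⟩ := hf
  refine ⟨C * D, fun x hx => ((ℓ x).le_opNorm _).trans ?_⟩
  exact mul_le_mul (hC x hx) (hD x hx) (norm_nonneg _) ((norm_nonneg _).trans (hC x hx))

end BddOn

variable {m n : ℕ} {a b ε R : ℝ} {s : Set (Spacetime m n)} {z : Spacetime m n → ℝ}

theorem BddOn.metric {X : Type*} {s : Set X} {V W : X → Spacetime m n} (hV : BddOn s V)
    (hW : BddOn s W) : BddOn s fun x => Ultrahyperbolic.metric (V x) (W x) :=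
  ((hV.comp_clm flat).clm_apply hW).congr fun _ _ => (flat_apply _ _).symm

theorem norm_sq_eq (p : Spacetime m n) : ‖p‖ ^ 2 = tau p ^ 2 + rad p ^ 2 := by
  rw [EuclideanSpace.norm_sq_eq, Fintype.sum_sum_type, tau_sq, rad_sq]
  simp

theorem norm_le_of_rad_le {p : Spacetime m n} (hf : 0 ≤ fFun p) : ‖p‖ ≤ 2 * rad p := by
  refine abs_le_of_sq_le_sq' ?_ (by linarith [rad_nonneg p]) |>.2
  rw [norm_sq_eq]
  have := four_mul_fFun p
  nlinarith [sq_nonneg (rad p)]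

theorem norm_dRad_le (p : Spacetime m n) : ‖dRad p‖ ≤ 1 := by
  refine abs_le_of_sq_le_sq' ?_ zero_le_one |>.2
  have h : ‖spaceVec p‖ ^ 2 = rad p ^ 2 := by
    rw [EuclideanSpace.norm_sq_eq, Fintype.sum_sum_type, rad_sq]
    simp [spaceVec_inl, spaceVec_inr]
  rw [dRad_eq, norm_smul, mul_pow, h, norm_inv, inv_pow, Real.norm_eq_abs, sq_abs, one_pow]
  exact inv_mul_le_one

theorem norm_dTau_le (p : Spacetime m n) : ‖dTau p‖ ≤ 1 := by
  refine abs_le_of_sq_le_sq' ?_ zero_le_one |>.2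
  have h : ‖dTau p‖ ^ 2 = (tau p ^ 2)⁻¹ * tau p ^ 2 := by
    conv_rhs => arg 2; rw [tau_sq]
    rw [EuclideanSpace.norm_sq_eq, Fintype.sum_sum_type, Finset.mul_sum]
    simp only [dTau, Sum.elim_inl, Sum.elim_inr, norm_zero, Real.norm_eq_abs, sq_abs, div_pow]
    simp [div_eq_inv_mul]
  rw [h, one_pow]
  exact inv_mul_le_one

/-- A bounded set of points in the exterior of the null cone on which the factors of the weight stay
away from zero. -/
structure IsAdmissible (ε R : ℝ) (s : Set (Spacetime m n)) : Prop where
  eps_pos : 0 < ε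
  pos : ∀ p ∈ s, 0 < fFun p
  rad_le : ∀ p ∈ s, rad p ≤ R
  eps_mul_le : ∀ p ∈ s, ε * rad p ≤ 1 / 100

namespace IsAdmissible

theorem bdd_rad (hs : IsAdmissible ε R s) : BddOn s rad :=
  ⟨R, fun p hp => by
    rw [Real.norm_of_nonneg (rad_nonneg p)]; exact hs.rad_le p hp⟩

theorem bdd_id (hs : IsAdmissible ε R s) : BddOn s fun p => p :=
  ⟨2 * R, fun p hp => (norm_le_of_rad_le (hs.pos p hp).le).trans (by linarith [hs.rad_le p hp])⟩

theorem bdd_dRad (s : Set (Spacetime m n)) : BddOn s dRad := ⟨1, fun p _ => norm_dRad_le p⟩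

theorem bdd_dTau (s : Set (Spacetime m n)) : BddOn s dTau := ⟨1, fun p _ => norm_dTau_le p⟩

theorem bdd_tau (hs : IsAdmissible ε R s) : BddOn s tau :=
  ⟨R, fun p hp => by
    rw [Real.norm_of_nonneg (tau_nonneg p)]
    exact (tau_lt_rad (hs.pos p hp)).le.trans (hs.rad_le p hp)⟩

theorem bdd_fFun (hs : IsAdmissible ε R s) : BddOn s fFun :=
  (((BddOn.const (1 / 4 : ℝ)).mul (hs.bdd_rad.pow 2)).sub
    ((BddOn.const (1 / 4 : ℝ)).mul (hs.bdd_tau.pow 2))).congr fun p _ => by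
      have := four_mul_fFun p
      linarith

theorem bdd_fFun_div_rad_sq (hs : IsAdmissible ε R s) :
    BddOn s fun p => fFun p * (rad p)⁻¹ ^ 2 := by
  refine ⟨1, fun p hp => ?_⟩
  have hf := hs.pos p hp
  have hr := rad_pos hf
  beta_reduce
  rw [Real.norm_of_nonneg (by positivity), inv_pow, ← div_eq_mul_inv, div_le_one (by positivity)]
  have := four_mul_fFun p
  nlinarith [sq_nonneg (tau p)]

theorem bdd_fFun_div_rad (hs : IsAdmissible ε R s) : BddOn s fun p => fFun p * (rad p)⁻¹ :=
  (hs.bdd_fFun_div_rad_sq.mul hs.bdd_rad).congr fun p hp => by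
    have hr := rad_pos (hs.pos p hp)
    field_simp

theorem bdd_inv_rad_smul (hs : IsAdmissible ε R s) : BddOn s fun p => (rad p)⁻¹ • p := by
  refine ⟨2, fun p hp => ?_⟩
  have hf := hs.pos p hp
  have hr := rad_pos hf
  rw [norm_smul, norm_inv, Real.norm_of_nonneg hr.le, inv_mul_le_iff₀ hr, mul_comm]
  exact norm_le_of_rad_le hf.le

theorem bdd_sqrt_fFun (hs : IsAdmissible ε R s) : BddOn s fun p => √(fFun p) := by
  obtain ⟨C, hC⟩ := hs.bdd_fFun
  refine ⟨√C, fun p hp => ?_⟩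
  rw [Real.norm_of_nonneg (Real.sqrt_nonneg _)]
  exact Real.sqrt_le_sqrt ((le_abs_self _).trans (hC p hp))

theorem mem_weightRegion (hs : IsAdmissible ε R s) {p : Spacetime m n} (hp : p ∈ s) :
    p ∈ weightRegion m n ε :=
  Ultrahyperbolic.mem_weightRegion hs.eps_pos (hs.pos p hp) (hs.eps_mul_le p hp)

theorem sqrt_denom_bounds (hs : IsAdmissible ε R s) {p : Spacetime m n} (hp : p ∈ s) :
    99 / 100 ≤ √(denom ε p) ∧ √(denom ε p) ≤ 1 := by
  have hf := hs.pos p hp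
  have hD := (hs.mem_weightRegion hp).2
  exact (exterior_bounds (τ := tau p) hs.eps_pos (rad_pos hf) (Real.sqrt_pos.2 hf)
    (Real.sqrt_pos.2 hD) (by rw [Real.sq_sqrt hf.le, four_mul_fFun])
    (by rw [Real.sq_sqrt hf.le, Real.sq_sqrt hD.le, denom])
    (hs.eps_mul_le p hp)).2

theorem bdd_sqrt_denom (hs : IsAdmissible ε R s) : BddOn s fun p => √(denom ε p) :=
  ⟨1, fun p hp => by
    rw [Real.norm_of_nonneg (Real.sqrt_nonneg _)]; exact (hs.sqrt_denom_bounds hp).2⟩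

theorem bdd_denom (hs : IsAdmissible ε R s) : BddOn s (denom ε) :=
  (hs.bdd_sqrt_denom.pow 2).congr fun _ hp => (Real.sq_sqrt (hs.mem_weightRegion hp).2.le).symm

theorem bdd_inv_sqrt_denom (hs : IsAdmissible ε R s) : BddOn s fun p => (√(denom ε p))⁻¹ := by
  refine ⟨(99 / 100)⁻¹, fun p hp => ?_⟩
  rw [Real.norm_of_nonneg (inv_nonneg.2 (Real.sqrt_nonneg _))]
  exact inv_anti₀ (by norm_num) (hs.sqrt_denom_bounds hp).1

/-- The coefficient `Γ` is of size `1 / f` near the null cone. -/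
theorem bdd_fFun_mul_gam (hs : IsAdmissible ε R s) : BddOn s fun p => fFun p * gam a b ε p :=
  (((BddOn.const a).mul (hs.bdd_inv_sqrt_denom.pow 2)).add
    (((BddOn.const (a * b)).mul hs.bdd_sqrt_fFun).mul (hs.bdd_inv_sqrt_denom.pow 3))).congr
      fun p hp => by
    have hm := hs.mem_weightRegion hp
    have hφ := Real.sqrt_pos.2 hm.1
    rw [gam_eq hm.1 hm.2]
    nth_rw 1 [← Real.sq_sqrt hm.1.le]
    field_simp

theorem bdd_multField (hs : IsAdmissible ε R s) : BddOn s (multField ε) :=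
  (((BddOn.const (1 / 2 : ℝ)).mul ((BddOn.const 1).sub ((BddOn.const ε).mul hs.bdd_rad))).smul
    hs.bdd_id).add (((BddOn.const ε).mul hs.bdd_fFun).smul (bdd_dRad s))

theorem bdd_multWeight (hs : IsAdmissible ε R s) : BddOn s (multWeight ε) :=
  ((BddOn.const _).mul ((BddOn.const 1).sub ((BddOn.const ε).mul hs.bdd_rad))).add
    ((BddOn.const _).mul hs.bdd_fFun_div_rad)

theorem bdd_multWeightGrad (hs : IsAdmissible ε R s) : BddOn s (multWeightGrad ε) :=
  ((((BddOn.const _).sub ((BddOn.const _).mul hs.bdd_fFun_div_rad_sq)).smul (bdd_dRad s)).add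
    ((BddOn.const (1 / 4 * ε * ((n : ℝ) - 2))).smul hs.bdd_inv_rad_smul)).congr fun p _ => by
      rw [multWeightGrad, smul_smul]

theorem bdd_fFun_mul_potential (hs : IsAdmissible ε R s) :
    BddOn s fun p => fFun p * potential a b ε p :=
  ((((hs.bdd_fFun_mul_gam (a := a) (b := b)).pow 2).mul hs.bdd_denom).sub
    (((BddOn.const (1 / 2 * (a * b))).mul hs.bdd_sqrt_fFun).mul (hs.bdd_inv_sqrt_denom.pow 3))
      |>.sub (((BddOn.const ε).mul hs.bdd_fFun_div_rad).mul
        (hs.bdd_fFun_mul_gam (a := a) (b := b)))).congr fun p hp => by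
    have hφ := Real.sqrt_pos.2 (hs.pos p hp)
    have h1 : fFun p * (√(fFun p))⁻¹ = √(fFun p) := by
      nth_rw 1 [← Real.sq_sqrt (hs.pos p hp).le]
      field_simp
    rw [potential]
    linear_combination -(1 / 2 * (a * b) * (√(denom ε p))⁻¹ ^ 3) * h1

variable {c : Spacetime m n → ℝ} {ℓ : Spacetime m n → Spacetime m n →L[ℝ] ℝ}

theorem bdd_conjGrad (hs : IsAdmissible ε R s) (hc : BddOn s c) (hl : BddOn s ℓ) :
    BddOn s fun p => fFun p • conjGrad a b ε (c p) (ℓ p) p :=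
  ((hs.bdd_fFun.smul (hl.comp_clm sharp)).add
    ((hc.mul (hs.bdd_fFun_mul_gam (a := a) (b := b))).smul hs.bdd_multField)).congr fun p _ => by
      rw [conjGrad]; module

theorem bdd_reducedCurrent (hs : IsAdmissible ε R s) (hc : BddOn s c) (hl : BddOn s ℓ) :
    BddOn s fun p => fFun p ^ 2 • reducedCurrent a b ε (c p) (ℓ p) p := by
  have hG := hs.bdd_conjGrad (a := a) (b := b) hc hl
  have hf := hs.bdd_fFun
  have hS := hs.bdd_multField
  refine ((((((hG.metric hS).smul hG).sub (((BddOn.const (1 / 2 : ℝ)).mul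
    (hG.metric hG)).smul hS)).add (((hf.mul hs.bdd_multWeight).mul hc).smul hG)).sub
      (((BddOn.const (1 / 2 : ℝ)).mul ((hf.pow 2).mul (hc.pow 2))).smul hs.bdd_multWeightGrad)).add
        ((((BddOn.const (1 / 2 : ℝ)).mul hf).mul ((hs.bdd_fFun_mul_potential (a := a) (b := b)).mul
          (hc.pow 2))).smul hS)).congr fun p _ => ?_
  rw [reducedCurrent]
  simp only [metric_smul_left, metric_smul_right]
  module

/-- The weight vanishes to high order on the null cone. -/
theorem weightRoot_sq_le (hs : IsAdmissible ε R s) (ha : 4 ≤ a) (hb : 0 < b) :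
    ∃ C, ∀ p ∈ s, weightRoot a b ε p ^ 2 ≤ C * fFun p ^ 4 := by
  obtain ⟨C₁, h₁⟩ := hs.bdd_fFun
  obtain ⟨C₂, h₂⟩ := hs.bdd_sqrt_fFun.mul hs.bdd_inv_sqrt_denom
  refine ⟨Real.exp ((2 * a - 4) * C₁ + 2 * a * (1 + 2 * b * C₂)), fun p hp => ?_⟩
  have hm := hs.mem_weightRegion hp
  have e1 : fFun p ^ 4 = Real.exp (4 * Real.log (fFun p)) := by
    rw [mul_comm, Real.exp_mul, Real.exp_log hm.1]
    norm_cast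
  rw [e1, ← Real.exp_add, weightRoot, ← Real.exp_nat_mul, Real.exp_le_exp]
  have k1 : Real.log (fFun p) ≤ C₁ :=
    (Real.log_le_sub_one_of_pos hm.1).trans (by
      linarith [(le_abs_self (fFun p)).trans (h₁ p hp)])
  have k2 : -Real.log (denom ε p) ≤ 1 := by
    rw [← Real.log_inv]
    refine (Real.log_le_sub_one_of_pos (inv_pos.2 hm.2)).trans ?_
    have : (denom ε p)⁻¹ ≤ 2 := by
      rw [inv_le_comm₀ hm.2 two_pos, ← Real.sq_sqrt hm.2.le]
      nlinarith [(hs.sqrt_denom_bounds hp).1]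
    linarith
  have k3 : √(fFun p) / √(denom ε p) ≤ C₂ := (le_abs_self _).trans (h₂ p hp)
  have k4 : (2 * a - 4) * Real.log (fFun p) ≤ (2 * a - 4) * C₁ := by gcongr; linarith
  have k5 : 2 * a * (-Real.log (denom ε p) + 2 * b * (√(fFun p) / √(denom ε p))) ≤
      2 * a * (1 + 2 * b * C₂) := by gcongr
  push_cast
  linarith

theorem bdd_weight (hs : IsAdmissible ε R s) (ha : 4 ≤ a) (hb : 0 < b) :
    BddOn s fun p => weightRoot a b ε p ^ 2 * (fFun p)⁻¹ ^ 4 := by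
  obtain ⟨C, hC⟩ := hs.weightRoot_sq_le ha hb
  refine ⟨C, fun p hp => ?_⟩
  have hf := hs.pos p hp
  beta_reduce
  rw [Real.norm_of_nonneg (by positivity), inv_pow, ← div_eq_mul_inv, div_le_iff₀ (by positivity)]
  exact hC p hp

/-- The current vanishes to second order on the null cone. -/
theorem bdd_current (hs : IsAdmissible ε R s) (ha : 4 ≤ a) (hb : 0 < b) (hc : BddOn s c)
    (hl : BddOn s ℓ) : BddOn s fun p => (fFun p)⁻¹ ^ 2 • current a b ε (c p) (ℓ p) p :=
  ((hs.bdd_weight ha hb).smul (hs.bdd_reducedCurrent hc hl)).congr fun p hp => by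
    have hf := hs.pos p hp
    rw [current, smul_smul, smul_smul]
    congr 1
    field_simp

end IsAdmissible

end Ultrahyperbolic

namespace Ultrahyperbolic

variable {m n : ℕ} {a b ε R : ℝ} {s : Set (Spacetime m n)} {z : Spacetime m n → ℝ}

namespace IsAdmissible

theorem carlemanWeight_eq (hs : IsAdmissible ε R s) {p : Spacetime m n} (hp : p ∈ s) :
    carlemanWeight a b ε p = weightRoot a b ε p ^ 2 :=
  Ultrahyperbolic.carlemanWeight_eq hs.eps_pos (hs.pos p hp) (hs.eps_mul_le p hp)

theorem bdd_spaceAngular (hs : IsAdmissible ε R s) (hl : BddOn s (fderiv ℝ z)) :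
    BddOn s (spaceAngular z) :=
  ((hl.clm_apply ((hl.comp_clm sharp).comp_clm spaceVec)).sub
    ((hl.clm_apply (bdd_dRad s)).pow 2)).congr fun _ hp => spaceAngular_eq (rad_pos (hs.pos _ hp))

theorem bdd_timeAngular (hs : IsAdmissible ε R s) (hl : BddOn s (fderiv ℝ z)) :
    BddOn s (timeAngular z) :=
  ((((hl.clm_apply (hl.comp_clm sharp)).sub (hs.bdd_spaceAngular hl)).sub
    ((hl.clm_apply (bdd_dRad s)).pow 2)).add ((hl.clm_apply (bdd_dTau s)).pow 2)).congr
      fun _ hp => by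
        rw [fderiv_sharp_self (rad_pos (hs.pos _ hp))]; ring

theorem bdd_firstOrderDensity (hs : IsAdmissible ε R s) (ha : 4 ≤ a) (hb : 0 < b)
    (hl : BddOn s (fderiv ℝ z)) : BddOn s (firstOrderDensity a b ε z) := by
  have hu : BddOn s nullU := (BddOn.const (1 / 2 : ℝ)).mul (hs.bdd_tau.sub hs.bdd_rad) |>.congr
    fun p _ => by rw [nullU]; ring
  have hv : BddOn s nullV := (BddOn.const (1 / 2 : ℝ)).mul (hs.bdd_tau.add hs.bdd_rad) |>.congr
    fun p _ => by rw [nullV]; ring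
  have hdu : BddOn s dU := (bdd_dTau s).sub (bdd_dRad s)
  have hdv : BddOn s dV := (bdd_dTau s).add (bdd_dRad s)
  refine (((hs.bdd_weight ha hb).mul ((hs.bdd_fFun.pow 3).mul hs.bdd_fFun_div_rad)).mul
    (((((hu.mul (hl.clm_apply hdu)).pow 2).add ((hv.mul (hl.clm_apply hdv)).pow 2)).add
      (hs.bdd_fFun.mul (hs.bdd_spaceAngular hl))).sub
        (hs.bdd_fFun.mul (hs.bdd_timeAngular hl)))).congr fun p hp => ?_
  have hf := hs.pos p hp
  rw [firstOrderDensity, sq_abs, sq_abs, hs.carlemanWeight_eq hp]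
  congr 1
  field_simp

theorem bdd_zeroOrderDensity (hs : IsAdmissible ε R s) (ha : 4 ≤ a) (hb : 0 < b)
    (hc : BddOn s z) : BddOn s (zeroOrderDensity a b ε z) := by
  refine (((hs.bdd_weight ha hb).mul ((hs.bdd_fFun.pow 3).mul hs.bdd_sqrt_fFun)).mul
    (hc.pow 2)).congr fun p hp => ?_
  have hf := hs.pos p hp
  have hφ := Real.sqrt_pos.2 hf
  rw [zeroOrderDensity, hs.carlemanWeight_eq hp]
  congr 1
  rw [← Real.sq_sqrt hf.le, Real.sqrt_sq hφ.le]
  field_simp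

theorem bdd_fFun_mul_zeroCoef (hs : IsAdmissible ε R s) :
    BddOn s fun p => fFun p * zeroCoef a b ε (rad p) √(fFun p) √(denom ε p) := by
  have hφ := hs.bdd_sqrt_fFun
  have hδ := hs.bdd_sqrt_denom
  have hΔ := hs.bdd_inv_sqrt_denom
  have hq := hs.bdd_fFun_div_rad
  have h1 := hδ.add ((BddOn.const b).mul hφ)
  refine (((((BddOn.const (a ^ 2 * b / 2)).mul h1).mul (hφ.mul (hΔ.pow 4))).add
    (((BddOn.const (a ^ 2 * ε / 2)).mul (h1.pow 2)).mul (hq.mul (hΔ.pow 4)))).sub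
    (((BddOn.const (a * b / 2)).mul ((BddOn.const (1 / 4)).add
      ((BddOn.const (ε / 2)).mul hq))).mul (hφ.mul (hΔ.pow 3)))).sub
    ((BddOn.const (ε * a)).mul (((BddOn.const (1 / 4)).mul (hq.mul (hΔ.pow 2))).add
      (((BddOn.const (b / 2)).mul hφ).mul (hq.mul (hΔ.pow 3))))) |>.congr fun p hp => ?_
  have hm := hs.mem_weightRegion hp
  have hr := rad_pos hm.1
  have hδ0 := Real.sqrt_pos.2 hm.2
  have hφ0 := Real.sqrt_pos.2 hm.1
  have e1 : √(fFun p) ^ 2 = fFun p := Real.sq_sqrt hm.1.le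
  generalize √(denom ε p) = δ at *
  generalize √(fFun p) = φ at *
  rw [zeroCoef, ← e1]
  field_simp

/-- The divergence of the current is bounded up to the source density. -/
theorem abs_divergence_le (hs : IsAdmissible ε R s) (ha : 4 ≤ a) (hb : 0 < b) (hc : BddOn s z)
    (hl : BddOn s (fderiv ℝ z)) : ∃ C, ∀ p ∈ s, ContDiffAt ℝ 2 z p →
      |divergence (fun x => current a b ε (z x) (fderiv ℝ z x) x) p| ≤
        C + boxDensity a b ε z p := by
  have hf := hs.bdd_fFun
  have hg := hs.bdd_fFun_mul_gam (a := a) (b := b)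
  have hq := hs.bdd_fFun_div_rad
  have hr := hs.bdd_rad
  have hAx := hs.bdd_spaceAngular hl
  have hAt := hs.bdd_timeAngular hl
  have hεr := (BddOn.const (s := s) (1 : ℝ)).sub ((BddOn.const ε).mul hr)
  obtain ⟨yτ, hyτ⟩ : ∃ y : Spacetime m n → ℝ, ∀ p, y p = fderiv ℝ z p (dTau p)
    - z p * gam a b ε p * ((1 - ε * rad p) * tau p / 2) := ⟨_, fun _ => rfl⟩
  obtain ⟨yr, hyr⟩ : ∃ y : Spacetime m n → ℝ, ∀ p, y p = fderiv ℝ z p (dRad p)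
    + z p * gam a b ε p * ((1 - ε * rad p) * rad p / 2 + ε * fFun p) := ⟨_, fun _ => rfl⟩
  obtain ⟨σ, hσ⟩ : ∃ y : Spacetime m n → ℝ, ∀ p, y p = (1 - ε * rad p) / 2 *
    (tau p * yτ p + rad p * yr p) + ε * fFun p * yr p + multWeight ε p * z p :=
    ⟨_, fun _ => rfl⟩
  have bτ : BddOn s fun p => fFun p * yτ p :=
    ((hf.mul (hl.clm_apply (bdd_dTau s))).sub ((hc.mul hg).mul
      ((BddOn.const (1 / 2 : ℝ)).mul (hεr.mul hs.bdd_tau)))).congr fun p _ => by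
        rw [hyτ]; ring
  have br : BddOn s fun p => fFun p * yr p :=
    ((hf.mul (hl.clm_apply (bdd_dRad s))).add ((hc.mul hg).mul
      (((BddOn.const (1 / 2 : ℝ)).mul (hεr.mul hr)).add ((BddOn.const ε).mul hf)))).congr
        fun p _ => by rw [hyr]; ring
  have bσ : BddOn s fun p => fFun p * σ p :=
    ((((BddOn.const (1 / 2 : ℝ)).mul hεr).mul ((hs.bdd_tau.mul bτ).add (hr.mul br))).add
      (((BddOn.const ε).mul hf).mul br) |>.add ((hf.mul hs.bdd_multWeight).mul hc)).congr
        fun p _ => by rw [hσ]; ring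
  -- the part of the divergence that does not involve the source
  obtain ⟨T, hT⟩ : ∃ T : Spacetime m n → ℝ, ∀ p, T p = -(ε * fFun p / (2 * rad p) *
      (-yτ p ^ 2 + yr p ^ 2 + spaceAngular z p - -timeAngular z p))
    + ε * fFun p / rad p * spaceAngular z p + 2 * gam a b ε p * σ p ^ 2
    + (zeroCoef a b ε (rad p) √(fFun p) √(denom ε p)
      + ε / rad p * (((m : ℝ) + n - 2) / 8
        + ((n : ℝ) - 2) * (n - 3) * fFun p / (4 * rad p ^ 2))) * z p ^ 2 := ⟨_, fun _ => rfl⟩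
  have bT : BddOn s fun p => fFun p ^ 4 * T p := by
    refine ((((((BddOn.const (-(ε / 2))).mul hq).mul (hf.pow 2)).mul
      ((((br.pow 2).sub (bτ.pow 2)).add ((hf.pow 2).mul hAx)).add ((hf.pow 2).mul hAt))).add
      (((BddOn.const ε).mul hq).mul ((hf.pow 4).mul hAx))).add
      (((BddOn.const 2).mul (hf.mul hg)).mul (bσ.pow 2))).add
      (((hs.bdd_fFun_mul_zeroCoef (a := a) (b := b)).add (((BddOn.const ε).mul hq).mul
        ((BddOn.const (((m : ℝ) + n - 2) / 8)).add
          ((BddOn.const (((n : ℝ) - 2) * (n - 3) / 4)).mul hs.bdd_fFun_div_rad_sq)))).mul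
            ((hf.pow 3).mul (hc.pow 2))) |>.congr fun p hp => ?_
    have hr0 := rad_pos (hs.pos p hp)
    rw [hT]
    field_simp
    ring
  obtain ⟨C₁, h₁⟩ := (hs.bdd_weight ha hb).mul bT
  obtain ⟨C₂, h₂⟩ := (hs.bdd_weight ha hb).mul (hf.mul (bσ.pow 2))
  refine ⟨C₁ + C₂, fun p hp hzp => ?_⟩
  have hm := hs.mem_weightRegion hp
  have hf0 := hm.1
  have k1 := h₁ p hp
  have k2 := (le_abs_self _).trans (h₂ p hp)
  rw [divergence_weightedCurrent hm hzp (by exact_mod_cast contDiffAt_weightRoot (k := 2) hm)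
    (hyτ p) (hyr p) (hσ p), boxDensity, hs.carlemanWeight_eq hp, sq_abs]
  beta_reduce at k1 k2
  have e1 : weightRoot a b ε p ^ 2 * (fFun p)⁻¹ ^ 4 * (fFun p ^ 4 * T p) =
      weightRoot a b ε p ^ 2 * T p := by field_simp
  have e2 : weightRoot a b ε p ^ 2 * (fFun p)⁻¹ ^ 4 * (fFun p * (fFun p * σ p) ^ 2) =
      weightRoot a b ε p ^ 2 * (σ p ^ 2 / fFun p) := by field_simp
  rw [e1, Real.norm_eq_abs] at k1
  rw [e2] at k2
  have e3 : |box z p * σ p| ≤ fFun p * box z p ^ 2 + σ p ^ 2 / fFun p := by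
    have i1 : 0 ≤ (fFun p * |box z p| - |σ p|) ^ 2 / fFun p := by positivity
    have i2 : (fFun p * |box z p| - |σ p|) ^ 2 / fFun p =
        fFun p * box z p ^ 2 + σ p ^ 2 / fFun p - 2 * |box z p * σ p| := by
      rw [abs_mul, ← sq_abs (box z p), ← sq_abs (σ p)]
      field_simp
      ring
    linarith [abs_nonneg (box z p * σ p)]
  have hW : 0 ≤ weightRoot a b ε p ^ 2 := sq_nonneg _
  have e4 := mul_le_mul_of_nonneg_left e3 hW
  have e5 : |weightRoot a b ε p ^ 2 * (box z p * σ p)| =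
      weightRoot a b ε p ^ 2 * |box z p * σ p| := by rw [abs_mul, abs_of_nonneg hW]
  refine le_trans (le_of_eq ?_) ((abs_add_le (weightRoot a b ε p ^ 2 * (box z p * σ p))
    (weightRoot a b ε p ^ 2 * T p)).trans ?_)
  · rw [hT]
    congr 1
    ring
  · rw [e5]
    linarith

end IsAdmissible

end Ultrahyperbolic

namespace Ultrahyperbolic

variable {m n : ℕ} {a b ε R : ℝ} {U : Set (Spacetime m n)} {z : Spacetime m n → ℝ}
  {𝒩 : Spacetime m n → Spacetime m n}

/-! ### The current up to the boundary -/

theorem BddOn.mono {X F : Type*} [Norm F] {s t : Set X} {f : X → F} (hf : BddOn s f)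
    (hts : t ⊆ s) : BddOn t f := by
  obtain ⟨C, hC⟩ := hf
  exact ⟨C, fun x hx => hC x (hts hx)⟩

theorem bddOn_of_subset_compact {X F : Type*} [TopologicalSpace X] [NormedAddCommGroup F]
    {s K : Set X} {f : X → F} (hK : IsCompact K) (hf : ContinuousOn f K) (hs : s ⊆ K) :
    BddOn s f := by
  obtain ⟨C, hC⟩ := hK.exists_bound_of_continuousOn hf
  exact ⟨C, fun x hx => hC x (hs hx)⟩

/-- The hypotheses of the Carleman estimate: the domain `U` with its unit normal field `𝒩`, the
parameters, and the function `z`. -/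
structure IsCarlemanData (U : Set (Spacetime m n)) (𝒩 : Spacetime m n → Spacetime m n)
    (a b ε R : ℝ) (z : Spacetime m n → ℝ) : Prop where
  one_le_left : 1 ≤ m
  one_le_right : 1 ≤ n
  isOpen : IsOpen U
  smooth : HasSmoothBoundary U
  normal : ∀ p ∈ frontier U, IsOuterUnitNormal U p (𝒩 p)
  rad_lt : U ∩ coneExterior m n ⊆ {p | rad p < R}
  R_pos : 0 < R
  eps_pos : 0 < ε
  b_pos : 0 < b
  sq_le_a : ((m : ℝ) + n) ^ 2 ≤ a
  eps_le : ε ≤ b / 100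
  b_le : b ≤ R⁻¹
  contDiffOn : ContDiffOn ℝ 2 z U
  contDiffOn_closure : ContDiffOn ℝ 1 z (closure U)
  zero : ∀ p ∈ frontier U ∩ coneExterior m n, z p = 0

/-- The weighted current of `z`, with the differential of `z` taken from within `closure U`. -/
noncomputable def currentField (U : Set (Spacetime m n)) (a b ε : ℝ) (z : Spacetime m n → ℝ)
    (p : Spacetime m n) : Spacetime m n := current a b ε (z p) (fderivWithin ℝ z (closure U) p) p

namespace IsCarlemanData

theorem nonempty_index (h : IsCarlemanData U 𝒩 a b ε R z) : Nonempty (Fin m ⊕ Fin n) :=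
  ⟨Sum.inl ⟨0, h.one_le_left⟩⟩

theorem four_le_a (h : IsCarlemanData U 𝒩 a b ε R z) : 4 ≤ a := by
  have hm' : (1 : ℝ) ≤ m := by exact_mod_cast h.one_le_left
  have hn' : (1 : ℝ) ≤ n := by exact_mod_cast h.one_le_right
  nlinarith [h.sq_le_a]

theorem rad_le (h : IsCarlemanData U 𝒩 a b ε R z) {p : Spacetime m n}
    (hp : p ∈ closure U ∩ coneExterior m n) : rad p ≤ R := by
  have h1 : p ∈ closure (U ∩ coneExterior m n) := by
    rw [inter_comm] at hp ⊢
    exact isOpen_coneExterior.inter_closure hp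
  have h2 : closure (U ∩ coneExterior m n) ⊆ {q | rad q ≤ R} :=
    closure_minimal (fun q hq => le_of_lt (show rad q < R from h.rad_lt hq)) (isClosed_le continuous_rad continuous_const)
  exact h2 h1

theorem b_mul_le (h : IsCarlemanData U 𝒩 a b ε R z) {p : Spacetime m n}
    (hp : p ∈ closure U ∩ coneExterior m n) : b * rad p ≤ 1 := by
  have h1 : b * rad p ≤ R⁻¹ * R :=
    mul_le_mul h.b_le (h.rad_le hp) (rad_nonneg p) (inv_nonneg.2 h.R_pos.le)
  rwa [inv_mul_cancel₀ h.R_pos.ne'] at h1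

theorem isAdmissible (h : IsCarlemanData U 𝒩 a b ε R z) :
    IsAdmissible ε R (closure U ∩ coneExterior m n) where
  eps_pos := h.eps_pos
  pos p hp := hp.2
  rad_le p hp := h.rad_le hp
  eps_mul_le p hp := by
    have h1 := h.b_mul_le hp
    have h2 : ε * rad p ≤ b / 100 * rad p := mul_le_mul_of_nonneg_right h.eps_le (rad_nonneg p)
    linarith

theorem inter_subset (h : IsCarlemanData U 𝒩 a b ε R z) :
    closure U ∩ coneExterior m n ⊆ closure U ∩ Metric.closedBall 0 (2 * R) := fun p hp => by
  refine ⟨hp.1, ?_⟩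
  rw [mem_closedBall_zero_iff]
  exact (norm_le_of_rad_le (le_of_lt hp.2)).trans (by linarith [h.rad_le hp])

theorem isCompact (U : Set (Spacetime m n)) (r : ℝ) :
    IsCompact (closure U ∩ Metric.closedBall 0 r) :=
  (isCompact_closedBall 0 r).inter_left isClosed_closure

theorem continuousOn_fderivWithin (h : IsCarlemanData U 𝒩 a b ε R z) :
    ContinuousOn (fderivWithin ℝ z (closure U)) (closure U) :=
  h.contDiffOn_closure.continuousOn_fderivWithin (uniqueDiffOn_closure h.isOpen h.smooth)
    (by norm_num)

theorem bdd_z (h : IsCarlemanData U 𝒩 a b ε R z) : BddOn (closure U ∩ coneExterior m n) z :=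
  bddOn_of_subset_compact (isCompact U (2 * R))
    (h.contDiffOn_closure.continuousOn.mono inter_subset_left) h.inter_subset

theorem bdd_fderivWithin (h : IsCarlemanData U 𝒩 a b ε R z) :
    BddOn (closure U ∩ coneExterior m n) (fderivWithin ℝ z (closure U)) :=
  bddOn_of_subset_compact (isCompact U (2 * R))
    (h.continuousOn_fderivWithin.mono inter_subset_left) h.inter_subset

theorem fderivWithin_eq (h : IsCarlemanData U 𝒩 a b ε R z) {p : Spacetime m n} (hp : p ∈ U) :
    fderivWithin ℝ z (closure U) p = fderiv ℝ z p :=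
  fderivWithin_of_mem_nhds (mem_of_superset (h.isOpen.mem_nhds hp) subset_closure)

theorem interior_subset (U : Set (Spacetime m n)) :
    U ∩ coneExterior m n ⊆ closure U ∩ coneExterior m n :=
  inter_subset_inter_left _ subset_closure

theorem isAdmissible_interior (h : IsCarlemanData U 𝒩 a b ε R z) :
    IsAdmissible ε R (U ∩ coneExterior m n) where
  eps_pos := h.eps_pos
  pos _ hp := hp.2
  rad_le _ hp := h.rad_le (interior_subset U hp)
  eps_mul_le p hp := h.isAdmissible.eps_mul_le p (interior_subset U hp)

theorem bdd_fderiv (h : IsCarlemanData U 𝒩 a b ε R z) :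
    BddOn (U ∩ coneExterior m n) (fderiv ℝ z) :=
  (h.bdd_fderivWithin.mono (interior_subset U)).congr fun _ hp => (h.fderivWithin_eq hp.1).symm

theorem contDiffAt (h : IsCarlemanData U 𝒩 a b ε R z) {p : Spacetime m n} (hp : p ∈ U) :
    ContDiffAt ℝ 2 z p := h.contDiffOn.contDiffAt (h.isOpen.mem_nhds hp)

theorem isOpen_interior (h : IsCarlemanData U 𝒩 a b ε R z) : IsOpen (U ∩ coneExterior m n) :=
  h.isOpen.inter isOpen_coneExterior

theorem volume_lt_top (h : IsCarlemanData U 𝒩 a b ε R z) :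
    volume (U ∩ coneExterior m n) < ⊤ :=
  (measure_mono (((interior_subset U).trans h.inter_subset).trans inter_subset_right)).trans_lt
    (isCompact_closedBall _ _).measure_lt_top

/-- A measurable function that is bounded on the domain is integrable there. -/
theorem integrableOn_of_bddOn (h : IsCarlemanData U 𝒩 a b ε R z) {g : Spacetime m n → ℝ}
    (hg : AEStronglyMeasurable g (volume.restrict (U ∩ coneExterior m n)))
    (hb : BddOn (U ∩ coneExterior m n) g) : IntegrableOn g (U ∩ coneExterior m n) := by
  obtain ⟨C, hC⟩ := hb
  refine ⟨hg, HasFiniteIntegral.restrict_of_bounded (C := C) h.volume_lt_top ?_⟩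
  exact (ae_restrict_iff' h.isOpen_interior.measurableSet).2 (Eventually.of_forall hC)

theorem contDiffOn_currentField (h : IsCarlemanData U 𝒩 a b ε R z) :
    ContDiffOn ℝ 1 (currentField U a b ε z) (U ∩ coneExterior m n) := by
  intro p hp
  have hm := h.isAdmissible_interior.mem_weightRegion hp
  have hz := h.contDiffAt hp.1
  have hd : ContDiffAt ℝ 1 (fderivWithin ℝ z (closure U)) p := by
    refine (hz.fderiv_right (m := 1) (by norm_num)).congr_of_eventuallyEq ?_
    filter_upwards [h.isOpen.mem_nhds hp.1] with x hx using h.fderivWithin_eq hx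
  exact (contDiffAt_current (k := 1) (x := fun x => x) hm (hz.of_le (by norm_num)) hd
    contDiffAt_id).contDiffWithinAt

theorem continuousOn_currentField (h : IsCarlemanData U 𝒩 a b ε R z) :
    ContinuousOn (currentField U a b ε z) (closure U ∩ coneExterior m n) := by
  intro p hp
  have hm := h.isAdmissible.mem_weightRegion hp
  have h1 := (contDiffAt_current (a := a) (b := b) (k := 0)
    (c := fun q : ℝ × (Spacetime m n →L[ℝ] ℝ) × Spacetime m n => q.1)
    (ℓ := fun q => q.2.1) (x := fun q => q.2.2)
    (q := (z p, fderivWithin ℝ z (closure U) p, p)) hm contDiffAt_fst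
    contDiffAt_snd.fst contDiffAt_snd.snd).continuousAt
  have h2 : ContinuousWithinAt (fun x => (z x, fderivWithin ℝ z (closure U) x, x))
      (closure U ∩ coneExterior m n) p :=
    ((h.contDiffOn_closure.continuousOn p hp.1).mono inter_subset_left).prodMk
      (((h.continuousOn_fderivWithin p hp.1).mono inter_subset_left).prodMk
        continuousWithinAt_id)
  exact ContinuousAt.comp_continuousWithinAt
    (f := fun x => (z x, fderivWithin ℝ z (closure U) x, x)) h1 h2

theorem bdd_currentField (h : IsCarlemanData U 𝒩 a b ε R z) :
    BddOn (closure U ∩ coneExterior m n) fun p =>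
      (fFun p)⁻¹ ^ 2 • currentField U a b ε z p :=
  h.isAdmissible.bdd_current h.four_le_a h.b_pos h.bdd_z h.bdd_fderivWithin

theorem divergence_currentField (h : IsCarlemanData U 𝒩 a b ε R z) {p : Spacetime m n}
    (hp : p ∈ U) : divergence (currentField U a b ε z) p =
      divergence (fun x => current a b ε (z x) (fderiv ℝ z x) x) p := by
  refine divergence_congr ?_
  filter_upwards [h.isOpen.mem_nhds hp] with x hx
  rw [currentField, h.fderivWithin_eq hx]

/-- Where `z` vanishes on the boundary, the flux of the current is half the boundary density. -/
theorem metric_currentField (h : IsCarlemanData U 𝒩 a b ε R z) {p : Spacetime m n}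
    (hp : p ∈ frontier U ∩ coneExterior m n) :
    metric (𝒩 p) (currentField U a b ε z p) = 1 / 2 * boundaryDensity a b ε U 𝒩 z p := by
  have hpc : p ∈ closure U := frontier_subset_closure hp.1
  have hr := rad_pos hp.2
  have hN := h.normal p hp.1
  obtain ⟨φ, hφ⟩ := h.smooth p hp.1
  have hd := hN.fderivWithin_eq h.isOpen hφ isOpen_coneExterior hp.2
    (h.contDiffOn_closure.differentiableOn (by norm_num) p hpc) h.zero
  obtain ⟨κ, hκ⟩ : ∃ κ, κ = fderivWithin ℝ z (closure U) p (𝒩 p) := ⟨_, rfl⟩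
  have hs : sharp (fderivWithin ℝ z (closure U) p) = κ • 𝒩 p := sharp_eq fun Y => by
    rw [hd, metric_smul_left, hκ]
  have hG : conjGrad a b ε (z p) (fderivWithin ℝ z (closure U) p) p = κ • 𝒩 p := by
    rw [conjGrad, h.zero p hp, hs]; simp
  have hf : fderiv ℝ fFun p (𝒩 p) = 1 / 2 * metric p (𝒩 p) := by
    rw [(hasFDerivAt_fFun p).fderiv, flat_apply, metric_smul_left]
  have hrd : fderiv ℝ rad p (𝒩 p) = metric (dRad p) (𝒩 p) := by
    rw [(hasFDerivAt_rad hr).fderiv, flat_apply]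
  rw [currentField, current, reducedCurrent, hG, h.zero p hp, boundaryDensity,
    h.isAdmissible.carlemanWeight_eq ⟨hpc, hp.2⟩, hf, hrd, ← hκ, sq_abs]
  have hu := hN.unit
  have hS : metric (𝒩 p) (multField ε p) = (1 - ε * rad p) * (1 / 2 * metric p (𝒩 p))
      + ε * fFun p * metric (dRad p) (𝒩 p) := by
    rw [metric_comm, metric_multField]; ring
  simp only [metric_smul_right, metric_add_right, sub_eq_add_neg, ← neg_smul, metric_smul_left,
    hu, hS]
  ring

end IsCarlemanData

end Ultrahyperbolic

namespace Ultrahyperbolic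

variable {m n : ℕ} {a b ε R : ℝ} {U : Set (Spacetime m n)} {z : Spacetime m n → ℝ}
  {𝒩 : Spacetime m n → Spacetime m n}

/-! ### Integrability of the densities -/

theorem measurable_fderiv_apply {V : Spacetime m n → Spacetime m n} (hV : Measurable V) :
    Measurable fun p => fderiv ℝ z p (V p) :=
  ContinuousLinearMap.measurable_apply₂.comp ((measurable_fderiv ℝ z).prodMk hV)

theorem measurable_dRad : Measurable (dRad : Spacetime m n → Spacetime m n) := by
  have : (dRad : Spacetime m n → _) = fun x => (rad x)⁻¹ • spaceVec x := funext dRad_eq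
  rw [this]
  exact continuous_rad.measurable.inv.smul spaceVec.continuous.measurable

theorem measurable_dTau : Measurable (dTau : Spacetime m n → Spacetime m n) := by
  have : (dTau : Spacetime m n → _) = fun x => (tau x)⁻¹ • (x - spaceVec x) := by
    funext x
    ext α
    rcases α with i | k
    · simp [dTau, spaceVec_inl, div_eq_inv_mul]
    · simp [dTau, spaceVec_inr]
  rw [this]
  exact continuous_tau.measurable.inv.smul (measurable_id.sub spaceVec.continuous.measurable)

theorem measurable_carlemanWeight :
    Measurable (carlemanWeight a b ε : Spacetime m n → ℝ) := by
  have hf : Measurable (fFun : Spacetime m n → ℝ) := continuous_fFun.measurable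
  have hu : Measurable (nullU : Spacetime m n → ℝ) :=
    ((continuous_tau.sub continuous_rad).div_const 2).measurable
  have hv : Measurable (nullV : Spacetime m n → ℝ) :=
    ((continuous_tau.add continuous_rad).div_const 2).measurable
  unfold carlemanWeight
  fun_prop

namespace IsCarlemanData

theorem integrableOn_firstOrderDensity (h : IsCarlemanData U 𝒩 a b ε R z) :
    IntegrableOn (firstOrderDensity a b ε z) (U ∩ coneExterior m n) := by
  have hs := h.isAdmissible_interior
  refine h.integrableOn_of_bddOn ?_ (hs.bdd_firstOrderDensity h.four_le_a h.b_pos h.bdd_fderiv)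
  have hf : Measurable (fFun : Spacetime m n → ℝ) := continuous_fFun.measurable
  have hr : Measurable (rad : Spacetime m n → ℝ) := continuous_rad.measurable
  have ht : Measurable (tau : Spacetime m n → ℝ) := continuous_tau.measurable
  have hu : Measurable (nullU : Spacetime m n → ℝ) := (ht.sub hr).div_const 2
  have hv : Measurable (nullV : Spacetime m n → ℝ) := (ht.add hr).div_const 2
  have hdu : Measurable (dU : Spacetime m n → _) := measurable_dTau.sub measurable_dRad
  have hdv : Measurable (dV : Spacetime m n → _) := measurable_dTau.add measurable_dRad
  have hsh : Measurable fun p => sharp (fderiv ℝ z p) :=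
    sharp.continuous.measurable.comp (measurable_fderiv ℝ z)
  have h1 := measurable_fderiv_apply (z := z) hdu
  have h2 := measurable_fderiv_apply (z := z) hdv
  have h3 := measurable_fderiv_apply (z := z) (measurable_dRad (m := m) (n := n))
  have h4 := measurable_fderiv_apply (z := z) (measurable_dTau (m := m) (n := n))
  have h5 := measurable_fderiv_apply (z := z) hsh
  have h6 := measurable_fderiv_apply (z := z) (spaceVec.continuous.measurable.comp hsh)
  have hm : Measurable fun p => carlemanWeight a b ε p * (rad p)⁻¹ *
      ((nullU p * fderiv ℝ z p (dU p)) ^ 2 + (nullV p * fderiv ℝ z p (dV p)) ^ 2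
        + fFun p * (fderiv ℝ z p (spaceVec (sharp (fderiv ℝ z p))) - fderiv ℝ z p (dRad p) ^ 2)
        - fFun p * (fderiv ℝ z p (sharp (fderiv ℝ z p)) - (fderiv ℝ z p (spaceVec
          (sharp (fderiv ℝ z p))) - fderiv ℝ z p (dRad p) ^ 2) - fderiv ℝ z p (dRad p) ^ 2
          + fderiv ℝ z p (dTau p) ^ 2)) :=
    (measurable_carlemanWeight.mul hr.inv).mul
      ((((((hu.mul h1).pow_const 2).add ((hv.mul h2).pow_const 2))).add
        (hf.mul (h6.sub (h3.pow_const 2)))).sub (hf.mul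
          (((h5.sub (h6.sub (h3.pow_const 2))).sub (h3.pow_const 2)).add (h4.pow_const 2))))
  refine hm.aestronglyMeasurable.congr ?_
  refine (ae_restrict_iff' h.isOpen_interior.measurableSet).2 (Eventually.of_forall fun p hp => ?_)
  have hrp := rad_pos hp.2
  beta_reduce
  rw [firstOrderDensity, sq_abs, sq_abs, ← spaceAngular_eq hrp, fderiv_sharp_self hrp]
  ring

theorem integrableOn_zeroOrderDensity (h : IsCarlemanData U 𝒩 a b ε R z) :
    IntegrableOn (zeroOrderDensity a b ε z) (U ∩ coneExterior m n) := by
  have hs := h.isAdmissible_interior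
  refine h.integrableOn_of_bddOn ?_
    (hs.bdd_zeroOrderDensity h.four_le_a h.b_pos (h.bdd_z.mono (interior_subset U)))
  have hz : AEStronglyMeasurable z (volume.restrict (U ∩ coneExterior m n)) :=
    (h.contDiffOn.continuousOn.mono inter_subset_left).aestronglyMeasurable
      h.isOpen_interior.measurableSet
  have h1 : Measurable fun p : Spacetime m n => (√(fFun p))⁻¹ :=
    continuous_fFun.measurable.sqrt.inv
  exact (measurable_carlemanWeight.mul h1).aestronglyMeasurable.mul (hz.pow 2)

theorem inducedSurfaceMeasure_lt_top (h : IsCarlemanData U 𝒩 a b ε R z) :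
    inducedSurfaceMeasure 𝒩 (frontier U ∩ coneExterior m n) < ⊤ := by
  have := h.nonempty_index
  have hA : MeasurableSet (frontier U ∩ coneExterior m n) :=
    isClosed_frontier.measurableSet.inter isOpen_coneExterior.measurableSet
  rw [← Measure.restrict_apply_self, restrict_inducedSurfaceMeasure 𝒩 hA,
    withDensity_apply _ hA, Measure.restrict_restrict hA, inter_self]
  have h1 : ∫⁻ p in frontier U ∩ coneExterior m n, ENNReal.ofReal ‖𝒩 p‖⁻¹
      ∂(Measure.euclideanHausdorffMeasure (m + n - 1)) ≤
      ∫⁻ _ in frontier U ∩ coneExterior m n, 1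
        ∂(Measure.euclideanHausdorffMeasure (m + n - 1)) := by
    refine setLIntegral_mono' hA fun p hp => ?_
    rw [ENNReal.ofReal_le_one]
    exact inv_le_one_of_one_le₀ (h.normal p hp.1).one_le_norm
  refine h1.trans_lt ?_
  rw [setLIntegral_one]
  refine (measure_mono ?_).trans_lt (measure_frontier_inter_lt_top h.isOpen h.smooth h.normal
    (isCompact U (2 * R)))
  exact fun p hp => ⟨hp.1, h.inter_subset ⟨frontier_subset_closure hp.1, hp.2⟩⟩

theorem integrableOn_boundaryDensity (h : IsCarlemanData U 𝒩 a b ε R z) :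
    IntegrableOn (boundaryDensity a b ε U 𝒩 z) (frontier U ∩ coneExterior m n)
      (inducedSurfaceMeasure 𝒩) := by
  have hA : MeasurableSet (frontier U ∩ coneExterior m n) :=
    isClosed_frontier.measurableSet.inter isOpen_coneExterior.measurableSet
  have hsub : frontier U ∩ coneExterior m n ⊆ closure U ∩ coneExterior m n :=
    inter_subset_inter_left _ frontier_subset_closure
  have heq : ∀ p ∈ frontier U ∩ coneExterior m n, boundaryDensity a b ε U 𝒩 z p =
      2 * metric (𝒩 p) (currentField U a b ε z p) := fun p hp => by
    rw [h.metric_currentField hp]; ring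
  have hNc : ContinuousOn 𝒩 (frontier U) := continuousOn_normal h.isOpen h.smooth h.normal
  have hcont : ContinuousOn (boundaryDensity a b ε U 𝒩 z) (frontier U ∩ coneExterior m n) := by
    refine ContinuousOn.congr ?_ heq
    have h1 := h.continuousOn_currentField.mono hsub
    simp only [← flat_apply]
    exact continuousOn_const.mul ((flat.continuous.comp_continuousOn
      (hNc.mono inter_subset_left)).clm_apply h1)
  have hNb : BddOn (frontier U ∩ coneExterior m n) 𝒩 := by
    refine bddOn_of_subset_compact ((isCompact_closedBall 0 (2 * R)).inter_left isClosed_frontier)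
      (hNc.mono inter_subset_left) fun p hp => ⟨hp.1, (h.inter_subset (hsub hp)).2⟩
  have hb : BddOn (frontier U ∩ coneExterior m n) (boundaryDensity a b ε U 𝒩 z) := by
    refine (((BddOn.const 2).mul ((h.isAdmissible.bdd_fFun.mono hsub).pow 2)).mul
      (hNb.metric (h.bdd_currentField.mono hsub))).congr fun p hp => ?_
    have hf : 0 < fFun p := hp.2
    rw [heq p hp, metric_smul_right]
    field_simp
  obtain ⟨C, hC⟩ := hb
  refine ⟨hcont.aestronglyMeasurable hA, HasFiniteIntegral.restrict_of_bounded (C := C)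
    h.inducedSurfaceMeasure_lt_top ?_⟩
  exact (ae_restrict_iff' hA).2 (Eventually.of_forall hC)

theorem integrableOn_divergence (h : IsCarlemanData U 𝒩 a b ε R z)
    (hbox : IntegrableOn (boxDensity a b ε z) (U ∩ coneExterior m n)) :
    IntegrableOn (divergence (currentField U a b ε z)) (U ∩ coneExterior m n) := by
  have hc : ContinuousOn (divergence (currentField U a b ε z)) (U ∩ coneExterior m n) := by
    refine continuousOn_finsetSum _ fun α _ => ?_
    have h1 : ContDiffOn ℝ 1 (fun x => currentField U a b ε z x α) (U ∩ coneExterior m n) :=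
      (EuclideanSpace.proj α : Spacetime m n →L[ℝ] ℝ).contDiff.comp_contDiffOn
        h.contDiffOn_currentField
    exact (h1.continuousOn_fderiv_of_isOpen h.isOpen_interior (by norm_num)).clm_apply
      continuousOn_const
  obtain ⟨C, hC⟩ := h.isAdmissible_interior.abs_divergence_le h.four_le_a h.b_pos
    (h.bdd_z.mono (interior_subset U)) h.bdd_fderiv
  have hi : IntegrableOn (fun p => C + boxDensity a b ε z p) (U ∩ coneExterior m n) :=
    (integrableOn_const h.volume_lt_top.ne).add hbox
  refine Integrable.mono' hi (hc.aestronglyMeasurable h.isOpen_interior.measurableSet) ?_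
  refine (ae_restrict_iff' h.isOpen_interior.measurableSet).2 (Eventually.of_forall fun p hp => ?_)
  rw [h.divergence_currentField hp.1]
  exact hC p hp (h.contDiffAt hp.1)

end IsCarlemanData

end Ultrahyperbolic

namespace Ultrahyperbolic

/-! ### Cutting off near the null cone -/

/-- A smooth cutoff, equal to `0` below `δ` and to `1` above `2δ`. -/
noncomputable def cutoff (δ s : ℝ) : ℝ := Real.smoothTransition (s / δ - 1)

theorem contDiff_cutoff (δ : ℝ) : ContDiff ℝ 1 (cutoff δ) :=
  (Real.smoothTransition.contDiff (n := 1)).comp ((contDiff_id.div_const δ).sub contDiff_const)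

theorem cutoff_of_le {δ s : ℝ} (hδ : 0 < δ) (hs : s ≤ δ) : cutoff δ s = 0 := by
  refine Real.smoothTransition.zero_of_nonpos ?_
  rw [sub_nonpos, div_le_one hδ]
  exact hs

theorem cutoff_of_ge {δ s : ℝ} (hδ : 0 < δ) (hs : 2 * δ ≤ s) : cutoff δ s = 1 := by
  refine Real.smoothTransition.one_of_one_le ?_
  rw [le_sub_iff_add_le, le_div_iff₀ hδ]
  linarith

theorem cutoff_nonneg (δ s : ℝ) : 0 ≤ cutoff δ s := Real.smoothTransition.nonneg _

theorem cutoff_le_one (δ s : ℝ) : cutoff δ s ≤ 1 := Real.smoothTransition.le_one _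

/-- The derivative of the cutoff is of size `δ⁻¹` on `[δ, 2δ]` and zero elsewhere, so that it is
beaten by a factor that vanishes to second order. -/
theorem exists_abs_deriv_cutoff_mul_sq_le :
    ∃ M, 0 ≤ M ∧ ∀ δ > 0, ∀ s : ℝ, |deriv (cutoff δ) s| * s ^ 2 ≤ M * δ := by
  have hd : Continuous (deriv Real.smoothTransition) :=
    (Real.smoothTransition.contDiff (n := 1)).continuous_deriv (by norm_num)
  obtain ⟨M, hM⟩ := (isCompact_Icc (a := (0 : ℝ)) (b := 1)).exists_bound_of_continuousOn
    hd.continuousOn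
  have hM0 : 0 ≤ M := (norm_nonneg _).trans (hM 0 (by simp))
  refine ⟨4 * M, by positivity, fun δ hδ s => ?_⟩
  rcases lt_or_ge s δ with h1 | h1
  · have : cutoff δ =ᶠ[𝓝 s] fun _ => 0 :=
      (eventually_lt_nhds h1).mono fun x hx => cutoff_of_le hδ hx.le
    rw [this.deriv_eq, deriv_const, abs_zero, zero_mul]
    positivity
  rcases lt_or_ge (2 * δ) s with h2 | h2
  · have : cutoff δ =ᶠ[𝓝 s] fun _ => 1 :=
      (eventually_gt_nhds h2).mono fun x hx => cutoff_of_ge hδ hx.le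
    rw [this.deriv_eq, deriv_const, abs_zero, zero_mul]
    positivity
  have e1 : deriv (cutoff δ) s = deriv Real.smoothTransition (s / δ - 1) * (1 / δ) := by
    have h3 : HasDerivAt (fun x : ℝ => x / δ - 1) (1 / δ) s :=
      ((hasDerivAt_id s).div_const δ).sub_const 1
    have h4 := (((Real.smoothTransition.contDiff (n := 1)).differentiable
      (by norm_num)) (s / δ - 1)).hasDerivAt
    exact (h4.comp s h3).deriv
  have e2 : |deriv Real.smoothTransition (s / δ - 1)| ≤ M := by
    refine hM _ ⟨?_, ?_⟩
    · rw [sub_nonneg, le_div_iff₀ hδ]; linarith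
    · rw [sub_le_iff_le_add, div_le_iff₀ hδ]; linarith
  rw [e1, abs_mul, abs_of_pos (by positivity : 0 < 1 / δ)]
  calc |deriv Real.smoothTransition (s / δ - 1)| * (1 / δ) * s ^ 2
      ≤ M * (1 / δ) * (2 * δ) ^ 2 := by
        have : 0 ≤ s := by linarith
        gcongr
    _ = 4 * M * δ := by field_simp; ring

variable {m n : ℕ} {a b ε R δ : ℝ} {U : Set (Spacetime m n)} {z : Spacetime m n → ℝ}
  {𝒩 : Spacetime m n → Spacetime m n}

open Classical in
/-- The current cut off near the null cone and extended by zero outside `closure U`. -/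
noncomputable def cutField (δ : ℝ) (U : Set (Spacetime m n)) (a b ε : ℝ) (z : Spacetime m n → ℝ)
    (p : Spacetime m n) : Spacetime m n :=
  if p ∈ closure U then cutoff δ (fFun p) • currentField U a b ε z p else 0

theorem cutField_of_mem {p : Spacetime m n} (hp : p ∈ closure U) :
    cutField δ U a b ε z p = cutoff δ (fFun p) • currentField U a b ε z p := by
  rw [cutField, if_pos hp]

theorem cutField_of_le (hδ : 0 < δ) {p : Spacetime m n} (hp : fFun p ≤ δ) :
    cutField δ U a b ε z p = 0 := by
  rw [cutField, cutoff_of_le hδ hp, zero_smul, ite_self]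

theorem cutField_eventuallyEq_zero (hδ : 0 < δ) {p : Spacetime m n} (hp : fFun p ≤ 0) :
    cutField δ U a b ε z =ᶠ[𝓝 p] fun _ => 0 := by
  have : ∀ᶠ x in 𝓝 p, fFun x < δ :=
    continuous_fFun.continuousAt.eventually_lt_const (hp.trans_lt hδ)
  exact this.mono fun x hx => cutField_of_le hδ hx.le

namespace IsCarlemanData

theorem cutField_eq_zero (h : IsCarlemanData U 𝒩 a b ε R z) (hδ : 0 < δ) {p : Spacetime m n}
    (hp : p ∉ Metric.closedBall 0 (2 * R)) : cutField δ U a b ε z p = 0 := by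
  by_cases h1 : p ∈ closure U
  · by_cases h2 : 0 < fFun p
    · exact absurd (h.inter_subset ⟨h1, h2⟩).2 hp
    · exact cutField_of_le hδ ((not_lt.1 h2).trans hδ.le)
  · rw [cutField, if_neg h1]

theorem continuousOn_cutField (h : IsCarlemanData U 𝒩 a b ε R z) (hδ : 0 < δ) :
    ContinuousOn (cutField δ U a b ε z) (closure U) := by
  intro p hp
  by_cases hf : 0 < fFun p
  · have h1 : ContinuousWithinAt (currentField U a b ε z) (closure U) p :=
      (continuousWithinAt_inter (isOpen_coneExterior.mem_nhds hf)).1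
        (h.continuousOn_currentField p ⟨hp, hf⟩)
    have h2 : ContinuousWithinAt (fun x => cutoff δ (fFun x)) (closure U) p :=
      ((contDiff_cutoff δ).continuous.comp continuous_fFun).continuousWithinAt
    exact (h2.smul h1).congr (fun x hx => cutField_of_mem hx) (cutField_of_mem hp)
  · exact ((continuousAt_const).congr
      (cutField_eventuallyEq_zero hδ (not_lt.1 hf)).symm).continuousWithinAt

theorem cutField_eventuallyEq (h : IsCarlemanData U 𝒩 a b ε R z) {p : Spacetime m n}
    (hp : p ∈ U) : cutField δ U a b ε z =ᶠ[𝓝 p]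
      fun x => cutoff δ (fFun x) • currentField U a b ε z x := by
  filter_upwards [h.isOpen.mem_nhds hp] with x hx using cutField_of_mem (subset_closure hx)

theorem contDiffOn_cutField (h : IsCarlemanData U 𝒩 a b ε R z) (hδ : 0 < δ) :
    ContDiffOn ℝ 1 (cutField δ U a b ε z) U := by
  intro p hp
  by_cases hf : 0 < fFun p
  · have h1 : ContDiffAt ℝ 1 (currentField U a b ε z) p :=
      h.contDiffOn_currentField.contDiffAt (h.isOpen_interior.mem_nhds ⟨hp, hf⟩)
    have h2 : ContDiffAt ℝ 1 (fun x : Spacetime m n => cutoff δ (fFun x)) p :=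
      ((contDiff_cutoff δ).comp (contDiff_fFun (k := 1))).contDiffAt
    exact ((h2.smul h1).congr_of_eventuallyEq (h.cutField_eventuallyEq hp)).contDiffWithinAt
  · exact (contDiffAt_const.congr_of_eventuallyEq
      (cutField_eventuallyEq_zero hδ (not_lt.1 hf))).contDiffWithinAt

/-- The divergence of the cut off current in the exterior of the null cone. -/
theorem divergence_cutField (h : IsCarlemanData U 𝒩 a b ε R z) {p : Spacetime m n}
    (hp : p ∈ U ∩ coneExterior m n) : divergence (cutField δ U a b ε z) p =
      cutoff δ (fFun p) * divergence (currentField U a b ε z) p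
        + deriv (cutoff δ) (fFun p) * (1 / 2 * metric p (currentField U a b ε z p)) := by
  have h1 : DifferentiableAt ℝ (currentField U a b ε z) p :=
    (h.contDiffOn_currentField.contDiffAt
      (h.isOpen_interior.mem_nhds hp)).differentiableAt (by norm_num)
  have h2 : HasFDerivAt (fun x : Spacetime m n => cutoff δ (fFun x)) _ p :=
    ((((contDiff_cutoff δ).differentiable (by norm_num)) _).hasDerivAt).comp_hasFDerivAt p
      (hasFDerivAt_fFun p)
  rw [divergence_congr (h.cutField_eventuallyEq hp.1), divergence_smul h2.differentiableAt h1,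
    h2.fderiv, _root_.smul_apply, flat_apply, metric_smul_left, smul_eq_mul]

theorem divergence_cutField_eq_indicator (h : IsCarlemanData U 𝒩 a b ε R z) (hδ : 0 < δ)
    {p : Spacetime m n} (hp : p ∈ U) : divergence (cutField δ U a b ε z) p =
      (coneExterior m n).indicator (fun p =>
        cutoff δ (fFun p) * divergence (currentField U a b ε z) p
          + deriv (cutoff δ) (fFun p) * (1 / 2 * metric p (currentField U a b ε z p))) p := by
  by_cases hf : p ∈ coneExterior m n
  · rw [indicator_of_mem hf, h.divergence_cutField ⟨hp, hf⟩]
  · rw [indicator_of_notMem hf, divergence_congr (cutField_eventuallyEq_zero hδ (not_lt.1 hf))]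
    simp [divergence, partialDeriv]

/-- The contribution of the derivative of the cutoff is small. -/
theorem exists_abs_deriv_cutoff_mul_le (h : IsCarlemanData U 𝒩 a b ε R z) :
    ∃ M, 0 ≤ M ∧ ∀ δ > 0, ∀ p ∈ U ∩ coneExterior m n,
      |deriv (cutoff δ) (fFun p) * (1 / 2 * metric p (currentField U a b ε z p))| ≤ M * δ := by
  obtain ⟨M, hM0, hM⟩ := exists_abs_deriv_cutoff_mul_sq_le
  obtain ⟨C, hC⟩ := (BddOn.const (1 / 2 : ℝ)).mul
    (h.isAdmissible.bdd_id.metric h.bdd_currentField)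
  refine ⟨|C| * M, by positivity, fun δ hδ p hp => ?_⟩
  have hf : 0 < fFun p := hp.2
  have h1 := (hC p (interior_subset U hp)).trans (le_abs_self C)
  beta_reduce at h1
  have h2 : 1 / 2 * metric p (currentField U a b ε z p) = fFun p ^ 2 *
      (1 / 2 * metric p ((fFun p)⁻¹ ^ 2 • currentField U a b ε z p)) := by
    rw [metric_smul_right]; field_simp
  rw [h2, ← mul_assoc, abs_mul, abs_mul, abs_of_pos (by positivity : 0 < fFun p ^ 2)]
  calc _ ≤ M * δ * |C| := mul_le_mul (hM δ hδ _) h1 (abs_nonneg _) (by positivity)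
    _ = _ := by ring

theorem integrableOn_cut (h : IsCarlemanData U 𝒩 a b ε R z)
    (hbox : IntegrableOn (boxDensity a b ε z) (U ∩ coneExterior m n)) (hδ : 0 < δ) :
    IntegrableOn (fun p => cutoff δ (fFun p) * divergence (currentField U a b ε z) p
      + deriv (cutoff δ) (fFun p) * (1 / 2 * metric p (currentField U a b ε z p)))
        (U ∩ coneExterior m n) := by
  have hi := h.integrableOn_divergence hbox
  obtain ⟨M, -, hM⟩ := h.exists_abs_deriv_cutoff_mul_le
  refine Integrable.add ?_ (h.integrableOn_of_bddOn ?_ ⟨M * δ, hM δ hδ⟩)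
  · refine hi.bdd_mul (c := 1)
      ((contDiff_cutoff δ).continuous.comp continuous_fFun).aestronglyMeasurable
      (Eventually.of_forall fun p => ?_)
    rw [Real.norm_eq_abs, abs_of_nonneg (cutoff_nonneg _ _)]
    exact cutoff_le_one _ _
  · have h1 : Continuous fun p : Spacetime m n => deriv (cutoff δ) (fFun p) :=
      ((contDiff_cutoff δ).continuous_deriv (by norm_num)).comp continuous_fFun
    have h2 : ContinuousOn (fun p => 1 / 2 * metric p (currentField U a b ε z p))
        (U ∩ coneExterior m n) := by
      simp only [← flat_apply]
      exact continuousOn_const.mul (flat.continuous.continuousOn.clm_apply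
        h.contDiffOn_currentField.continuousOn)
    exact (h1.continuousOn.mul h2).aestronglyMeasurable h.isOpen_interior.measurableSet

/-- The divergence theorem for the cut off current. -/
theorem integral_cut (h : IsCarlemanData U 𝒩 a b ε R z)
    (hbox : IntegrableOn (boxDensity a b ε z) (U ∩ coneExterior m n)) (hδ : 0 < δ) :
    ∫ p in U ∩ coneExterior m n, (cutoff δ (fFun p) * divergence (currentField U a b ε z) p
      + deriv (cutoff δ) (fFun p) * (1 / 2 * metric p (currentField U a b ε z p))) =
    ∫ p in frontier U ∩ coneExterior m n,
      cutoff δ (fFun p) * (1 / 2 * boundaryDensity a b ε U 𝒩 z p)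
        ∂(inducedSurfaceMeasure 𝒩) := by
  have := h.nonempty_index
  have hD : MeasurableSet (coneExterior m n) := isOpen_coneExterior.measurableSet
  have hdiv : ∀ p ∈ U, ∑ α, partialDeriv α (fun x => cutField δ U a b ε z x α) p = _ :=
    fun p hp => h.divergence_cutField_eq_indicator hδ hp
  have hint : IntegrableOn
      (fun p => ∑ α, partialDeriv α (fun x => cutField δ U a b ε z x α) p) U := by
    refine IntegrableOn.congr_fun ?_ (fun p hp => (hdiv p hp).symm) h.isOpen.measurableSet
    rw [integrableOn_indicator_iff hD, inter_comm]
    exact h.integrableOn_cut hbox hδ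
  have key := integral_divergence h.isOpen h.smooth h.normal
    (Q := fun α x => cutField δ U a b ε z x α) (isCompact_closedBall 0 (2 * R))
    (fun α x hx => by rw [h.cutField_eq_zero hδ hx]; rfl)
    (fun α => (EuclideanSpace.proj α : Spacetime m n →L[ℝ] ℝ).continuous.comp_continuousOn
      (h.continuousOn_cutField hδ))
    (fun α => (EuclideanSpace.proj α : Spacetime m n →L[ℝ] ℝ).contDiff.comp_contDiffOn
      (h.contDiffOn_cutField hδ)) hint
  rw [setIntegral_congr_fun h.isOpen.measurableSet hdiv, setIntegral_indicator hD] at key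
  rw [key, ← setIntegral_indicator hD]
  refine setIntegral_congr_fun isClosed_frontier.measurableSet fun p hp => ?_
  change metric (𝒩 p) (cutField δ U a b ε z p) = _
  by_cases hf : p ∈ coneExterior m n
  · rw [indicator_of_mem hf, cutField_of_mem (frontier_subset_closure hp), metric_smul_right,
      h.metric_currentField ⟨hp, hf⟩]
  · rw [indicator_of_notMem hf, cutField_of_le hδ ((not_lt.1 hf).trans hδ.le)]
    simp [metric]

/-- The divergence theorem for the current: no boundary term arises on the null cone. -/
theorem integral_divergence_currentField (h : IsCarlemanData U 𝒩 a b ε R z)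
    (hbox : IntegrableOn (boxDensity a b ε z) (U ∩ coneExterior m n)) :
    ∫ p in U ∩ coneExterior m n, divergence (currentField U a b ε z) p =
      1 / 2 * ∫ p in frontier U ∩ coneExterior m n, boundaryDensity a b ε U 𝒩 z p
        ∂(inducedSurfaceMeasure 𝒩) := by
  have hA : MeasurableSet (frontier U ∩ coneExterior m n) :=
    isClosed_frontier.measurableSet.inter isOpen_coneExterior.measurableSet
  obtain ⟨M, hM0, hM⟩ := h.exists_abs_deriv_cutoff_mul_le
  obtain ⟨δ, hδ⟩ : ∃ δ : ℕ → ℝ, ∀ k, δ k = 1 / ((k : ℝ) + 1) := ⟨_, fun _ => rfl⟩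
  have hδ0 : ∀ k, 0 < δ k := fun k => by rw [hδ]; positivity
  have hδ1 : ∀ k, δ k ≤ 1 := fun k => by
    rw [hδ, div_le_one (by positivity)]; linarith [Nat.cast_nonneg (α := ℝ) k]
  have hδt : Tendsto δ atTop (𝓝 0) := by
    rw [funext hδ]; exact tendsto_one_div_add_atTop_nhds_zero_nat
  have hcut : ∀ p : Spacetime m n, 0 < fFun p →
      Tendsto (fun k => cutoff (δ k) (fFun p)) atTop (𝓝 1) := fun p hp => by
    refine tendsto_const_nhds.congr' ?_
    have : ∀ᶠ k in atTop, δ k < fFun p / 2 := hδt.eventually_lt_const (by positivity)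
    exact this.mono fun k hk => (cutoff_of_ge (hδ0 k) (by linarith)).symm
  have hL : Tendsto (fun k => ∫ p in U ∩ coneExterior m n,
      (cutoff (δ k) (fFun p) * divergence (currentField U a b ε z) p
        + deriv (cutoff (δ k)) (fFun p) * (1 / 2 * metric p (currentField U a b ε z p))))
      atTop (𝓝 (∫ p in U ∩ coneExterior m n, divergence (currentField U a b ε z) p)) := by
    refine tendsto_integral_of_dominated_convergence
      (fun p => |divergence (currentField U a b ε z) p| + M)
      (fun k => (h.integrableOn_cut hbox (hδ0 k)).aestronglyMeasurable)
      ((h.integrableOn_divergence hbox).abs.add (integrableOn_const h.volume_lt_top.ne))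
      (fun k => ?_) ?_
    · refine (ae_restrict_iff' h.isOpen_interior.measurableSet).2
        (Eventually.of_forall fun p hp => ?_)
      refine (norm_add_le _ _).trans (add_le_add ?_ ?_)
      · rw [norm_mul, Real.norm_eq_abs, Real.norm_eq_abs, abs_of_nonneg (cutoff_nonneg _ _)]
        exact mul_le_of_le_one_left (abs_nonneg _) (cutoff_le_one _ _)
      · exact (hM _ (hδ0 k) p hp).trans (mul_le_of_le_one_right hM0 (hδ1 k))
    · refine (ae_restrict_iff' h.isOpen_interior.measurableSet).2
        (Eventually.of_forall fun p hp => ?_)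
      have h1 := (hcut p hp.2).mul_const (divergence (currentField U a b ε z) p)
      have h2 : Tendsto (fun k => deriv (cutoff (δ k)) (fFun p) *
          (1 / 2 * metric p (currentField U a b ε z p))) atTop (𝓝 0) := by
        refine squeeze_zero_norm (fun k => hM _ (hδ0 k) p hp) ?_
        simpa using hδt.const_mul M
      simpa using h1.add h2
  have hB := h.integrableOn_boundaryDensity
  have hR : Tendsto (fun k => ∫ p in frontier U ∩ coneExterior m n,
      cutoff (δ k) (fFun p) * (1 / 2 * boundaryDensity a b ε U 𝒩 z p)
        ∂(inducedSurfaceMeasure 𝒩)) atTop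
      (𝓝 (∫ p in frontier U ∩ coneExterior m n, 1 / 2 * boundaryDensity a b ε U 𝒩 z p
        ∂(inducedSurfaceMeasure 𝒩))) := by
    refine tendsto_integral_of_dominated_convergence
      (fun p => |1 / 2 * boundaryDensity a b ε U 𝒩 z p|)
      (fun k => ?_) (hB.const_mul _).abs (fun k => Eventually.of_forall fun p => ?_) ?_
    · exact ((contDiff_cutoff _).continuous.comp continuous_fFun).aestronglyMeasurable.mul
        (hB.const_mul _).aestronglyMeasurable
    · rw [norm_mul, Real.norm_eq_abs, Real.norm_eq_abs, abs_of_nonneg (cutoff_nonneg _ _)]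
      exact mul_le_of_le_one_left (abs_nonneg _) (cutoff_le_one _ _)
    · refine (ae_restrict_iff' hA).2 (Eventually.of_forall fun p hp => ?_)
      simpa using (hcut p hp.2).mul_const (1 / 2 * boundaryDensity a b ε U 𝒩 z p)
  rw [← integral_const_mul]
  refine tendsto_nhds_unique hL (hR.congr fun k => ?_)
  exact (h.integral_cut hbox (hδ0 k)).symm

/-- The Carleman estimate under the bundled hypotheses. -/
theorem estimate (h : IsCarlemanData U 𝒩 a b ε R z)
    (hbox : IntegrableOn (boxDensity a b ε z) (U ∩ coneExterior m n)) :
    1 / 4 * ε * (∫ p in U ∩ coneExterior m n, firstOrderDensity a b ε z p)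
        + 1 / 4 * b * a ^ 2 * (∫ p in U ∩ coneExterior m n, zeroOrderDensity a b ε z p) ≤
      1 / a * (∫ p in U ∩ coneExterior m n, boxDensity a b ε z p)
        + 2 * (∫ p in frontier U ∩ coneExterior m n, boundaryDensity a b ε U 𝒩 z p
          ∂(inducedSurfaceMeasure 𝒩)) := by
  have h1 := h.integrableOn_firstOrderDensity
  have h0 := h.integrableOn_zeroOrderDensity
  have hi : IntegrableOn (fun p => 1 / 16 * (ε * firstOrderDensity a b ε z p
      + b * a ^ 2 * zeroOrderDensity a b ε z p)) (U ∩ coneExterior m n) :=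
    ((h1.const_mul ε).add (h0.const_mul (b * a ^ 2))).const_mul (1 / 16)
  have hmono := setIntegral_mono_on (hi.sub (hbox.const_mul (1 / (4 * a))))
    (h.integrableOn_divergence hbox) h.isOpen_interior.measurableSet fun p hp => by
      rw [h.divergence_currentField hp.1]
      exact densities_le_divergence h.one_le_left h.one_le_right h.sq_le_a h.eps_pos h.b_pos
        h.eps_le hp.2 (h.b_mul_le (interior_subset U hp)) (h.contDiffAt hp.1)
  rw [h.integral_divergence_currentField hbox] at hmono
  simp only [Pi.sub_apply] at hmono
  rw [integral_sub hi (hbox.const_mul _), integral_const_mul, integral_const_mul,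
    integral_add (h1.const_mul _) (h0.const_mul _), integral_const_mul, integral_const_mul]
    at hmono
  have ha : 0 < a := by linarith [h.four_le_a]
  have e : 1 / a * (∫ p in U ∩ coneExterior m n, boxDensity a b ε z p) =
      4 * (1 / (4 * a) * ∫ p in U ∩ coneExterior m n, boxDensity a b ε z p) := by
    field_simp
  rw [e]
  linarith

end IsCarlemanData

end Ultrahyperbolic

end

theorem mainTheorem3 :
    ∃ κ : ℝ, 0 < κ ∧ ∀ m n : ℕ, 1 ≤ m → 1 ≤ n →
      ∃ c C C' : ℝ, 0 < c ∧ 0 < C ∧ 0 < C' ∧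
        ∀ (U : Set (Ultrahyperbolic.Spacetime m n)) (R ε a b : ℝ)
          (𝒩 : Ultrahyperbolic.Spacetime m n → Ultrahyperbolic.Spacetime m n),
          IsOpen U → 0 < R →
          U ∩ Ultrahyperbolic.coneExterior m n ⊆ {p | Ultrahyperbolic.rad p < R} →
          Ultrahyperbolic.HasSmoothBoundary U →
          Ultrahyperbolic.HasTimelikeBoundary U →
          (∀ p ∈ frontier U, Ultrahyperbolic.IsOuterUnitNormal U p (𝒩 p)) →
          0 < ε → 0 < b → ((m : ℝ) + n) ^ 2 ≤ a → ε ≤ c * b → b ≤ κ * R⁻¹ →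
          ∀ z : Ultrahyperbolic.Spacetime m n → ℝ,
            ContDiffOn ℝ 2 z U → ContDiffOn ℝ 1 z (closure U) →
            (∀ p ∈ frontier U ∩ Ultrahyperbolic.coneExterior m n, z p = 0) →
            IntegrableOn (Ultrahyperbolic.firstOrderDensity a b ε z)
                (U ∩ Ultrahyperbolic.coneExterior m n) ∧
              IntegrableOn (Ultrahyperbolic.zeroOrderDensity a b ε z)
                (U ∩ Ultrahyperbolic.coneExterior m n) ∧
              IntegrableOn (Ultrahyperbolic.boundaryDensity a b ε U 𝒩 z)
                (frontier U ∩ Ultrahyperbolic.coneExterior m n)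
                (Ultrahyperbolic.inducedSurfaceMeasure 𝒩) ∧
              (IntegrableOn (Ultrahyperbolic.boxDensity a b ε z)
                  (U ∩ Ultrahyperbolic.coneExterior m n) →
                C * ε * (∫ p in U ∩ Ultrahyperbolic.coneExterior m n,
                      Ultrahyperbolic.firstOrderDensity a b ε z p)
                    + C * b * a ^ 2 * (∫ p in U ∩ Ultrahyperbolic.coneExterior m n,
                      Ultrahyperbolic.zeroOrderDensity a b ε z p)
                  ≤ 1 / a * (∫ p in U ∩ Ultrahyperbolic.coneExterior m n,
                      Ultrahyperbolic.boxDensity a b ε z p)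
                    + C' * (∫ p in frontier U ∩ Ultrahyperbolic.coneExterior m n,
                      Ultrahyperbolic.boundaryDensity a b ε U 𝒩 z p
                        ∂(Ultrahyperbolic.inducedSurfaceMeasure 𝒩))) := by
  -- With `κ = 1` and `c = 1 / 100` one has `b r ≤ 1` and `ε r ≤ 1 / 100` on the domain. The factors
  -- `1 / 4` and `2` are those of the pointwise estimate and of the flux, `1 / 16` and `1 / 2`, times
  -- the `4` that normalizes the source term.
  refine ⟨1, one_pos, fun m n hm hn => ⟨1 / 100, 1 / 4, 2, by norm_num, by norm_num, by norm_num, ?_⟩⟩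
  intro U R ε a b 𝒩 hU hR hUR hs _ hN hε hb ha hεb hbR z hz2 hz1 hz0
  have h : Ultrahyperbolic.IsCarlemanData U 𝒩 a b ε R z :=
    { one_le_left := hm, one_le_right := hn, isOpen := hU, smooth := hs, normal := hN
      rad_lt := hUR, R_pos := hR, eps_pos := hε, b_pos := hb, sq_le_a := ha
      eps_le := by linarith
      b_le := by linarith
      contDiffOn := hz2, contDiffOn_closure := hz1, zero := hz0 }
  exact ⟨h.integrableOn_firstOrderDensity, h.integrableOn_zeroOrderDensity,
    h.integrableOn_boundaryDensity, fun hbox => h.estimate hbox⟩
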